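/- **Theorem.** Let $n\ge 1$ and let $G(\mathbb H)=\mathbb H^n\times\operatorname{Im}\mathbb H$ be the quaternionic Heisenberg group, with group law $(q_0,\omega_0)\circ(q,\omega)=(q_0+q,\ \omega_0+\omega+2\operatorname{Im} q_0\bar q)$, where $q_0\bar q=\sum_{\alpha} q_0^\alpha\overline{q^\alpha}$, and with its standard quaternionic contact (qc) form $\tilde\Theta=\tfrac12(d\omega-q\cdot d\bar q+dq\cdot\bar q)$. Let $\Omega\subseteq G(\mathbb H)$ be a connected open set (for instance $\Omega=G(\mathbb H)$), let $h$ be a positive smooth function on $\Omega$, and consider the qc structure on $\Omega$ defined by the conformal deformation $\Theta=\frac1{2h}\tilde\Theta$. Let $R$ be the curvature of its Biquard connection, let $g$ be its horizontal metric on $H=\operatorname{Ker}\Theta$ (normalized by $2g(I_sX,Y)=d\Theta_s(X,Y)$), and, for a $g$-orthonormal basis $(e_a)$ of $H$, let $\mathrm{Ric}(X,Y)=\sum_b g(R(e_b,X)Y,e_b)$ and $S_\Theta=\sum_a\mathrm{Ric}(e_a,e_a)$. Suppose that $\Theta$ is qc-Einstein, that is, $\mathrm{Ric}(X,Y)=\frac{S_\Theta}{4n}g(X,Y)$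 for all $X,Y\in H$; if $n=1$, suppose in addition that $S_\Theta$ is constant. Then one of the following holds. 1. There are constants $c_0>0$, $\sigma\in\mathbb R$ and a point $(q_0,\omega_0)\in G(\mathbb H)$ such that $$h(q,\omega)=c_0\Big[\big(\sigma+|q+q_0|^2\big)^2+\big|\omega+\omega_0+2\operatorname{Im}q_0\bar q\big|^2\Big]\quad\text{on }\Omega,$$ that is, up to a left translation $h=c_0[(\sigma+|q|^2)^2+|\omega|^2]$; and $S_\Theta=128\,n(n+2)\,c_0\,\sigma$. 2. There are $a\in\mathbb H$ and $c=(c^1,\dots,c^n)\in\mathbb H^n$ such that $h(q,\omega)=\big|a+\sum_\alpha c^\alpha\overline{q^\alpha}\big|^2$ on $\Omega$; and $S_\Theta=-32\,n(n+2)\,|c|^2$. If $\Omega=G(\mathbb H)$, then $c=0$, so that $h$ is constant and $S_\Theta=0$. -/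

import Mathlib

open scoped Quaternion ContDiff

noncomputable section

namespace QC

section General

/-! Quaternionic contact geometry on an open subset `Ω` of a real vector space `E`, in the
linear chart `E`. Tensor fields and connections are functions on `E` of which only the values on
`Ω` matter. -/

variable {E : Type*} [NormedAddCommGroup E] [NormedSpace ℝ E]

/-- The exterior derivative `dα(X, Y)` of a 1-form `α` at `p`
(normalised by `dα(X, Y) = X α(Y) - Y α(X) - α([X, Y])`). -/
def dForm (α : E → E →L[ℝ] ℝ) (p X Y : E) : ℝ :=
  fderiv ℝ α p X Y - fderiv ℝ α p Y X

/-- The horizontal space `H_p = ⋂ₛ Ker ηₛ(p)`. -/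
def horizontal (η : Fin 3 → E → E →L[ℝ] ℝ) (p : E) : Submodule ℝ E :=
  ⨅ s, LinearMap.ker (η s p : E →ₗ[ℝ] ℝ)

/-- `∇_v Y` at `p` for the linear connection `∇ = D + Γ`. -/
def covDeriv (Γ : E → E →L[ℝ] E →L[ℝ] E) (Y : E → E) (p v : E) : E :=
  fderiv ℝ Y p v + Γ p v (Y p)

/-- The torsion `T(A, B) = ∇_A B - ∇_B A - [A, B]` of `∇ = D + Γ`
(computed on constant vector fields). -/
def torsion (Γ : E → E →L[ℝ] E →L[ℝ] E) (p A B : E) : E :=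
  Γ p A B - Γ p B A

/-- The curvature `R(A, B)C = [∇_A, ∇_B]C - ∇_{[A, B]}C` of `∇ = D + Γ`
(computed on constant vector fields, for which `∇_B C = Γ(B, C)` and `[A, B] = 0`). -/
def curvature (Γ : E → E →L[ℝ] E →L[ℝ] E) (p A B C : E) : E :=
  covDeriv Γ (fun x => Γ x B C) p A - covDeriv Γ (fun x => Γ x A C) p B

/-- A quaternionic contact structure on `Ω ⊆ E`, `dim E = 4n + 3`, with contact form
`η = (η₁, η₂, η₃)`: a metric `g` and endomorphisms `I₁, I₂, I₃` of the horizontal bundle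
`H = ⋂ₛ Ker ηₛ` satisfying the quaternion relations and `2 g(Iₛ X, Y) = dηₛ(X, Y)`, together with
the Reeb vector fields `ξ₁, ξ₂, ξ₃`. As usual `g` stands also for its extension
`g + ∑ₛ ηₛ ⊗ ηₛ` to a Riemannian metric, and `Iₛ` is extended by zero on the vertical space
`V = span (ξ₁, ξ₂, ξ₃)`. All these data are determined by `η` on `Ω`. -/
structure QCStructure (n : ℕ) (Ω : Set E) (η : Fin 3 → E → E →L[ℝ] ℝ) where
  finrank_eq : Module.finrank ℝ E = 4 * n + 3
  isOpen : IsOpen Ω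
  g : E → E →L[ℝ] E →L[ℝ] ℝ
  I : Fin 3 → E → E →L[ℝ] E
  ξ : Fin 3 → E → E
  contDiffOn_η : ∀ s, ContDiffOn ℝ ∞ (η s) Ω
  contDiffOn_g : ContDiffOn ℝ ∞ g Ω
  contDiffOn_I : ∀ s, ContDiffOn ℝ ∞ (I s) Ω
  contDiffOn_ξ : ∀ s, ContDiffOn ℝ ∞ (ξ s) Ω
  -- the Reeb vector fields
  reeb_dual : ∀ p ∈ Ω, ∀ s t, η s p (ξ t p) = if s = t then 1 else 0
  reeb_skew : ∀ p ∈ Ω, ∀ s t, ∀ X ∈ horizontal η p,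
    dForm (η t) p (ξ s p) X = - dForm (η s) p (ξ t p) X
  -- the metric
  g_symm : ∀ p ∈ Ω, ∀ X Y, g p X Y = g p Y X
  g_pos : ∀ p ∈ Ω, ∀ X ∈ horizontal η p, X ≠ 0 → 0 < g p X X
  g_reeb : ∀ p ∈ Ω, ∀ s v, g p (ξ s p) v = η s p v
  -- the almost complex structures
  I_mem : ∀ p ∈ Ω, ∀ s, ∀ X ∈ horizontal η p, I s p X ∈ horizontal η p
  I_reeb : ∀ p ∈ Ω, ∀ s t, I s p (ξ t p) = 0
  I_sq : ∀ p ∈ Ω, ∀ s, ∀ X ∈ horizontal η p, I s p (I s p X) = - X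
  I_mul : ∀ p ∈ Ω, ∀ X ∈ horizontal η p, I 0 p (I 1 p X) = I 2 p X
  I_anticomm : ∀ p ∈ Ω, ∀ X ∈ horizontal η p, I 1 p (I 0 p X) = - I 2 p X
  -- compatibility
  g_I : ∀ p ∈ Ω, ∀ s, ∀ X ∈ horizontal η p, ∀ Y ∈ horizontal η p,
    g p (I s p X) (I s p Y) = g p X Y
  two_g_I : ∀ p ∈ Ω, ∀ s, ∀ X ∈ horizontal η p, ∀ Y ∈ horizontal η p,
    2 * g p (I s p X) Y = dForm (η s) p X Y

variable {n : ℕ} {Ω : Set E} {η : Fin 3 → E → E →L[ℝ] ℝ}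

namespace QCStructure

/-- `e` is an orthonormal basis of the horizontal space `H_p` (which has dimension `4n`). -/
def IsFrame (Q : QCStructure n Ω η) (p : E) (e : Fin (4 * n) → E) : Prop :=
  (∀ a, e a ∈ horizontal η p) ∧ ∀ a b, Q.g p (e a) (e b) = if a = b then 1 else 0

/-- `A` restricts to an element of `sp(n) ⊂ End(H_p)`: a skew-symmetric endomorphism of `H_p`
that commutes with `I₁, I₂, I₃`. -/
def IsSp (Q : QCStructure n Ω η) (p : E) (A : E →L[ℝ] E) : Prop :=
  (∀ X ∈ horizontal η p, A X ∈ horizontal η p) ∧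
  (∀ X ∈ horizontal η p, ∀ Y ∈ horizontal η p, Q.g p (A X) Y = - Q.g p X (A Y)) ∧
  ∀ s, ∀ X ∈ horizontal η p, A (Q.I s p X) = Q.I s p (A X)

/-- `∇ = D + Γ` is the Biquard connection of the qc structure. -/
structure IsBiquardConnection (Q : QCStructure n Ω η) (Γ : E → E →L[ℝ] E →L[ℝ] E) : Prop where
  contDiffOn : ContDiffOn ℝ ∞ Γ Ω
  /-- `H` is parallel: `(∇_v ηₛ)(X) = 0` for horizontal `X`, i.e. `∇_v` maps sections of `H` to
  sections of `H`. -/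
  horizontal_parallel : ∀ p ∈ Ω, ∀ v, ∀ X ∈ horizontal η p, ∀ s,
    fderiv ℝ (η s) p v X - η s p (Γ p v X) = 0
  /-- `V` is parallel. -/
  vertical_parallel : ∀ p ∈ Ω, ∀ v s,
    covDeriv Γ (Q.ξ s) p v ∈ Submodule.span ℝ (Set.range fun t => Q.ξ t p)
  /-- The horizontal metric is parallel: `(∇_v g)(X, Y) = 0`. -/
  metric_parallel : ∀ p ∈ Ω, ∀ v, ∀ X ∈ horizontal η p, ∀ Y ∈ horizontal η p,
    fderiv ℝ Q.g p v X Y - Q.g p (Γ p v X) Y - Q.g p X (Γ p v Y) = 0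
  /-- The bundle spanned by `I₁, I₂, I₃` is parallel: `∇_v Iₛ = ∑ₜ aₛₜ Iₜ` on `H`. -/
  quaternionic_parallel : ∀ p ∈ Ω, ∀ v, ∃ a : Fin 3 → Fin 3 → ℝ, ∀ s, ∀ X ∈ horizontal η p,
    fderiv ℝ (Q.I s) p v X + Γ p v (Q.I s p X) - Q.I s p (Γ p v X) = ∑ t, a s t • Q.I t p X
  /-- `T(X, Y) = -[X, Y]_V = ∑ₛ dηₛ(X, Y) ξₛ` for horizontal `X`, `Y`. -/
  torsion_horizontal : ∀ p ∈ Ω, ∀ X ∈ horizontal η p, ∀ Y ∈ horizontal η p,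
    torsion Γ p X Y = ∑ s, dForm (η s) p X Y • Q.ξ s p
  /-- `T(ξ, X)` is horizontal for vertical `ξ` and horizontal `X`. -/
  torsion_vertical : ∀ p ∈ Ω, ∀ s, ∀ X ∈ horizontal η p,
    torsion Γ p (Q.ξ s p) X ∈ horizontal η p
  /-- `T_ξ` is orthogonal to `sp(n)` in `End(H)`. -/
  torsion_perp_sp : ∀ p ∈ Ω, ∀ s, ∀ e, Q.IsFrame p e → ∀ A, Q.IsSp p A →
    ∑ a, Q.g p (torsion Γ p (Q.ξ s p) (e a)) (A (e a)) = 0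
  /-- `T_ξ` is orthogonal to `sp(1) = span (I₁, I₂, I₃)` in `End(H)`. -/
  torsion_perp_sp_one : ∀ p ∈ Ω, ∀ s, ∀ e, Q.IsFrame p e → ∀ t,
    ∑ a, Q.g p (torsion Γ p (Q.ξ s p) (e a)) (Q.I t p (e a)) = 0

/-- The qc-Ricci tensor `Ric(A, B) = ∑_b R(e_b, A, B, e_b)`, where
`R(A, B, C, D) = g(R(A, B)C, D)`; `e` is an orthonormal basis of `H_p`. -/
def ricci (Q : QCStructure n Ω η) (Γ : E → E →L[ℝ] E →L[ℝ] E) (p : E) (e : Fin (4 * n) → E)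
    (A B : E) : ℝ :=
  ∑ b, Q.g p (curvature Γ p (e b) A B) (e b)

/-- The qc-scalar curvature `S = ∑_{a, b} R(e_b, e_a, e_a, e_b)` at `p`. -/
def scal (Q : QCStructure n Ω η) (Γ : E → E →L[ℝ] E →L[ℝ] E) (p : E) (e : Fin (4 * n) → E) : ℝ :=
  ∑ a, Q.ricci Γ p e (e a) (e a)

/-- The qc structure with Biquard connection `∇ = D + Γ` is qc-Einstein:
`Ric(X, Y) = (S / 4n) g(X, Y)` for horizontal `X`, `Y`. -/
def IsQCEinstein (Q : QCStructure n Ω η) (Γ : E → E →L[ℝ] E →L[ℝ] E) : Prop :=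
  ∀ p ∈ Ω, ∀ e, Q.IsFrame p e → ∀ X ∈ horizontal η p, ∀ Y ∈ horizontal η p,
    Q.ricci Γ p e X Y = Q.scal Γ p e / (4 * n) * Q.g p X Y

/-- The qc-scalar curvature is equal to the constant `k` on `Ω`. -/
def HasConstantScal (Q : QCStructure n Ω η) (Γ : E → E →L[ℝ] E →L[ℝ] E) (k : ℝ) : Prop :=
  ∀ p ∈ Ω, ∀ e, Q.IsFrame p e → Q.scal Γ p e = k

end QCStructure

end General

/-- The space `ℍⁿ × Im ℍ` underlying the quaternionic Heisenberg group, in real coordinates: a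
point `(q, ω)` consists of the real components `(tᵅ, xᵅ, yᵅ, zᵅ)` of the quaternions
`qᵅ = tᵅ + xᵅ i + yᵅ j + zᵅ k` and the components `(x, y, z)` of `ω = x i + y j + z k`. -/
abbrev QHeis (n : ℕ) : Type := (Fin n → Fin 4 → ℝ) × (Fin 3 → ℝ)

/-- The quaternionic coordinates `q = (q¹, …, qⁿ)` of the point `(q, ω)`. -/
def qcoord {n : ℕ} (p : QHeis n) (i : Fin n) : ℍ[ℝ] :=
  ⟨p.1 i 0, p.1 i 1, p.1 i 2, p.1 i 3⟩

/-- The three components of the imaginary part of a quaternion. -/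
def im (s : Fin 3) (a : ℍ[ℝ]) : ℝ := ![a.imI, a.imJ, a.imK] s

theorem qcoord_add {n : ℕ} (p v : QHeis n) (i : Fin n) :
    qcoord (p + v) i = qcoord p i + qcoord v i := by
  ext <;> rfl

theorem qcoord_smul {n : ℕ} (c : ℝ) (p : QHeis n) (i : Fin n) :
    qcoord (c • p) i = c • qcoord p i := by
  ext <;> rfl

theorem im_add (s : Fin 3) (a b : ℍ[ℝ]) : im s (a + b) = im s a + im s b := by
  fin_cases s <;> simp [im]

theorem im_smul (s : Fin 3) (c : ℝ) (a : ℍ[ℝ]) : im s (c • a) = c * im s a := by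
  fin_cases s <;> simp [im]

/-- The components of the standard contact form
`Θ̃ = ½ (dω - q · dq̄ + dq · q̄) = ½ dω + Im (dq · q̄)` on `ℍⁿ × Im ℍ`. -/
def stdForm (n : ℕ) (s : Fin 3) (p : QHeis n) : QHeis n →L[ℝ] ℝ :=
  LinearMap.toContinuousLinearMap
    { toFun := fun v => 1 / 2 * v.2 s + im s (∑ i, qcoord v i * star (qcoord p i))
      map_add' := by
        intro v w
        simp only [qcoord_add, add_mul, Finset.sum_add_distrib, im_add, Prod.snd_add, Pi.add_apply]
        ring
      map_smul' := by
        intro c v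
        simp only [qcoord_smul, smul_mul_assoc, ← Finset.smul_sum, im_smul, Prod.smul_snd,
          Pi.smul_apply, smul_eq_mul, RingHom.id_apply]
        ring }

/-- The conformal deformation `Θ = (1 / 2h) Θ̃`. -/
def confForm {n : ℕ} (h : QHeis n → ℝ) (s : Fin 3) (p : QHeis n) : QHeis n →L[ℝ] ℝ :=
  (1 / (2 * h p)) • stdForm n s p

end QC

end

noncomputable section

/-!
In the left-invariant frame of the Heisenberg group, the metric, the almost complex structures and
the Reeb fields `ξₛ` of `Θ = (1 / 2h) Θ̃` are determined by `h` and its horizontal gradient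
`u = ∇h`. Metricity and the vanishing of the horizontal torsion determine the Biquard connection
in horizontal directions by Koszul's formula; that the torsion along the Reeb fields is orthogonal
to `sp(n) ⊕ sp(1)` determines those traces of the vertical part which enter the Ricci tensor.
Writing `(A, u) = ∑ᵢ Aᵢ u̅ᵢ`, the qc-Einstein condition becomes the equation
`D_A u = M A + (2h)⁻¹ (A, u) u` with `M = λ - ∑ₛ (ξₛ h) eₛ` for a real function `λ`. The commutation
relations of the horizontal fields, together with the constancy of the scalar curvature if `n = 1`,
then give `D_A M = (2h)⁻¹ (A, u) M`.

This closed system is integrated explicitly, `|M|² / (2h)` being constant. If the constant is not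
zero, then `M̅ u / (2h)` is a multiple of `q + q₀`, so that `M` is a multiple of
`σ + |q + q₀|² - (ω + ω₀ + 2 Im q₀ q̄)` and `h` is a multiple of `|M|²`. If `M = 0`, then the Gram
matrix `u̅ᵢ uⱼ / (2h)` is constant, and it follows that `h = |a + ∑ᵢ cᵢ q̄ᵢ|²`.
-/

namespace QC

variable {n : ℕ}

/-! ### The left `ℍ`-module `ℍⁿ` -/

section QuaternionicSpace

/-- The imaginary units `i`, `j`, `k` of `ℍ`, indexed as the components of `im`. -/
def imUnit (s : Fin 3) : ℍ[ℝ] := ![⟨0, 1, 0, 0⟩, ⟨0, 0, 1, 0⟩, ⟨0, 0, 0, 1⟩] s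

/-- The real basis `1`, `i`, `j`, `k` of `ℍ`. -/
def quatBasis (t : Fin 4) : ℍ[ℝ] := ![1, ⟨0, 1, 0, 0⟩, ⟨0, 0, 1, 0⟩, ⟨0, 0, 0, 1⟩] t

@[simp] theorem re_imUnit_zero : (imUnit 0).re = 0 := rfl
@[simp] theorem imI_imUnit_zero : (imUnit 0).imI = 1 := rfl
@[simp] theorem imJ_imUnit_zero : (imUnit 0).imJ = 0 := rfl
@[simp] theorem imK_imUnit_zero : (imUnit 0).imK = 0 := rfl
@[simp] theorem re_imUnit_one : (imUnit 1).re = 0 := rfl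
@[simp] theorem imI_imUnit_one : (imUnit 1).imI = 0 := rfl
@[simp] theorem imJ_imUnit_one : (imUnit 1).imJ = 1 := rfl
@[simp] theorem imK_imUnit_one : (imUnit 1).imK = 0 := rfl
@[simp] theorem re_imUnit_two : (imUnit 2).re = 0 := rfl
@[simp] theorem imI_imUnit_two : (imUnit 2).imI = 0 := rfl
@[simp] theorem imJ_imUnit_two : (imUnit 2).imJ = 0 := rfl
@[simp] theorem imK_imUnit_two : (imUnit 2).imK = 1 := rfl
@[simp] theorem quatBasis_zero : quatBasis 0 = 1 := rfl
@[simp] theorem quatBasis_one : quatBasis 1 = imUnit 0 := rfl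
@[simp] theorem quatBasis_two : quatBasis 2 = imUnit 1 := rfl
@[simp] theorem quatBasis_three : quatBasis 3 = imUnit 2 := rfl
@[simp] theorem im_zero (a : ℍ[ℝ]) : im 0 a = a.imI := rfl
@[simp] theorem im_one (a : ℍ[ℝ]) : im 1 a = a.imJ := rfl
@[simp] theorem im_two (a : ℍ[ℝ]) : im 2 a = a.imK := rfl

theorem quatBasis_succ (s : Fin 3) : quatBasis s.succ = imUnit s := by fin_cases s <;> rfl

theorem imUnit_mul_self (s : Fin 3) : imUnit s * imUnit s = -1 := by
  fin_cases s <;> ext <;> simp [Quaternion.re_mul, Quaternion.imI_mul, Quaternion.imJ_mul,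
    Quaternion.imK_mul]

theorem imUnit_smul_imUnit_smul {ι : Type*} (s : Fin 3) (X : ι → ℍ[ℝ]) :
    imUnit s • imUnit s • X = -X := by
  rw [smul_smul, imUnit_mul_self, neg_one_smul]

instance : StarModule ℝ ℍ[ℝ] := ⟨fun _ _ => by ext <;> simp⟩

theorem im_apply_zero (s : Fin 3) : im s 0 = 0 := by fin_cases s <;> rfl

theorem im_sub (s : Fin 3) (a b : ℍ[ℝ]) : im s (a - b) = im s a - im s b := by
  fin_cases s <;> simp

theorem im_star (s : Fin 3) (a : ℍ[ℝ]) : im s (star a) = -im s a := by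
  fin_cases s <;> simp

theorem re_add_sum_im_mul_imUnit (a : ℍ[ℝ]) :
    (a.re : ℍ[ℝ]) + ∑ s, (im s a : ℍ[ℝ]) * imUnit s = a := by
  ext <;> simp [Fin.sum_univ_three]

theorem re_sum {α : Type*} (s : Finset α) (f : α → ℍ[ℝ]) :
    (∑ i ∈ s, f i).re = ∑ i ∈ s, (f i).re :=
  map_sum (QuaternionAlgebra.reₗ _ _ _) f s

theorem coe_sum {α : Type*} (s : Finset α) (f : α → ℝ) :
    ((∑ i ∈ s, f i : ℝ) : ℍ[ℝ]) = ∑ i ∈ s, (f i : ℍ[ℝ]) :=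
  map_sum (algebraMap ℝ ℍ[ℝ]) f s

theorem re_mul_comm (a b : ℍ[ℝ]) : (a * b).re = (b * a).re := by
  simp only [Quaternion.re_mul]; ring

theorem normSq_eq_re (a : ℍ[ℝ]) : Quaternion.normSq a = (a * star a).re := by
  rw [Quaternion.self_mul_star, Quaternion.re_coe]

variable {ι : Type*} [Fintype ι]

/-- The quaternionic Hermitian form `∑ᵢ Xᵢ Y̅ᵢ`, linear over `ℍ` in the first variable. -/
def qinner (X Y : ι → ℍ[ℝ]) : ℍ[ℝ] := X ⬝ᵥ star Y

/-- The Euclidean inner product `Re ∑ᵢ Xᵢ Y̅ᵢ` of `ℍⁿ`. The norm that `ι → ℍ` carries as a product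
is not the Euclidean one, so this is not an instance of `inner`. -/
def rinner (X Y : ι → ℍ[ℝ]) : ℝ := (qinner X Y).re

section Hermitian

variable (X Y Z : ι → ℍ[ℝ]) (a : ℍ[ℝ]) (r : ℝ)

theorem qinner_eq_sum : qinner X Y = ∑ i, X i * star (Y i) := rfl

theorem qinner_add_left : qinner (X + Y) Z = qinner X Z + qinner Y Z := add_dotProduct _ _ _

theorem qinner_add_right : qinner X (Y + Z) = qinner X Y + qinner X Z := by
  rw [qinner, star_add, dotProduct_add]; rfl

theorem qinner_neg_left : qinner (-X) Y = -qinner X Y := neg_dotProduct _ _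

theorem qinner_neg_right : qinner X (-Y) = -qinner X Y := by
  rw [qinner, star_neg, dotProduct_neg]; rfl

theorem qinner_sub_left : qinner (X - Y) Z = qinner X Z - qinner Y Z := sub_dotProduct _ _ _

theorem qinner_smul_left : qinner (a • X) Y = a * qinner X Y := smul_dotProduct _ _ _

theorem qinner_smul_right : qinner X (a • Y) = qinner X Y * star a := by
  simp [qinner_eq_sum, Finset.sum_mul, mul_assoc]

theorem qinner_real_smul_left : qinner (r • X) Y = r • qinner X Y := smul_dotProduct _ _ _

theorem qinner_real_smul_right : qinner X (r • Y) = r • qinner X Y := by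
  rw [qinner, star_smul, star_trivial, dotProduct_smul]; rfl

@[simp] theorem qinner_zero_left : qinner 0 Y = 0 := zero_dotProduct _

@[simp] theorem qinner_zero_right : qinner X 0 = 0 := by rw [qinner, star_zero, dotProduct_zero]

theorem star_qinner : star (qinner X Y) = qinner Y X := by simp [qinner_eq_sum]

theorem rinner_comm : rinner X Y = rinner Y X := by
  rw [rinner, rinner, ← star_qinner X Y, Quaternion.re_star]

theorem qinner_self : qinner X X = ((rinner X X : ℝ) : ℍ[ℝ]) :=
  Quaternion.star_eq_self.1 (star_qinner X X)

theorem rinner_self_eq_sum : rinner X X = ∑ i, ‖X i‖ ^ 2 := by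
  simp only [rinner, qinner_eq_sum, re_sum, Quaternion.self_mul_star, Quaternion.re_coe,
    Quaternion.normSq_eq_norm_mul_self, sq]

theorem rinner_self_nonneg : 0 ≤ rinner X X := by
  rw [rinner_self_eq_sum]; positivity

theorem rinner_self_eq_zero {X : ι → ℍ[ℝ]} : rinner X X = 0 ↔ X = 0 := by
  rw [rinner_self_eq_sum, Finset.sum_eq_zero_iff_of_nonneg fun i _ => by positivity]
  simp [funext_iff]

theorem rinner_self_pos {X : ι → ℍ[ℝ]} (h : X ≠ 0) : 0 < rinner X X :=
  (rinner_self_nonneg X).lt_of_ne fun h' => h (rinner_self_eq_zero.1 h'.symm)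

theorem rinner_add_left : rinner (X + Y) Z = rinner X Z + rinner Y Z := by
  simp [rinner, qinner_add_left]

theorem rinner_add_right : rinner X (Y + Z) = rinner X Y + rinner X Z := by
  simp [rinner, qinner_add_right]

theorem rinner_neg_left : rinner (-X) Y = -rinner X Y := by simp [rinner, qinner_neg_left]

theorem rinner_neg_right : rinner X (-Y) = -rinner X Y := by simp [rinner, qinner_neg_right]

theorem rinner_sub_left : rinner (X - Y) Z = rinner X Z - rinner Y Z := by
  simp [rinner, qinner_sub_left]

theorem rinner_real_smul_left : rinner (r • X) Y = r * rinner X Y := by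
  simp [rinner, qinner_real_smul_left]

theorem rinner_real_smul_right : rinner X (r • Y) = r * rinner X Y := by
  simp [rinner, qinner_real_smul_right]

theorem rinner_smul_left : rinner (a • X) Y = (a * qinner X Y).re := by
  rw [rinner, qinner_smul_left]

theorem rinner_smul_right : rinner X (a • Y) = rinner (star a • X) Y := by
  rw [rinner, qinner_smul_right, re_mul_comm, rinner_smul_left]

@[simp] theorem rinner_zero_left : rinner 0 Y = 0 := by simp [rinner]

@[simp] theorem rinner_zero_right : rinner X 0 = 0 := by simp [rinner]

theorem rinner_sum_left {α : Type*} (s : Finset α) (f : α → ι → ℍ[ℝ]) :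
    rinner (∑ i ∈ s, f i) Y = ∑ i ∈ s, rinner (f i) Y := by
  rw [rinner, qinner, sum_dotProduct, re_sum]; rfl

theorem rinner_ext {X Y : ι → ℍ[ℝ]} (h : ∀ Z, rinner X Z = rinner Y Z) : X = Y := by
  rw [← sub_eq_zero, ← rinner_self_eq_zero, rinner_sub_left, h, sub_self]

theorem rinner_imUnit_left (s : Fin 3) : rinner (imUnit s • X) Y = -im s (qinner X Y) := by
  rw [rinner_smul_left]
  fin_cases s <;> simp [Quaternion.re_mul]

theorem rinner_imUnit_right (s : Fin 3) : rinner X (imUnit s • Y) = im s (qinner X Y) := by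
  rw [rinner, qinner_smul_right]
  fin_cases s <;> simp [Quaternion.re_mul]

theorem qinner_eq_sum_quatBasis :
    qinner X Y = ∑ t, (rinner X (quatBasis t • Y) : ℍ[ℝ]) * quatBasis t := by
  rw [Fin.sum_univ_succ]
  simp only [quatBasis_succ, rinner_imUnit_right, quatBasis_zero, one_smul, mul_one]
  exact (re_add_sum_im_mul_imUnit (qinner X Y)).symm

end Hermitian

theorem im_qinner_comm (s : Fin 3) (X Y : ι → ℍ[ℝ]) :
    im s (qinner X Y) = -im s (qinner Y X) := by
  rw [← star_qinner, im_star]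

section StandardBasis

variable [DecidableEq ι]

/-- The standard real basis of `ℍⁿ`, orthonormal for `rinner`. -/
def stdBasis (k : ι × Fin 4) : ι → ℍ[ℝ] := Pi.single k.1 (quatBasis k.2)

theorem qinner_single_left (i : ι) (a : ℍ[ℝ]) (Y : ι → ℍ[ℝ]) :
    qinner (Pi.single i a) Y = a * star (Y i) := single_dotProduct _ _ _

theorem qinner_single_right (i : ι) (a : ℍ[ℝ]) (Y : ι → ℍ[ℝ]) :
    qinner Y (Pi.single i a) = Y i * star a := by
  rw [← star_qinner, qinner_single_left, star_mul, star_star]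

theorem sum_rinner_smul_stdBasis (X : ι → ℍ[ℝ]) :
    ∑ k, rinner X (stdBasis k) • stdBasis k = X := by
  rw [Fintype.sum_prod_type]
  ext1 j
  simp only [stdBasis, rinner, qinner_single_right, Finset.sum_apply, Pi.smul_apply]
  rw [Finset.sum_eq_single j]
  · ext <;> simp [Fin.sum_univ_four, Quaternion.re_mul]
  · intro i _ hij
    simp [hij.symm]
  · simp

theorem sum_rinner_smul_map_stdBasis {F : Type*} [AddCommGroup F] [Module ℝ F]
    (K : (ι → ℍ[ℝ]) →ₗ[ℝ] F) (X : ι → ℍ[ℝ]) :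
    ∑ k, rinner X (stdBasis k) • K (stdBasis k) = K X := by
  conv_rhs => rw [← sum_rinner_smul_stdBasis X]
  simp only [map_sum, map_smul]

theorem sum_rinner_mul_rinner_stdBasis (X Y : ι → ℍ[ℝ]) :
    ∑ k, rinner X (stdBasis k) * rinner Y (stdBasis k) = rinner X Y := by
  conv_rhs => rw [← sum_rinner_smul_stdBasis X]
  rw [rinner_sum_left]
  exact Finset.sum_congr rfl fun k _ => by rw [rinner_real_smul_left, rinner_comm Y]

theorem rinner_stdBasis (k l : ι × Fin 4) :
    rinner (stdBasis k) (stdBasis l) = if k = l then 1 else 0 := by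
  obtain ⟨i, s⟩ := k
  obtain ⟨j, t⟩ := l
  rw [rinner, stdBasis, stdBasis, qinner_single_left]
  by_cases h : i = j
  · subst h
    rw [Pi.single_eq_same]
    fin_cases s <;> fin_cases t <;> simp [Quaternion.re_mul]
  · simp [h]

theorem sum_rinner_stdBasis_self :
    ∑ k : ι × Fin 4, rinner (stdBasis k) (stdBasis k) = 4 * Fintype.card ι := by
  simp [rinner_stdBasis, mul_comm]

theorem sum_qinner_mul_qinner_right (Y Z : ι → ℍ[ℝ]) (r : ℍ[ℝ]) :
    ∑ k, qinner Y (stdBasis k) * r * qinner Z (stdBasis k) =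
      (-2 : ℝ) • (qinner Y Z * star r) := by
  rw [Fintype.sum_prod_type]
  simp only [stdBasis, qinner_single_right]
  rw [qinner_eq_sum, Finset.sum_mul, Finset.smul_sum]
  refine Finset.sum_congr rfl fun i _ => ?_
  ext <;> simp [Fin.sum_univ_four, Quaternion.re_mul, Quaternion.imI_mul, Quaternion.imJ_mul,
    Quaternion.imK_mul] <;> ring

theorem sum_qinner_mul_qinner_left (Y Z : ι → ℍ[ℝ]) (r : ℍ[ℝ]) :
    ∑ k, qinner (stdBasis k) Y * r * qinner Z (stdBasis k) =
      ((4 * (r * qinner Z Y).re : ℝ) : ℍ[ℝ]) := by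
  rw [Fintype.sum_prod_type]
  simp only [stdBasis, qinner_single_right, qinner_single_left]
  rw [qinner_eq_sum, Finset.mul_sum, re_sum, Finset.mul_sum, coe_sum]
  refine Finset.sum_congr rfl fun i _ => ?_
  ext <;> simp [Fin.sum_univ_four, Quaternion.re_mul, Quaternion.imI_mul, Quaternion.imJ_mul,
    Quaternion.imK_mul] <;> ring

end StandardBasis

section OrthogonalFamily

variable {α : Type*} [Fintype α] [DecidableEq α] {κ : ℝ} {ε : α → ι → ℍ[ℝ]}

theorem sum_rinner_mul_rinner_of_orthogonal (hα : Fintype.card α = 4 * Fintype.card ι)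
    (hκ : κ ≠ 0) (hε : ∀ a b, rinner (ε a) (ε b) = if a = b then κ else 0) (X Y : ι → ℍ[ℝ]) :
    ∑ a, rinner (ε a) X * rinner (ε a) Y = κ * rinner X Y := by
  classical
  let P : Matrix α (ι × Fin 4) ℝ := Matrix.of fun a k => rinner (ε a) (stdBasis k)
  have hcard : Fintype.card α = Fintype.card (ι × Fin 4) := by simp [hα, mul_comm]
  have hPP : P * (κ⁻¹ • P.transpose) = 1 := by
    rw [Matrix.mul_smul]
    ext a b
    simp only [P, Matrix.smul_apply, Matrix.mul_apply, Matrix.transpose_apply,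
      Matrix.of_apply, sum_rinner_mul_rinner_stdBasis, hε, Matrix.one_apply]
    split_ifs <;> simp [hκ]
  have hPP' : P.transpose * P = κ • (1 : Matrix (ι × Fin 4) (ι × Fin 4) ℝ) := by
    rw [← (Matrix.mul_eq_one_comm_of_equiv (Fintype.equivOfCardEq hcard)).1 hPP, Matrix.smul_mul,
      smul_inv_smul₀ hκ]
  have hP (Z : ι → ℍ[ℝ]) : (fun a => rinner (ε a) Z) = P.mulVec fun k => rinner Z (stdBasis k) :=
    funext fun a => by rw [← sum_rinner_mul_rinner_stdBasis]; rfl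
  calc ∑ a, rinner (ε a) X * rinner (ε a) Y
      = (P.mulVec fun k => rinner X (stdBasis k)) ⬝ᵥ P.mulVec fun k => rinner Y (stdBasis k) := by
        rw [← hP, ← hP]; rfl
    _ = κ * ∑ k, rinner X (stdBasis k) * rinner Y (stdBasis k) := by
        rw [Matrix.dotProduct_mulVec, Matrix.vecMul_mulVec, hPP', Matrix.vecMul_smul,
          Matrix.vecMul_one, smul_dotProduct]; rfl
    _ = κ * rinner X Y := by rw [sum_rinner_mul_rinner_stdBasis]

theorem sum_rinner_smul_map_of_orthogonal (hα : Fintype.card α = 4 * Fintype.card ι)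
    (hκ : κ ≠ 0) (hε : ∀ a b, rinner (ε a) (ε b) = if a = b then κ else 0)
    {F : Type*} [AddCommGroup F] [Module ℝ F] (K : (ι → ℍ[ℝ]) →ₗ[ℝ] F) (X : ι → ℍ[ℝ]) :
    ∑ a, rinner (ε a) X • K (ε a) = κ • K X := by
  classical
  have hK (a : α) : K (ε a) = ∑ k, rinner (ε a) (stdBasis k) • K (stdBasis k) :=
    (sum_rinner_smul_map_stdBasis K (ε a)).symm
  simp only [hK, Finset.smul_sum, smul_smul]
  rw [Finset.sum_comm]
  simp only [← Finset.sum_smul]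
  simp only [sum_rinner_mul_rinner_of_orthogonal hα hκ hε, mul_smul, ← Finset.smul_sum,
    sum_rinner_smul_map_stdBasis]

theorem sum_diag_of_orthogonal [DecidableEq ι] (hα : Fintype.card α = 4 * Fintype.card ι)
    (hκ : κ ≠ 0) (hε : ∀ a b, rinner (ε a) (ε b) = if a = b then κ else 0)
    (β : (ι → ℍ[ℝ]) →ₗ[ℝ] (ι → ℍ[ℝ]) →ₗ[ℝ] ℝ) :
    ∑ a, β (ε a) (ε a) = κ * ∑ k, β (stdBasis k) (stdBasis k) := by
  have hβ (a : α) : β (ε a) (ε a) =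
      ∑ k, rinner (ε a) (stdBasis k) • β (stdBasis k) (ε a) := by
    simpa using (sum_rinner_smul_map_stdBasis (β.flip (ε a)) (ε a)).symm
  simp only [hβ]
  rw [Finset.sum_comm, Finset.mul_sum]
  exact Finset.sum_congr rfl fun k _ =>
    sum_rinner_smul_map_of_orthogonal hα hκ hε (β (stdBasis k)) (stdBasis k)

end OrthogonalFamily

end QuaternionicSpace

/-! ### Directional derivatives -/

section HasDirDeriv

variable {E F G H : Type*} [NormedAddCommGroup E] [NormedSpace ℝ E] [NormedAddCommGroup F]
  [NormedSpace ℝ F] [NormedAddCommGroup G] [NormedSpace ℝ G] [NormedAddCommGroup H]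
  [NormedSpace ℝ H]

/-- `f` is Fréchet differentiable at `p`, and its derivative in the direction `v` is `f'`. In
contrast to `HasLineDerivAt` this is stable under composition, and in contrast to `HasFDerivAt` it
does not name the derivatives in the other directions. -/
structure HasDirDeriv (f : E → F) (f' : F) (p v : E) : Prop where
  differentiableAt : DifferentiableAt ℝ f p
  fderiv_eq : fderiv ℝ f p v = f'

namespace HasDirDeriv

variable {p v : E}

theorem of_hasFDerivAt {f : E → F} {L : E →L[ℝ] F} (h : HasFDerivAt f L p) (v : E) :
    HasDirDeriv f (L v) p v := ⟨h.differentiableAt, by rw [h.fderiv]⟩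

theorem of_differentiableAt {f : E → F} (h : DifferentiableAt ℝ f p) (v : E) :
    HasDirDeriv f (fderiv ℝ f p v) p v := ⟨h, rfl⟩

theorem congr_deriv {f : E → F} {a b : F} (h : HasDirDeriv f a p v) (hab : a = b) :
    HasDirDeriv f b p v := hab ▸ h

theorem congr_of_isOpen {f g : E → F} {a : F} {Ω : Set E} (h : HasDirDeriv f a p v)
    (hΩ : IsOpen Ω) (hp : p ∈ Ω) (hfg : ∀ x ∈ Ω, g x = f x) : HasDirDeriv g a p v := by
  have he : g =ᶠ[nhds p] f := Filter.eventually_of_mem (hΩ.mem_nhds hp) hfg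
  exact ⟨h.differentiableAt.congr_of_eventuallyEq he, by rw [he.fderiv_eq, h.fderiv_eq]⟩

theorem unique {f g : E → F} {a b : F} {Ω : Set E} (h : HasDirDeriv f a p v)
    (h' : HasDirDeriv g b p v) (hΩ : IsOpen Ω) (hp : p ∈ Ω) (hfg : ∀ x ∈ Ω, g x = f x) : a = b :=
  (h.congr_of_isOpen hΩ hp hfg).fderiv_eq.symm.trans h'.fderiv_eq

theorem const (c : F) (p v : E) : HasDirDeriv (fun _ => c) 0 p v :=
  of_hasFDerivAt (hasFDerivAt_const c p) v

theorem clm (L : F →L[ℝ] G) {f : E → F} {a : F} (hf : HasDirDeriv f a p v) :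
    HasDirDeriv (fun x => L (f x)) (L a) p v := by
  obtain ⟨hf, rfl⟩ := hf
  exact of_hasFDerivAt (L.hasFDerivAt.comp p hf.hasFDerivAt) v

theorem linear [FiniteDimensional ℝ F] (L : F →ₗ[ℝ] G) {f : E → F} {a : F}
    (hf : HasDirDeriv f a p v) : HasDirDeriv (fun x => L (f x)) (L a) p v :=
  hf.clm L.toContinuousLinearMap

theorem add {f g : E → F} {a b : F} (hf : HasDirDeriv f a p v) (hg : HasDirDeriv g b p v) :
    HasDirDeriv (fun x => f x + g x) (a + b) p v := by
  obtain ⟨hf, rfl⟩ := hf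
  obtain ⟨hg, rfl⟩ := hg
  exact of_hasFDerivAt (hf.hasFDerivAt.add hg.hasFDerivAt) v

theorem sub {f g : E → F} {a b : F} (hf : HasDirDeriv f a p v) (hg : HasDirDeriv g b p v) :
    HasDirDeriv (fun x => f x - g x) (a - b) p v := by
  obtain ⟨hf, rfl⟩ := hf
  obtain ⟨hg, rfl⟩ := hg
  exact of_hasFDerivAt (hf.hasFDerivAt.sub hg.hasFDerivAt) v

theorem sum {ι : Type*} (s : Finset ι) {f : ι → E → F} {a : ι → F}
    (h : ∀ i, HasDirDeriv (f i) (a i) p v) :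
    HasDirDeriv (fun x => ∑ i ∈ s, f i x) (∑ i ∈ s, a i) p v :=
  (of_hasFDerivAt (HasFDerivAt.fun_sum fun i _ => (h i).differentiableAt.hasFDerivAt)
    v).congr_deriv (by simp [fun i => (h i).fderiv_eq])

theorem pi {ι : Type*} [Fintype ι] {f : E → ι → F} {a : ι → F}
    (h : ∀ i, HasDirDeriv (fun x => f x i) (a i) p v) : HasDirDeriv f a p v :=
  (of_hasFDerivAt (hasFDerivAt_pi.2 fun i => (h i).differentiableAt.hasFDerivAt) v).congr_deriv
    (funext fun i => (h i).fderiv_eq)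

theorem apply {ι : Type*} [Fintype ι] {f : E → ι → F} {a : ι → F}
    (h : HasDirDeriv f a p v) (i : ι) : HasDirDeriv (fun x => f x i) (a i) p v :=
  h.clm (ContinuousLinearMap.proj (R := ℝ) (φ := fun _ : ι => F) i)

theorem clm_apply {f : E → F →L[ℝ] G} {g : E → F} {a : F →L[ℝ] G} {b : F}
    (hf : HasDirDeriv f a p v) (hg : HasDirDeriv g b p v) :
    HasDirDeriv (fun x => f x (g x)) (a (g p) + f p b) p v := by
  obtain ⟨hf, rfl⟩ := hf
  obtain ⟨hg, rfl⟩ := hg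
  exact (of_hasFDerivAt (hf.hasFDerivAt.clm_apply hg.hasFDerivAt) v).congr_deriv
    (by simp [add_comm])

theorem bilinear [FiniteDimensional ℝ F] [FiniteDimensional ℝ G] (B : F →ₗ[ℝ] G →ₗ[ℝ] H)
    {f : E → F} {g : E → G} {a : F} {b : G} (hf : HasDirDeriv f a p v)
    (hg : HasDirDeriv g b p v) :
    HasDirDeriv (fun x => B (f x) (g x)) (B a (g p) + B (f p) b) p v :=
  (hf.clm B.toContinuousBilinearMap).clm_apply hg

theorem smul {f : E → ℝ} {g : E → F} {a : ℝ} {b : F}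
    (hf : HasDirDeriv f a p v) (hg : HasDirDeriv g b p v) :
    HasDirDeriv (fun x => f x • g x) (a • g p + f p • b) p v :=
  (hf.clm (ContinuousLinearMap.lsmul ℝ ℝ : ℝ →L[ℝ] F →L[ℝ] F)).clm_apply hg

theorem const_smul {g : E → F} {b : F} (r : ℝ) (hg : HasDirDeriv g b p v) :
    HasDirDeriv (fun x => r • g x) (r • b) p v := hg.clm (r • ContinuousLinearMap.id ℝ F)

theorem mul {A : Type*} [NormedRing A] [NormedAlgebra ℝ A] {f g : E → A} {a b : A}
    (hf : HasDirDeriv f a p v) (hg : HasDirDeriv g b p v) :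
    HasDirDeriv (fun x => f x * g x) (a * g p + f p * b) p v :=
  (hf.clm (ContinuousLinearMap.mul ℝ A)).clm_apply hg

theorem inv {f : E → ℝ} {a : ℝ} (hf : HasDirDeriv f a p v) (h0 : f p ≠ 0) :
    HasDirDeriv (fun x => (f x)⁻¹) (-a / f p ^ 2) p v := by
  obtain ⟨hf, rfl⟩ := hf
  refine (of_hasFDerivAt
    ((hasDerivAt_inv h0).comp_hasFDerivAt p hf.hasFDerivAt) v).congr_deriv ?_
  simp only [_root_.smul_apply, smul_eq_mul]
  ring

theorem star {f : E → ℍ[ℝ]} {a : ℍ[ℝ]} (hf : HasDirDeriv f a p v) :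
    HasDirDeriv (fun x => star (f x)) (star a) p v :=
  hf.clm (starL' ℝ : ℍ[ℝ] ≃L[ℝ] ℍ[ℝ]).toContinuousLinearMap

theorem re {f : E → ℍ[ℝ]} {a : ℍ[ℝ]} (hf : HasDirDeriv f a p v) :
    HasDirDeriv (fun x => (f x).re) a.re p v := hf.linear (QuaternionAlgebra.reₗ _ _ _)

theorem coe {f : E → ℝ} {a : ℝ} (hf : HasDirDeriv f a p v) :
    HasDirDeriv (fun x => (f x : ℍ[ℝ])) (a : ℍ[ℝ]) p v :=
  hf.linear (Algebra.linearMap ℝ ℍ[ℝ])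

section Quaternionic

variable {ι : Type*} [Fintype ι]

theorem qinner {f g : E → ι → ℍ[ℝ]} {a b : ι → ℍ[ℝ]} (hf : HasDirDeriv f a p v)
    (hg : HasDirDeriv g b p v) :
    HasDirDeriv (fun x => qinner (f x) (g x)) (qinner a (g p) + qinner (f p) b) p v := by
  refine (sum Finset.univ fun i => (hf.apply i).mul (hg.apply i).star).congr_deriv ?_
  rw [Finset.sum_add_distrib, qinner_eq_sum, qinner_eq_sum]

theorem rinner {f g : E → ι → ℍ[ℝ]} {a b : ι → ℍ[ℝ]} (hf : HasDirDeriv f a p v)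
    (hg : HasDirDeriv g b p v) :
    HasDirDeriv (fun x => rinner (f x) (g x)) (rinner a (g p) + rinner (f p) b) p v :=
  (hf.qinner hg).re

theorem quat_smul {f : E → ℍ[ℝ]} {g : E → ι → ℍ[ℝ]} {a : ℍ[ℝ]} {b : ι → ℍ[ℝ]}
    (hf : HasDirDeriv f a p v) (hg : HasDirDeriv g b p v) :
    HasDirDeriv (fun x => f x • g x) (a • g p + f p • b) p v :=
  pi fun i => hf.mul (hg.apply i)

end Quaternionic

end HasDirDeriv

end HasDirDeriv

section Smooth

variable {E : Type*} [NormedAddCommGroup E] [NormedSpace ℝ E] {Ω : Set E} {ι : Type*} [Fintype ι]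

theorem contDiffOn_linear {F G : Type*} [NormedAddCommGroup F] [NormedSpace ℝ F]
    [NormedAddCommGroup G] [NormedSpace ℝ G] [FiniteDimensional ℝ F] (L : F →ₗ[ℝ] G)
    {f : E → F} (hf : ContDiffOn ℝ ∞ f Ω) : ContDiffOn ℝ ∞ (fun x => L (f x)) Ω :=
  L.toContinuousLinearMap.contDiff.comp_contDiffOn hf

theorem contDiffOn_star {f : E → ℍ[ℝ]} (hf : ContDiffOn ℝ ∞ f Ω) :
    ContDiffOn ℝ ∞ (fun x => star (f x)) Ω :=
  (starL' ℝ : ℍ[ℝ] ≃L[ℝ] ℍ[ℝ]).contDiff.comp_contDiffOn hf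

theorem contDiffOn_re {f : E → ℍ[ℝ]} (hf : ContDiffOn ℝ ∞ f Ω) :
    ContDiffOn ℝ ∞ (fun x => (f x).re) Ω := contDiffOn_linear (QuaternionAlgebra.reₗ _ _ _) hf

theorem contDiffOn_coe {f : E → ℝ} (hf : ContDiffOn ℝ ∞ f Ω) :
    ContDiffOn ℝ ∞ (fun x => (f x : ℍ[ℝ])) Ω := contDiffOn_linear (Algebra.linearMap ℝ ℍ[ℝ]) hf

theorem contDiffOn_qinner {f g : E → ι → ℍ[ℝ]} (hf : ContDiffOn ℝ ∞ f Ω)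
    (hg : ContDiffOn ℝ ∞ g Ω) : ContDiffOn ℝ ∞ (fun x => qinner (f x) (g x)) Ω :=
  ContDiffOn.sum fun i _ => (contDiffOn_pi.1 hf i).mul (contDiffOn_star (contDiffOn_pi.1 hg i))

theorem contDiffOn_rinner {f g : E → ι → ℍ[ℝ]} (hf : ContDiffOn ℝ ∞ f Ω)
    (hg : ContDiffOn ℝ ∞ g Ω) : ContDiffOn ℝ ∞ (fun x => rinner (f x) (g x)) Ω :=
  contDiffOn_re (contDiffOn_qinner hf hg)

theorem contDiffOn_quat_smul {f : E → ℍ[ℝ]} {g : E → ι → ℍ[ℝ]} (hf : ContDiffOn ℝ ∞ f Ω)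
    (hg : ContDiffOn ℝ ∞ g Ω) : ContDiffOn ℝ ∞ (fun x => f x • g x) Ω :=
  contDiffOn_pi.2 fun i => hf.mul (contDiffOn_pi.1 hg i)

end Smooth

/-! ### Left-invariant vector fields on the quaternionic Heisenberg group -/

section LeftInvariant

/-- `qcoord` as a real linear map. -/
def qcoordLin : QHeis n →ₗ[ℝ] (Fin n → ℍ[ℝ]) where
  toFun := qcoord
  map_add' p v := funext (qcoord_add p v)
  map_smul' c p := funext (qcoord_smul c p)

theorem qcoord_map_add (p v : QHeis n) : qcoord (p + v) = qcoord p + qcoord v :=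
  map_add qcoordLin p v

theorem qcoord_map_sub (p v : QHeis n) : qcoord (p - v) = qcoord p - qcoord v :=
  map_sub qcoordLin p v

theorem qcoord_map_smul (c : ℝ) (p : QHeis n) : qcoord (c • p) = c • qcoord p :=
  map_smul qcoordLin c p

theorem qcoord_map_sum {ι : Type*} (s : Finset ι) (f : ι → QHeis n) :
    qcoord (∑ i ∈ s, f i) = ∑ i ∈ s, qcoord (f i) :=
  map_sum qcoordLin f s

/-- The inverse `ℍⁿ → ℝ⁴ⁿ` of the quaternionic coordinates. -/
def realCoord : (Fin n → ℍ[ℝ]) →ₗ[ℝ] Fin n → Fin 4 → ℝ where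
  toFun A i := ![(A i).re, (A i).imI, (A i).imJ, (A i).imK]
  map_add' A B := by ext i t; fin_cases t <;> simp
  map_smul' c A := by ext i t; fin_cases t <;> simp

/-- The derivative of the vector field `p ↦ horField p A` in the direction `v`, as a bilinear
function of `A` and `v`. -/
def horFieldDeriv : (Fin n → ℍ[ℝ]) →ₗ[ℝ] QHeis n →ₗ[ℝ] QHeis n :=
  LinearMap.mk₂ ℝ (fun A v => (0, fun s => -2 * im s (qinner A (qcoord v))))
    (fun A B v => by ext <;> simp [qinner_add_left, im_add]; ring)
    (fun c A v => by ext <;> simp [qinner_real_smul_left, im_smul]; ring)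
    (fun A v w => by ext <;> simp [qcoord_map_add, qinner_add_right, im_add]; ring)
    (fun c A v => by ext <;> simp [qcoord_map_smul, qinner_real_smul_right, im_smul]; ring)

/-- The value at `p` of the left-invariant horizontal vector field of direction `A`. -/
def horField (p : QHeis n) : (Fin n → ℍ[ℝ]) →ₗ[ℝ] QHeis n :=
  LinearMap.inl ℝ _ _ ∘ₗ realCoord + horFieldDeriv.flip p

/-- The left-invariant vertical vector fields, dual to the standard contact form. -/
def vertField (s : Fin 3) : QHeis n := (0, Pi.single s 2)

theorem horField_eq (p : QHeis n) (A : Fin n → ℍ[ℝ]) :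
    horField p A = (realCoord A, 0) + horFieldDeriv A p := rfl

theorem horFieldDeriv_apply (A : Fin n → ℍ[ℝ]) (v : QHeis n) :
    horFieldDeriv A v = (0, fun s => -2 * im s (qinner A (qcoord v))) := rfl

theorem horField_fst (p : QHeis n) (A : Fin n → ℍ[ℝ]) : (horField p A).1 = realCoord A :=
  add_zero _

theorem horField_snd (s : Fin 3) (p : QHeis n) (A : Fin n → ℍ[ℝ]) :
    (horField p A).2 s = -2 * im s (qinner A (qcoord p)) := zero_add _

@[simp] theorem qcoord_horField (p : QHeis n) (A : Fin n → ℍ[ℝ]) : qcoord (horField p A) = A := by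
  ext i <;> simp [qcoord, horField_fst, realCoord]

@[simp] theorem qcoord_horFieldDeriv (A : Fin n → ℍ[ℝ]) (v : QHeis n) :
    qcoord (horFieldDeriv A v) = 0 := rfl

@[simp] theorem qcoord_vertField (s : Fin 3) : qcoord (vertField s : QHeis n) = 0 := rfl

theorem horField_injective (p : QHeis n) : Function.Injective (horField p) :=
  Function.LeftInverse.injective (qcoord_horField p)

theorem horFieldDeriv_eq_sum (A : Fin n → ℍ[ℝ]) (v : QHeis n) :
    horFieldDeriv A v = -∑ s, im s (qinner A (qcoord v)) • vertField s := by
  rw [horFieldDeriv_apply]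
  ext s
  · simp [vertField, Prod.fst_sum]
  · fin_cases s <;> simp [vertField, Fin.sum_univ_three] <;> ring

theorem stdForm_apply (s : Fin 3) (p v : QHeis n) :
    stdForm n s p v = 1 / 2 * v.2 s + im s (qinner (qcoord v) (qcoord p)) := rfl

@[simp] theorem stdForm_horField (s : Fin 3) (p : QHeis n) (A : Fin n → ℍ[ℝ]) :
    stdForm n s p (horField p A) = 0 := by
  rw [stdForm_apply, qcoord_horField, horField_snd]
  ring

theorem stdForm_vertField (s t : Fin 3) (p : QHeis n) :
    stdForm n s p (vertField t) = if s = t then 1 else 0 := by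
  rw [stdForm_apply, qcoord_vertField, qinner_zero_left, im_apply_zero]
  simp only [vertField, Pi.single_apply]
  split_ifs <;> simp

theorem eq_horField_add_vertField (p v : QHeis n) :
    v = horField p (qcoord v) + ∑ s, stdForm n s p v • vertField s := by
  refine Prod.ext (funext fun i => funext fun t => ?_) (funext fun s => ?_)
  · fin_cases t <;> simp [horField_fst, vertField, Prod.fst_sum, realCoord, qcoord]
  · fin_cases s <;>
      simp [horField_snd, vertField, stdForm_apply, Fin.sum_univ_three] <;> ring

theorem hasDirDeriv_qcoord (p v : QHeis n) :
    HasDirDeriv (fun x : QHeis n => qcoord x) (qcoord v) p v :=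
  .of_hasFDerivAt qcoordLin.toContinuousLinearMap.hasFDerivAt v

theorem hasDirDeriv_snd (p v : QHeis n) (s : Fin 3) :
    HasDirDeriv (fun x : QHeis n => x.2 s) (v.2 s) p v :=
  .of_hasFDerivAt ((ContinuousLinearMap.proj s).comp
    (ContinuousLinearMap.snd ℝ (Fin n → Fin 4 → ℝ) (Fin 3 → ℝ))).hasFDerivAt v

theorem hasDirDeriv_horField (A : Fin n → ℍ[ℝ]) (p v : QHeis n) :
    HasDirDeriv (fun x => horField x A) (horFieldDeriv A v) p v := by
  have h := (HasDirDeriv.const ((realCoord A, 0) : QHeis n) p v).add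
    (.of_hasFDerivAt (horFieldDeriv A).toContinuousLinearMap.hasFDerivAt v)
  exact h.congr_deriv (zero_add _)

theorem HasDirDeriv.horField {f : QHeis n → Fin n → ℍ[ℝ]} {a : Fin n → ℍ[ℝ]} {p v : QHeis n}
    (hf : HasDirDeriv f a p v) :
    HasDirDeriv (fun x => horField x (f x)) (horField p a + horFieldDeriv (f p) v) p v := by
  have hid : HasDirDeriv (fun x : QHeis n => x) v p v := .of_hasFDerivAt (hasFDerivAt_id p) v
  exact ((hf.linear (LinearMap.inl ℝ _ _ ∘ₗ realCoord)).add
    (hf.bilinear horFieldDeriv hid)).congr_deriv (add_assoc _ _ _).symm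

theorem contDiffOn_qcoord {Ω : Set (QHeis n)} : ContDiffOn ℝ ∞ (fun x : QHeis n => qcoord x) Ω :=
  contDiffOn_linear qcoordLin contDiffOn_id

theorem contDiffOn_snd_apply {Ω : Set (QHeis n)} (s : Fin 3) :
    ContDiffOn ℝ ∞ (fun x : QHeis n => x.2 s) Ω :=
  (contDiff_apply ℝ ℝ s |>.comp contDiff_snd).contDiffOn

end LeftInvariant

section Commutator

variable {F : Type*} [NormedAddCommGroup F] [NormedSpace ℝ F]

section SecondDerivative

variable {E : Type*} [NormedAddCommGroup E] [NormedSpace ℝ E] {f : E → F} {p : E}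

theorem hasDirDeriv_fderiv_apply (hf : ContDiffAt ℝ ∞ f p) {Y : E → E} {y v : E}
    (hY : HasDirDeriv Y y p v) :
    HasDirDeriv (fun x => fderiv ℝ f x (Y x)) (fderiv ℝ (fderiv ℝ f) p v (Y p) + fderiv ℝ f p y)
      p v :=
  (HasDirDeriv.of_differentiableAt
    ((hf.fderiv_right (m := ∞) (by simp)).differentiableAt (by simp)) v).clm_apply hY

theorem fderiv_fderiv_comm (hf : ContDiffAt ℝ ∞ f p) (v w : E) :
    fderiv ℝ (fderiv ℝ f) p v w = fderiv ℝ (fderiv ℝ f) p w v :=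
  (hf.isSymmSndFDerivAt (by
    rw [minSmoothness_of_isRCLikeNormedField]; exact WithTop.coe_le_coe.2 le_top)).eq v w

end SecondDerivative

variable {f : QHeis n → F} {p : QHeis n} {Ω : Set (QHeis n)}

theorem fderiv_horField_commutator (hf : ContDiffAt ℝ ∞ f p) (A B : Fin n → ℍ[ℝ]) :
    fderiv ℝ (fun x => fderiv ℝ f x (horField x B)) p (horField p A) -
      fderiv ℝ (fun x => fderiv ℝ f x (horField x A)) p (horField p B) =
      (-2 : ℝ) • ∑ s, rinner (imUnit s • A) B • fderiv ℝ f p (vertField s) := by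
  rw [(hasDirDeriv_fderiv_apply hf (hasDirDeriv_horField B p (horField p A))).fderiv_eq,
    (hasDirDeriv_fderiv_apply hf (hasDirDeriv_horField A p (horField p B))).fderiv_eq,
    fderiv_fderiv_comm hf]
  simp only [horFieldDeriv_eq_sum, qcoord_horField, map_neg, map_sum, map_smul,
    rinner_imUnit_left, im_qinner_comm _ B A, neg_smul, Finset.sum_neg_distrib]
  module

/-- The horizontal fields generate the vertical ones as commutators: on the first coordinate
`[1, eₛ]` is a multiple of the `s`-th vertical field. -/
theorem fderiv_vertField_eq_zero_of_horField [NeZero n] (hΩ : IsOpen Ω)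
    (hf : ContDiffOn ℝ ∞ f Ω) (h : ∀ p ∈ Ω, ∀ A, fderiv ℝ f p (horField p A) = 0) (hp : p ∈ Ω)
    (s : Fin 3) : fderiv ℝ f p (vertField s) = 0 := by
  let A : Fin n → ℍ[ℝ] := Pi.single 0 1
  let B : Fin n → ℍ[ℝ] := Pi.single 0 (imUnit s)
  have hzero (C : Fin n → ℍ[ℝ]) (v : QHeis n) :
      fderiv ℝ (fun x => fderiv ℝ f x (horField x C)) p v = 0 :=
    ((HasDirDeriv.const 0 p v).congr_of_isOpen hΩ hp fun x hx => h x hx C).fderiv_eq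
  have hAB (t : Fin 3) : rinner (imUnit t • A) B = if t = s then 1 else 0 := by
    rw [rinner_imUnit_left, qinner_single_right]
    fin_cases t <;> fin_cases s <;> simp [A]
  have hcomm := fderiv_horField_commutator (hf.contDiffAt (hΩ.mem_nhds hp)) A B
  simpa [hzero, hAB] using hcomm

theorem fderiv_eq_zero_of_horField [NeZero n] (hΩ : IsOpen Ω) (hf : ContDiffOn ℝ ∞ f Ω)
    (h : ∀ p ∈ Ω, ∀ A, fderiv ℝ f p (horField p A) = 0) (hp : p ∈ Ω) : fderiv ℝ f p = 0 := by
  refine ContinuousLinearMap.ext fun v => ?_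
  rw [eq_horField_add_vertField p v]
  simp [h p hp, fderiv_vertField_eq_zero_of_horField hΩ hf h hp]

theorem exists_eq_const_of_horField [NeZero n] (hΩ : IsOpen Ω) (hc : IsPreconnected Ω)
    (hf : ContDiffOn ℝ ∞ f Ω) (h : ∀ p ∈ Ω, ∀ A, fderiv ℝ f p (horField p A) = 0) :
    ∃ a, ∀ x ∈ Ω, f x = a :=
  hΩ.exists_is_const_of_fderiv_eq_zero hc (hf.differentiableOn (by simp))
    fun _ hp => fderiv_eq_zero_of_horField hΩ hf h hp

end Commutator

/-! ### Integration of the overdetermined system -/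

section QuadModel

theorem rinner_self_of_gram_eq {ι : Type*} [Fintype ι] {X Y : ι → ℍ[ℝ]} {t : ℝ}
    (h : ∀ i j, star (X i) * X j = t • (star (Y i) * Y j)) : rinner X X = t * rinner Y Y := by
  have hdiag (Z : ι → ℍ[ℝ]) : rinner Z Z = ∑ i, (star (Z i) * Z i).re := by
    rw [rinner, qinner_eq_sum, re_sum]
    exact Finset.sum_congr rfl fun i _ => re_mul_comm _ _
  rw [hdiag, hdiag, Finset.mul_sum]
  exact Finset.sum_congr rfl fun i _ => by rw [h, Quaternion.re_smul, smul_eq_mul]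

theorem qinner_mul_qinner_of_gram_eq {ι : Type*} [Fintype ι] {X Y : ι → ℍ[ℝ]} {t : ℝ}
    (h : ∀ i j, star (X i) * X j = t • (star (Y i) * Y j)) (Z : ι → ℍ[ℝ]) :
    qinner Y X * qinner X Z = (t * rinner Y Y) • qinner Y Z :=
  calc qinner Y X * qinner X Z = ∑ i, ∑ j, Y i * (star (X i) * X j) * star (Z j) := by
        simp only [qinner_eq_sum, Finset.sum_mul_sum, mul_assoc]
    _ = t • (qinner Y Y * qinner Y Z) := by
        simp only [h, qinner_eq_sum, Finset.sum_mul_sum, Finset.smul_sum, mul_smul_comm,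
          smul_mul_assoc, mul_assoc]
    _ = (t * rinner Y Y) • qinner Y Z := by
        rw [qinner_self, Quaternion.coe_mul_eq_smul, smul_smul]

/-- `im s` as a real linear map. -/
def imLin (s : Fin 3) : ℍ[ℝ] →ₗ[ℝ] ℝ := ⟨⟨im s, im_add s⟩, im_smul s⟩

/-- The quaternion `|q + q₀|² - (ω + 2 Im q₀ q̄)`, whose norm square is the model conformal factor
`|q|⁴ + |ω|²` up to a left translation. -/
def quadModel (q₀ : Fin n → ℍ[ℝ]) (p : QHeis n) : ℍ[ℝ] :=
  (rinner (qcoord p + q₀) (qcoord p + q₀) : ℍ[ℝ]) -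
    ∑ s, ((p.2 s + 2 * im s (qinner q₀ (qcoord p)) : ℝ) : ℍ[ℝ]) * imUnit s

theorem re_quadModel (q₀ : Fin n → ℍ[ℝ]) (p : QHeis n) :
    (quadModel q₀ p).re = rinner (qcoord p + q₀) (qcoord p + q₀) := by
  simp [quadModel, Fin.sum_univ_three, Quaternion.re_mul]

theorem im_quadModel (q₀ : Fin n → ℍ[ℝ]) (p : QHeis n) (s : Fin 3) :
    im s (quadModel q₀ p) = -(p.2 s + 2 * im s (qinner q₀ (qcoord p))) := by
  fin_cases s <;> simp [quadModel, Fin.sum_univ_three, Quaternion.imI_mul, Quaternion.imJ_mul,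
    Quaternion.imK_mul]

theorem contDiffOn_quadModel (q₀ : Fin n → ℍ[ℝ]) {Ω : Set (QHeis n)} :
    ContDiffOn ℝ ∞ (quadModel q₀) Ω := by
  have hq : ContDiffOn ℝ ∞ (fun x : QHeis n => qcoord x + q₀) Ω :=
    contDiffOn_qcoord.add contDiffOn_const
  exact (contDiffOn_coe (contDiffOn_rinner hq hq)).sub (ContDiffOn.sum fun s _ =>
    (contDiffOn_coe ((contDiffOn_snd_apply s).add (contDiffOn_const.mul (contDiffOn_linear
      (imLin s) (contDiffOn_qinner contDiffOn_const contDiffOn_qcoord))))).mul contDiffOn_const)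

theorem hasDirDeriv_quadModel (q₀ : Fin n → ℍ[ℝ]) (p : QHeis n) (A : Fin n → ℍ[ℝ]) :
    HasDirDeriv (quadModel q₀) ((2 : ℝ) • qinner A (qcoord p + q₀)) p (horField p A) := by
  have hq : HasDirDeriv (fun x : QHeis n => qcoord x) A p (horField p A) :=
    (hasDirDeriv_qcoord p (horField p A)).congr_deriv (qcoord_horField p A)
  have hnorm := ((hq.add (.const q₀ p _)).rinner (hq.add (.const q₀ p _))).coe
  have hvert (s : Fin 3) := ((((hasDirDeriv_snd p (horField p A) s).add
    ((((HasDirDeriv.const q₀ p _).qinner hq).linear (imLin s)).const_smul 2)).coe).mul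
      (.const (imUnit s) p _))
  refine (hnorm.sub (HasDirDeriv.sum Finset.univ hvert)).congr_deriv ?_
  have himLin (s : Fin 3) (a : ℍ[ℝ]) : imLin s a = im s a := rfl
  conv_rhs => rw [← re_add_sum_im_mul_imUnit (qinner A (qcoord p + q₀))]
  simp only [himLin, horField_snd, im_qinner_comm _ q₀ A, add_zero, mul_zero, zero_add,
    qinner_zero_left, rinner_comm _ A, qinner_add_right, im_add]
  simp only [rinner, qinner_add_right]
  ext <;> simp [Fin.sum_univ_three, Quaternion.re_mul, Quaternion.imI_mul, Quaternion.imJ_mul,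
    Quaternion.imK_mul] <;> ring

end QuadModel

theorem HasDirDeriv.inv_two_mul {E : Type*} [NormedAddCommGroup E] [NormedSpace ℝ E] {h : E → ℝ}
    {a : ℝ} {p v : E} (hd : HasDirDeriv h a p v) (hp : h p ≠ 0) :
    HasDirDeriv (fun x => (2 * h x)⁻¹) (-2 * (2 * h p)⁻¹ ^ 2 * a) p v := by
  refine (((HasDirDeriv.const 2 p v).mul hd).inv (by positivity)).congr_deriv ?_
  simp only [zero_mul, zero_add]
  field_simp

theorem contDiffOn_inv_two_mul {E : Type*} [NormedAddCommGroup E] [NormedSpace ℝ E] {h : E → ℝ}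
    {Ω : Set E} (hs : ContDiffOn ℝ ∞ h Ω) (hpos : ∀ p ∈ Ω, 0 < h p) :
    ContDiffOn ℝ ∞ (fun x => (2 * h x)⁻¹) Ω :=
  (contDiffOn_const.mul hs).inv fun x hx => mul_ne_zero two_ne_zero (hpos x hx).ne'

/-- The first order system satisfied by a conformal factor `h`, its horizontal gradient `u` and the
quaternion `M` that consists of the trace and the vertical derivatives of `h`. -/
structure ConfSystem (Ω : Set (QHeis n)) (h : QHeis n → ℝ) (u : QHeis n → Fin n → ℍ[ℝ])
    (M : QHeis n → ℍ[ℝ]) : Prop where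
  isOpen : IsOpen Ω
  isPreconnected : IsPreconnected Ω
  contDiffOn_h : ContDiffOn ℝ ∞ h Ω
  contDiffOn_u : ContDiffOn ℝ ∞ u Ω
  contDiffOn_M : ContDiffOn ℝ ∞ M Ω
  pos : ∀ p ∈ Ω, 0 < h p
  deriv_h : ∀ p ∈ Ω, ∀ A, HasDirDeriv h (rinner (u p) A) p (horField p A)
  deriv_u : ∀ p ∈ Ω, ∀ A,
    HasDirDeriv u (M p • A + (2 * h p)⁻¹ • (qinner A (u p) • u p)) p (horField p A)
  deriv_M : ∀ p ∈ Ω, ∀ A, HasDirDeriv M ((2 * h p)⁻¹ • (qinner A (u p) * M p)) p (horField p A)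

namespace ConfSystem

variable {Ω : Set (QHeis n)} {h : QHeis n → ℝ} {u : QHeis n → Fin n → ℍ[ℝ]} {M : QHeis n → ℍ[ℝ]}
  {p : QHeis n}

theorem deriv_inv (C : ConfSystem Ω h u M) (hp : p ∈ Ω) (A : Fin n → ℍ[ℝ]) :
    HasDirDeriv (fun x => (2 * h x)⁻¹) (-2 * (2 * h p)⁻¹ ^ 2 * rinner (u p) A) p (horField p A) :=
  (C.deriv_h p hp A).inv_two_mul (C.pos p hp).ne'

theorem contDiffOn_inv (C : ConfSystem Ω h u M) : ContDiffOn ℝ ∞ (fun x => (2 * h x)⁻¹) Ω :=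
  contDiffOn_inv_two_mul C.contDiffOn_h C.pos

theorem exists_eq_const [NeZero n] (C : ConfSystem Ω h u M) {F : Type*} [NormedAddCommGroup F]
    [NormedSpace ℝ F] {f : QHeis n → F} (hf : ContDiffOn ℝ ∞ f Ω)
    (hd : ∀ p ∈ Ω, ∀ A, HasDirDeriv f 0 p (horField p A)) : ∃ a, ∀ x ∈ Ω, f x = a :=
  exists_eq_const_of_horField C.isOpen C.isPreconnected hf fun p hp A => (hd p hp A).fderiv_eq

theorem exists_normSq_eq_const [NeZero n] (C : ConfSystem Ω h u M) :
    ∃ c, ∀ p ∈ Ω, (2 * h p)⁻¹ * Quaternion.normSq (M p) = c := by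
  simp only [normSq_eq_re]
  refine C.exists_eq_const (C.contDiffOn_inv.mul
    (contDiffOn_re (C.contDiffOn_M.mul (contDiffOn_star C.contDiffOn_M)))) fun p hp A => ?_
  refine ((C.deriv_inv hp A).mul
    ((C.deriv_M p hp A).mul (C.deriv_M p hp A).star).re).congr_deriv ?_
  rw [rinner_comm, rinner]
  generalize qinner A (u p) = x
  generalize (2 * h p)⁻¹ = k
  simp [Quaternion.re_mul, Quaternion.imI_mul, Quaternion.imJ_mul, Quaternion.imK_mul]
  ring

theorem eq_zero_or_exists_normSq_eq [NeZero n] (C : ConfSystem Ω h u M) :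
    (∀ p ∈ Ω, M p = 0) ∨ ∃ c, 0 < c ∧ ∀ p ∈ Ω, (2 * h p)⁻¹ * Quaternion.normSq (M p) = c := by
  obtain ⟨c, hc⟩ := C.exists_normSq_eq_const
  by_cases hM : ∀ p ∈ Ω, M p = 0
  · exact .inl hM
  · push Not at hM
    obtain ⟨p, hp, hMp⟩ := hM
    have hh := C.pos p hp
    have hN : 0 < Quaternion.normSq (M p) :=
      Quaternion.normSq_nonneg.lt_of_ne' (Quaternion.normSq_ne_zero.2 hMp)
    exact .inr ⟨c, hc p hp ▸ by positivity, hc⟩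

section NonzeroTrace

theorem hasDirDeriv_star_smul (C : ConfSystem Ω h u M) (hp : p ∈ Ω) (A : Fin n → ℍ[ℝ]) :
    HasDirDeriv (fun x => (2 * h x)⁻¹ • (star (M x) • u x))
      (((2 * h p)⁻¹ * Quaternion.normSq (M p)) • A) p (horField p A) := by
  refine ((C.deriv_inv hp A).smul ((C.deriv_M p hp A).star.quat_smul
    (C.deriv_u p hp A))).congr_deriv ?_
  rw [rinner_comm, rinner, normSq_eq_re]
  ext1 i
  generalize qinner A (u p) = x
  generalize (2 * h p)⁻¹ = k
  simp only [Pi.add_apply, Pi.smul_apply, smul_eq_mul]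
  generalize u p i = y
  generalize A i = a
  generalize M p = m
  ext <;> simp [Quaternion.re_mul, Quaternion.imI_mul, Quaternion.imJ_mul, Quaternion.imK_mul] <;>
    ring

variable {c : ℝ} {q₀ : Fin n → ℍ[ℝ]}

theorem exists_star_smul_eq_translate [NeZero n] (C : ConfSystem Ω h u M) (hc : 0 < c)
    (hcM : ∀ p ∈ Ω, (2 * h p)⁻¹ * Quaternion.normSq (M p) = c) :
    ∃ q₀ : Fin n → ℍ[ℝ], ∀ p ∈ Ω, (2 * h p)⁻¹ • (star (M p) • u p) = c • (qcoord p + q₀) := by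
  have hsmooth : ContDiffOn ℝ ∞ (fun x => (2 * h x)⁻¹ • (star (M x) • u x)) Ω :=
    C.contDiffOn_inv.smul (contDiffOn_quat_smul (contDiffOn_star C.contDiffOn_M) C.contDiffOn_u)
  obtain ⟨z₀, hz₀⟩ := C.exists_eq_const (hsmooth.sub (contDiffOn_qcoord.const_smul c))
    fun p hp A => ((C.hasDirDeriv_star_smul hp A).sub
      ((hasDirDeriv_qcoord p (horField p A)).const_smul c)).congr_deriv (by
        rw [hcM p hp, qcoord_horField, sub_self])
  refine ⟨c⁻¹ • z₀, fun p hp => ?_⟩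
  rw [smul_add, smul_inv_smul₀ hc.ne', ← hz₀ p hp, add_sub_cancel]

theorem exists_eq_quadModel [NeZero n] (C : ConfSystem Ω h u M)
    (hz : ∀ p ∈ Ω, (2 * h p)⁻¹ • (star (M p) • u p) = c • (qcoord p + q₀)) :
    ∃ m₀ : ℍ[ℝ], ∀ p ∈ Ω, M p = (c / 2) • quadModel q₀ p + m₀ := by
  have hderiv (p) (hp : p ∈ Ω) (A : Fin n → ℍ[ℝ]) :
      (2 * h p)⁻¹ • (qinner A (u p) * M p) = (c / 2) • (2 : ℝ) • qinner A (qcoord p + q₀) := by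
    have := congrArg (qinner A) (hz p hp)
    rwa [qinner_real_smul_right, qinner_smul_right, star_star, qinner_real_smul_right,
      ← div_mul_cancel₀ c two_ne_zero, mul_smul] at this
  obtain ⟨m₀, hm₀⟩ := C.exists_eq_const
    (C.contDiffOn_M.sub ((contDiffOn_quadModel q₀).const_smul (c / 2)))
    fun p hp A => ((C.deriv_M p hp A).sub
      ((hasDirDeriv_quadModel q₀ p A).const_smul (c / 2))).congr_deriv (by
        rw [hderiv p hp A, sub_self])
  exact ⟨m₀, fun p hp => by rw [← hm₀ p hp, add_sub_cancel]⟩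

theorem rinner_self_eq_translate (C : ConfSystem Ω h u M) (hc : 0 < c)
    (hcM : ∀ p ∈ Ω, (2 * h p)⁻¹ * Quaternion.normSq (M p) = c)
    (hz : ∀ p ∈ Ω, (2 * h p)⁻¹ • (star (M p) • u p) = c • (qcoord p + q₀)) (hp : p ∈ Ω) :
    rinner (u p) (u p) = 2 * h p * (c * rinner (qcoord p + q₀) (qcoord p + q₀)) := by
  have hh := C.pos p hp
  have hN : Quaternion.normSq (M p) = 2 * h p * c := by
    rw [← hcM p hp, mul_inv_cancel_left₀ (by positivity)]
  have hu : star (M p) • u p = (2 * h p * c) • (qcoord p + q₀) := by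
    rw [mul_smul, ← hz p hp, smul_inv_smul₀ (by positivity)]
  have hnorm : rinner (star (M p) • u p) (star (M p) • u p) =
      Quaternion.normSq (M p) * rinner (u p) (u p) := by
    rw [rinner_smul_right, star_star, smul_smul, Quaternion.self_mul_star, rinner_smul_left,
      qinner_self, ← Quaternion.coe_mul, Quaternion.re_coe]
  rw [hu, rinner_real_smul_left, rinner_real_smul_right, hN] at hnorm
  have hne : 2 * h p * c ≠ 0 := by positivity
  refine mul_left_cancel₀ hne ?_
  linear_combination -hnorm

theorem exists_eq_of_normSq_eq [NeZero n] (C : ConfSystem Ω h u M) (hc : 0 < c)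
    (hcM : ∀ p ∈ Ω, (2 * h p)⁻¹ * Quaternion.normSq (M p) = c) :
    ∃ (c₀ σ : ℝ) (q₀ : Fin n → ℍ[ℝ]) (ω₀ : Fin 3 → ℝ), 0 < c₀ ∧
      (∀ p ∈ Ω, h p = c₀ * ((σ + ∑ i, ‖qcoord p i + q₀ i‖ ^ 2) ^ 2 +
        ∑ s, (p.2 s + ω₀ s + 2 * im s (∑ i, q₀ i * star (qcoord p i))) ^ 2)) ∧
      ∀ p ∈ Ω, 4 * (M p).re - rinner (u p) (u p) / h p = 16 * c₀ * σ := by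
  obtain ⟨q₀, hz⟩ := C.exists_star_smul_eq_translate hc hcM
  obtain ⟨m₀, hM⟩ := C.exists_eq_quadModel hz
  have hre (p) (hp : p ∈ Ω) :
      (M p).re = c / 2 * rinner (qcoord p + q₀) (qcoord p + q₀) + m₀.re := by
    rw [hM p hp, Quaternion.re_add, Quaternion.re_smul, re_quadModel, smul_eq_mul]
  have him (p) (hp : p ∈ Ω) (s : Fin 3) :
      im s (M p) = -(c / 2 * (p.2 s + 2 * im s (qinner q₀ (qcoord p)))) + im s m₀ := by
    rw [hM p hp, im_add, im_smul, im_quadModel, mul_neg]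
  refine ⟨c / 8, 2 / c * m₀.re, q₀, fun s => -(2 / c * im s m₀), by positivity,
    fun p hp => ?_, fun p hp => ?_⟩
  · have hh := C.pos p hp
    have hnormSq : Quaternion.normSq (M p) = (M p).re ^ 2 + ∑ s, im s (M p) ^ 2 := by
      rw [Quaternion.normSq_def', Fin.sum_univ_three]
      simp only [im_zero, im_one, im_two]
      ring
    have hhc : h p = (2 * c)⁻¹ * Quaternion.normSq (M p) := by
      rw [← hcM p hp] at hc ⊢
      field_simp [(pos_of_mul_pos_right hc (by positivity)).ne']
    rw [hhc, hnormSq, hre p hp, rinner_self_eq_sum]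
    simp only [him p hp, qinner_eq_sum, Pi.add_apply, Fin.sum_univ_three]
    field_simp
    ring
  · have hh := C.pos p hp
    rw [hre p hp, C.rinner_self_eq_translate hc hcM hz hp]
    field_simp
    ring

end NonzeroTrace

section ZeroTrace

theorem exists_gram_eq_const [NeZero n] (C : ConfSystem Ω h u M) (hM : ∀ p ∈ Ω, M p = 0)
    (i j : Fin n) : ∃ c, ∀ p ∈ Ω, (2 * h p)⁻¹ • (star (u p i) * u p j) = c := by
  have hu := contDiffOn_pi.1 C.contDiffOn_u
  refine C.exists_eq_const (C.contDiffOn_inv.smul ((contDiffOn_star (hu i)).mul (hu j)))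
    fun p hp A => ?_
  have hu := C.deriv_u p hp A
  rw [hM p hp, zero_smul, zero_add] at hu
  refine ((C.deriv_inv hp A).smul ((hu.apply i).star.mul (hu.apply j))).congr_deriv ?_
  rw [rinner_comm, rinner]
  generalize qinner A (u p) = x
  generalize (2 * h p)⁻¹ = k
  simp only [Pi.smul_apply, smul_eq_mul]
  generalize u p i = y
  generalize u p j = w
  ext <;> simp [Quaternion.re_mul, Quaternion.imI_mul, Quaternion.imJ_mul, Quaternion.imK_mul] <;>
    ring

theorem exists_gram_eq [NeZero n] (C : ConfSystem Ω h u M) (hM : ∀ p ∈ Ω, M p = 0)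
    (hne : Ω.Nonempty) : ∃ c : Fin n → ℍ[ℝ],
      ∀ p ∈ Ω, ∀ i j, star (u p i) * u p j = (4 * h p) • (star (c i) * c j) := by
  obtain ⟨p₀, hp₀⟩ := hne
  have hh₀ := C.pos p₀ hp₀
  have hsq : √(h p₀) ^ 2 = h p₀ := Real.sq_sqrt hh₀.le
  refine ⟨((2 * √(h p₀))⁻¹ : ℝ) • u p₀, fun p hp i j => ?_⟩
  have hh := C.pos p hp
  obtain ⟨g, hg⟩ := C.exists_gram_eq_const hM i j
  rw [Pi.smul_apply, Pi.smul_apply, star_smul, star_trivial (2 * √(h p₀))⁻¹,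
    smul_mul_smul_comm, ← smul_inv_smul₀ (by positivity : 2 * h p ≠ 0) (star (u p i) * u p j),
    hg p hp, ← hg p₀ hp₀, smul_smul, smul_smul]
  congr 1
  rw [← sq, inv_pow, mul_pow, hsq]
  field_simp
  norm_num

variable {c : Fin n → ℍ[ℝ]}

theorem exists_eq_of_u_eq_zero [NeZero n] (C : ConfSystem Ω h u M) (hu : ∀ p ∈ Ω, u p = 0) :
    ∃ a : ℍ[ℝ], ∀ p ∈ Ω, h p = ‖a‖ ^ 2 := by
  obtain ⟨b, hb⟩ := C.exists_eq_const C.contDiffOn_h fun p hp A =>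
    (C.deriv_h p hp A).congr_deriv (by rw [hu p hp, rinner_zero_left])
  refine ⟨√b, fun p hp => ?_⟩
  rw [Quaternion.norm_coe, Real.norm_eq_abs, sq_abs, hb p hp,
    Real.sq_sqrt (hb p hp ▸ (C.pos p hp).le)]

theorem exists_qinner_eq_of_gram [NeZero n] (C : ConfSystem Ω h u M) (hM : ∀ p ∈ Ω, M p = 0)
    (hc : c ≠ 0) (hgram : ∀ p ∈ Ω, ∀ i j, star (u p i) * u p j = (4 * h p) • (star (c i) * c j)) :
    ∃ a : ℍ[ℝ], ∀ p ∈ Ω, a + qinner c (qcoord p) = (2 * rinner c c)⁻¹ • qinner c (u p) := by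
  have hcpos := rinner_self_pos hc
  obtain ⟨a, ha⟩ := C.exists_eq_const
    (((contDiffOn_qinner contDiffOn_const C.contDiffOn_u).const_smul (2 * rinner c c)⁻¹).sub
      (contDiffOn_qinner contDiffOn_const contDiffOn_qcoord)) fun p hp A => by
      have hh := C.pos p hp
      refine ((((HasDirDeriv.const c p _).qinner (C.deriv_u p hp A)).const_smul _).sub
        ((HasDirDeriv.const c p _).qinner (hasDirDeriv_qcoord p (horField p A)))).congr_deriv ?_
      rw [hM p hp, zero_smul, zero_add, qinner_zero_left, qinner_zero_left, zero_add, zero_add,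
        qcoord_horField, qinner_real_smul_right, qinner_smul_right, star_qinner,
        qinner_mul_qinner_of_gram_eq (hgram p hp), smul_smul, smul_smul, sub_eq_zero]
      convert one_smul ℝ _
      field_simp
      norm_num
  exact ⟨a, fun p hp => by rw [← ha p hp, sub_add_cancel]⟩

theorem exists_eq_of_gram [NeZero n] (C : ConfSystem Ω h u M) (hM : ∀ p ∈ Ω, M p = 0)
    (hgram : ∀ p ∈ Ω, ∀ i j, star (u p i) * u p j = (4 * h p) • (star (c i) * c j)) :
    ∃ a : ℍ[ℝ], ∀ p ∈ Ω, h p = ‖a + qinner c (qcoord p)‖ ^ 2 := by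
  rcases eq_or_ne c 0 with rfl | hc
  · simp only [qinner_zero_left, add_zero]
    refine C.exists_eq_of_u_eq_zero fun p hp => rinner_self_eq_zero.1 ?_
    rw [rinner_self_of_gram_eq (hgram p hp), rinner_zero_left, mul_zero]
  · obtain ⟨a, ha⟩ := C.exists_qinner_eq_of_gram hM hc hgram
    refine ⟨a, fun p hp => ?_⟩
    have hcpos := rinner_self_pos hc
    have hnormSq : Quaternion.normSq (qinner c (u p)) = 4 * h p * rinner c c * rinner c c := by
      rw [normSq_eq_re, star_qinner, qinner_mul_qinner_of_gram_eq (hgram p hp), qinner_self,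
        Quaternion.re_smul, Quaternion.re_coe, smul_eq_mul]
    rw [ha p hp, sq, ← Quaternion.normSq_eq_norm_mul_self, Quaternion.normSq_smul, hnormSq]
    field_simp
    norm_num

theorem exists_eq_of_eq_zero [NeZero n] (C : ConfSystem Ω h u M) (hM : ∀ p ∈ Ω, M p = 0)
    (hne : Ω.Nonempty) :
    ∃ (a : ℍ[ℝ]) (c : Fin n → ℍ[ℝ]),
      (∀ p ∈ Ω, h p = ‖a + ∑ i, c i * star (qcoord p i)‖ ^ 2) ∧
      ∀ p ∈ Ω, 4 * (M p).re - rinner (u p) (u p) / h p = -(4 * ∑ i, ‖c i‖ ^ 2) := by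
  obtain ⟨c, hgram⟩ := C.exists_gram_eq hM hne
  obtain ⟨a, ha⟩ := C.exists_eq_of_gram hM hgram
  refine ⟨a, c, ha, fun p hp => ?_⟩
  have hh := C.pos p hp
  rw [hM p hp, rinner_self_of_gram_eq (hgram p hp), ← rinner_self_eq_sum, Quaternion.re_zero]
  field_simp
  ring

end ZeroTrace

end ConfSystem

/-! ### Integrability conditions -/

/-- The quaternion `λ - ∑ₛ (ξₛ h) eₛ`, which plays the role of `M` in `ConfSystem`; here `λ` is the
trace part of the horizontal Hessian of `h`. -/
def confM (h l : QHeis n → ℝ) (p : QHeis n) : ℍ[ℝ] :=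
  (l p : ℍ[ℝ]) - ∑ s, ((fderiv ℝ h p (vertField s) : ℝ) : ℍ[ℝ]) * imUnit s

theorem im_confM (h l : QHeis n → ℝ) (p : QHeis n) (s : Fin 3) :
    im s (confM h l p) = -fderiv ℝ h p (vertField s) := by
  fin_cases s <;> simp [confM, Fin.sum_univ_three, Quaternion.imI_mul, Quaternion.imJ_mul,
    Quaternion.imK_mul]

theorem re_confM (h l : QHeis n → ℝ) (p : QHeis n) : (confM h l p).re = l p := by
  simp [confM, Fin.sum_univ_three, Quaternion.re_mul]

/-- The form that the qc-Einstein condition forces upon the horizontal Hessian of a conformal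
factor `h` with horizontal gradient `u`, before any integrability condition is used. -/
structure HessSystem (Ω : Set (QHeis n)) (h : QHeis n → ℝ) (u : QHeis n → Fin n → ℍ[ℝ])
    (l : QHeis n → ℝ) : Prop where
  isOpen : IsOpen Ω
  contDiffOn_h : ContDiffOn ℝ ∞ h Ω
  contDiffOn_u : ContDiffOn ℝ ∞ u Ω
  contDiffOn_l : ContDiffOn ℝ ∞ l Ω
  pos : ∀ p ∈ Ω, 0 < h p
  deriv_h : ∀ p ∈ Ω, ∀ A, HasDirDeriv h (rinner (u p) A) p (horField p A)
  deriv_u : ∀ p ∈ Ω, ∀ A,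
    HasDirDeriv u (confM h l p • A + (2 * h p)⁻¹ • (qinner A (u p) • u p)) p (horField p A)

/-- The obstruction `N_A = D_A M - (A, u) M / (2 h)` to `ConfSystem.deriv_M`. -/
def defect (h : QHeis n → ℝ) (u : QHeis n → Fin n → ℍ[ℝ]) (l : QHeis n → ℝ) (p : QHeis n) :
    (Fin n → ℍ[ℝ]) →ₗ[ℝ] ℍ[ℝ] where
  toFun A := fderiv ℝ (confM h l) p (horField p A) - (2 * h p)⁻¹ • (qinner A (u p) * confM h l p)
  map_add' A B := by simp only [map_add, qinner_add_left, add_mul, smul_add]; abel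
  map_smul' c A := by
    simp only [map_smul, qinner_real_smul_left, smul_mul_assoc, smul_sub, RingHom.id_apply]
    rw [smul_comm c ((2 * h p)⁻¹)]

/-- The vector `vₛ = ξₛ u + eₛ M̅ u / (2 h)`, through which the vertical derivatives of `u` enter
the integrability conditions. -/
def vertDefect (h : QHeis n → ℝ) (u : QHeis n → Fin n → ℍ[ℝ]) (l : QHeis n → ℝ) (p : QHeis n)
    (s : Fin 3) : Fin n → ℍ[ℝ] :=
  fderiv ℝ u p (vertField s) + (2 * h p)⁻¹ • (imUnit s • star (confM h l p) • u p)

theorem defect_apply (h : QHeis n → ℝ) (u : QHeis n → Fin n → ℍ[ℝ]) (l : QHeis n → ℝ)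
    (p : QHeis n) (A : Fin n → ℍ[ℝ]) :
    defect h u l p A = fderiv ℝ (confM h l) p (horField p A) -
      (2 * h p)⁻¹ • (qinner A (u p) * confM h l p) := rfl

theorem horFieldDeriv_vertField (A : Fin n → ℍ[ℝ]) (s : Fin 3) :
    horFieldDeriv A (vertField s) = 0 := by
  simp [horFieldDeriv_eq_sum, im_apply_zero]

theorem qinner_sub_qinner_comm {ι : Type*} [Fintype ι] (A B : ι → ℍ[ℝ]) :
    qinner B A - qinner A B = (2 : ℝ) • ∑ s, rinner (imUnit s • A) B • imUnit s := by
  rw [← star_qinner A B]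
  simp only [rinner_imUnit_left]
  ext <;> simp [Fin.sum_univ_three] <;> ring

/-- The integrability conditions in a quaternionic line, for `v = (v₁, v₂, v₃)` in place of
`vertDefect`. -/
theorem eq_zero_of_integrability {v : Fin 3 → ℍ[ℝ]}
    (hv : ∀ r, (-∑ s, (v s).re • imUnit s) * imUnit r + ∑ s, im r (v s) • imUnit s +
      (2 : ℝ) • v r = 0) (r : Fin 3) : v r = 0 := by
  have h₀ := hv 0
  have h₁ := hv 1
  have h₂ := hv 2
  simp only [Quaternion.ext_iff, Fin.sum_univ_three, Quaternion.re_add, Quaternion.imI_add,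
    Quaternion.imJ_add, Quaternion.imK_add, Quaternion.re_mul, Quaternion.imI_mul,
    Quaternion.imJ_mul, Quaternion.imK_mul, Quaternion.re_neg, Quaternion.imI_neg,
    Quaternion.imJ_neg, Quaternion.imK_neg, Quaternion.re_smul, Quaternion.imI_smul,
    Quaternion.imJ_smul, Quaternion.imK_smul, re_imUnit_zero, imI_imUnit_zero, imJ_imUnit_zero,
    imK_imUnit_zero, re_imUnit_one, imI_imUnit_one, imJ_imUnit_one, imK_imUnit_one,
    re_imUnit_two, imI_imUnit_two, imJ_imUnit_two, imK_imUnit_two, im_zero, im_one, im_two,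
    Quaternion.re_zero, Quaternion.imI_zero, Quaternion.imJ_zero, Quaternion.imK_zero,
    smul_eq_mul] at h₀ h₁ h₂
  obtain ⟨h₀r, h₀i, h₀j, h₀k⟩ := h₀
  obtain ⟨h₁r, h₁i, h₁j, h₁k⟩ := h₁
  obtain ⟨h₂r, h₂i, h₂j, h₂k⟩ := h₂
  fin_cases r <;> ext <;> simp <;> linarith

namespace HessSystem

variable {Ω : Set (QHeis n)} {h : QHeis n → ℝ} {u : QHeis n → Fin n → ℍ[ℝ]}
  {l : QHeis n → ℝ} {p : QHeis n}

theorem contDiffOn_confM (C : HessSystem Ω h u l) : ContDiffOn ℝ ∞ (confM h l) Ω :=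
  (contDiffOn_coe C.contDiffOn_l).sub (ContDiffOn.sum fun _ _ => (contDiffOn_coe
    ((C.contDiffOn_h.fderiv_of_isOpen C.isOpen (by simp)).clm_apply contDiffOn_const)).mul
      contDiffOn_const)

theorem hasDirDeriv_confM (C : HessSystem Ω h u l) (hp : p ∈ Ω) (v : QHeis n) :
    HasDirDeriv (confM h l) (fderiv ℝ (confM h l) p v) p v :=
  .of_differentiableAt
    ((C.contDiffOn_confM.contDiffAt (C.isOpen.mem_nhds hp)).differentiableAt (by simp)) v

theorem contDiffAt_h (C : HessSystem Ω h u l) (hp : p ∈ Ω) : ContDiffAt ℝ ∞ h p :=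
  C.contDiffOn_h.contDiffAt (C.isOpen.mem_nhds hp)

theorem contDiffAt_u (C : HessSystem Ω h u l) (hp : p ∈ Ω) : ContDiffAt ℝ ∞ u p :=
  C.contDiffOn_u.contDiffAt (C.isOpen.mem_nhds hp)

theorem deriv_inv (C : HessSystem Ω h u l) (hp : p ∈ Ω) (A : Fin n → ℍ[ℝ]) :
    HasDirDeriv (fun x => (2 * h x)⁻¹) (-2 * (2 * h p)⁻¹ ^ 2 * rinner (u p) A) p (horField p A) :=
  (C.deriv_h p hp A).inv_two_mul (C.pos p hp).ne'

theorem hasDirDeriv_deriv_u (C : HessSystem Ω h u l) (hp : p ∈ Ω) (A B : Fin n → ℍ[ℝ]) :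
    HasDirDeriv (fun x => fderiv ℝ u x (horField x B)) (fderiv ℝ (confM h l) p (horField p A) • B +
      (2 * h p)⁻¹ • ((qinner B A * star (confM h l p)) • u p + (qinner B (u p) * confM h l p) • A))
      p (horField p A) := by
  have hu := C.deriv_u p hp A
  have hB := HasDirDeriv.const B p (horField p A)
  have hrhs := ((C.hasDirDeriv_confM hp (horField p A)).quat_smul hB).add
    ((C.deriv_inv hp A).smul ((hB.qinner hu).quat_smul hu))
  refine (hrhs.congr_of_isOpen C.isOpen hp fun x hx =>
    (C.deriv_u x hx B).fderiv_eq).congr_deriv ?_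
  rw [rinner_comm, rinner, smul_zero, add_zero, qinner_zero_left, zero_add, qinner_add_right,
    qinner_real_smul_right, qinner_smul_right, qinner_smul_right]
  ext1 i
  simp only [Pi.add_apply, Pi.smul_apply, smul_eq_mul]
  generalize qinner A (u p) = x
  generalize qinner B (u p) = y
  generalize qinner B A = z
  generalize (2 * h p)⁻¹ = k
  generalize confM h l p = m
  generalize u p i = w
  generalize A i = a
  congr 1
  ext <;> simp [Quaternion.re_mul, Quaternion.imI_mul, Quaternion.imJ_mul, Quaternion.imK_mul] <;>
    ring

theorem defect_comm (C : HessSystem Ω h u l) (hp : p ∈ Ω) (A B : Fin n → ℍ[ℝ]) :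
    defect h u l p A • B - defect h u l p B • A +
      (2 : ℝ) • ∑ s, rinner (imUnit s • A) B • vertDefect h u l p s = 0 := by
  have hcomm := fderiv_horField_commutator (C.contDiffAt_u hp) A B
  rw [(C.hasDirDeriv_deriv_u hp A B).fderiv_eq, (C.hasDirDeriv_deriv_u hp B A).fderiv_eq] at hcomm
  have hskew := congrArg (fun z => (2 * h p)⁻¹ • (z * star (confM h l p)) • u p)
    (qinner_sub_qinner_comm A B)
  simp only [sub_mul, add_mul, sub_smul, add_smul, smul_mul_assoc, smul_assoc, mul_smul,
    Fin.sum_univ_three] at hskew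
  simp only [defect_apply, vertDefect, sub_smul, smul_assoc, mul_smul, Fin.sum_univ_three]
    at hcomm ⊢
  -- `module` cannot mix real and quaternionic scalars, so the quaternionic products become atoms.
  generalize (star (confM h l p) • u p : Fin n → ℍ[ℝ]) = w at *
  generalize (imUnit 0 • w : Fin n → ℍ[ℝ]) = w₀, (imUnit 1 • w : Fin n → ℍ[ℝ]) = w₁,
    (imUnit 2 • w : Fin n → ℍ[ℝ]) = w₂, (qinner A B • w : Fin n → ℍ[ℝ]) = w₃,
    (qinner B A • w : Fin n → ℍ[ℝ]) = w₄ at *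
  generalize (qinner A (u p) • confM h l p • B : Fin n → ℍ[ℝ]) = x,
    (qinner B (u p) • confM h l p • A : Fin n → ℍ[ℝ]) = y,
    (fderiv ℝ (confM h l) p (horField p A) • B : Fin n → ℍ[ℝ]) = a,
    (fderiv ℝ (confM h l) p (horField p B) • A : Fin n → ℍ[ℝ]) = b at *
  linear_combination (norm := module) hcomm - hskew

theorem im_fderiv_confM (C : HessSystem Ω h u l) (hp : p ∈ Ω) (v : QHeis n) (s : Fin 3) :
    im s (fderiv ℝ (confM h l) p v) = -fderiv ℝ (fderiv ℝ h) p v (vertField s) := by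
  have him := (C.hasDirDeriv_confM hp v).linear (imLin s)
  have hh := (hasDirDeriv_fderiv_apply (C.contDiffAt_h hp)
    (.const (vertField s : QHeis n) p v)).const_smul (-1)
  refine (him.unique hh C.isOpen hp fun x _ => ?_).trans (by simp)
  rw [neg_one_smul]
  exact (im_confM h l x s).symm

theorem rinner_fderiv_u_vertField (C : HessSystem Ω h u l) (hp : p ∈ Ω) (A : Fin n → ℍ[ℝ])
    (s : Fin 3) : rinner (fderiv ℝ u p (vertField s)) A =
      fderiv ℝ (fderiv ℝ h) p (horField p A) (vertField s) := by
  have hu := (HasDirDeriv.of_differentiableAt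
    ((C.contDiffAt_u hp).differentiableAt (by simp)) (vertField s)).rinner (.const A p _)
  have hh := hasDirDeriv_fderiv_apply (C.contDiffAt_h hp) (hasDirDeriv_horField A p (vertField s))
  have hderiv := hu.unique hh C.isOpen hp fun x hx => (C.deriv_h x hx A).fderiv_eq
  rw [rinner_zero_right, add_zero, horFieldDeriv_vertField, map_zero, add_zero] at hderiv
  rw [hderiv, fderiv_fderiv_comm (C.contDiffAt_h hp)]

theorem im_defect (C : HessSystem Ω h u l) (hp : p ∈ Ω) (A : Fin n → ℍ[ℝ]) (s : Fin 3) :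
    im s (defect h u l p A) = -rinner (vertDefect h u l p s) A := by
  rw [defect_apply, vertDefect, im_sub, C.im_fderiv_confM hp, rinner_add_left,
    C.rinner_fderiv_u_vertField hp, im_smul, rinner_real_smul_left, rinner_imUnit_left,
    qinner_smul_left, ← star_qinner A (u p), ← star_mul, im_star]
  ring

theorem re_defect (C : HessSystem Ω h u l) {k : ℝ}
    (hk : ∀ p ∈ Ω, 4 * l p - rinner (u p) (u p) / h p = k) (hp : p ∈ Ω) (A : Fin n → ℍ[ℝ]) :
    (defect h u l p A).re = 0 := by
  have hd := ((C.hasDirDeriv_confM hp (horField p A)).re.const_smul 4).sub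
    (((C.deriv_inv hp A).mul ((C.deriv_u p hp A).rinner (C.deriv_u p hp A))).const_smul 2)
  have hzero := hd.unique (.const k p (horField p A)) C.isOpen hp fun x hx => by
    have := C.pos x hx
    rw [← hk x hx, re_confM, smul_eq_mul, smul_eq_mul]
    field_simp
  rw [defect_apply, Quaternion.re_sub]
  rw [rinner_comm (u p) (_ + _), rinner_add_left, rinner_real_smul_left, rinner_smul_left,
    rinner_smul_left, qinner_self, rinner_comm (u p) A, rinner] at hzero
  simp only [smul_eq_mul, Quaternion.re_smul, Quaternion.re_mul, Quaternion.re_coe,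
    Quaternion.imI_coe, Quaternion.imJ_coe, Quaternion.imK_coe, mul_zero, sub_zero] at hzero ⊢
  linear_combination hzero / 4

theorem defect_single_eq_zero_of_ne (C : HessSystem Ω h u l) (hp : p ∈ Ω) {i j : Fin n}
    (hij : i ≠ j) (a : ℍ[ℝ]) : defect h u l p (Pi.single i a) = 0 := by
  have hcomm := congrFun (C.defect_comm hp (Pi.single i a) (Pi.single j 1)) j
  have horth (s : Fin 3) : rinner (imUnit s • Pi.single i a) (Pi.single j (1 : ℍ[ℝ])) = 0 := by
    rw [rinner_imUnit_left, qinner_single_left]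
    simp [hij, im_apply_zero]
  simpa [horth, hij.symm] using hcomm

theorem defect_single_of_re_eq_zero (C : HessSystem Ω h u l) (hp : p ∈ Ω)
    (hre : ∀ A, (defect h u l p A).re = 0) (i : Fin n) (a : ℍ[ℝ]) :
    defect h u l p (Pi.single i a) =
      -∑ s, (vertDefect h u l p s i * star a).re • imUnit s := by
  have him (s : Fin 3) := C.im_defect hp (Pi.single i a) s
  simp only [rinner, qinner_single_right] at him
  rw [← re_add_sum_im_mul_imUnit (defect h u l p (Pi.single i a)), hre]
  simp [him, Quaternion.coe_mul_eq_smul, -Quaternion.re_mul]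

theorem vertDefect_apply_eq_zero (C : HessSystem Ω h u l) (hp : p ∈ Ω)
    (hre : ∀ A, (defect h u l p A).re = 0) (i : Fin n) (r : Fin 3) :
    vertDefect h u l p r i = 0 := by
  refine eq_zero_of_integrability (v := fun s => vertDefect h u l p s i) (fun r => ?_) r
  have hcomm := congrFun (C.defect_comm hp (Pi.single i 1) (Pi.single i (imUnit r))) i
  rw [C.defect_single_of_re_eq_zero hp hre, C.defect_single_of_re_eq_zero hp hre] at hcomm
  have hunit (s : Fin 3) :
      rinner (imUnit s • Pi.single i (1 : ℍ[ℝ])) (Pi.single i (imUnit r)) =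
        if s = r then 1 else 0 := by
    rw [rinner_imUnit_left, qinner_single_left]
    fin_cases s <;> fin_cases r <;> simp
  have him (a : ℍ[ℝ]) : (a * star (imUnit r)).re = im r a := by
    fin_cases r <;> simp [Quaternion.re_mul]
  simpa only [hunit, him, star_one, mul_one, ite_smul, one_smul, zero_smul, Finset.sum_ite_eq',
    Finset.mem_univ, if_true, Pi.add_apply, Pi.sub_apply, Pi.smul_apply, Pi.single_eq_same,
    smul_eq_mul, Pi.zero_apply, sub_neg_eq_add] using hcomm

theorem defect_eq_zero [NeZero n] (C : HessSystem Ω h u l)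
    (hS : n = 1 → ∃ k : ℝ, ∀ p ∈ Ω, 4 * l p - rinner (u p) (u p) / h p = k)
    (hp : p ∈ Ω) : defect h u l p = 0 := by
  refine LinearMap.pi_ext fun i a => ?_
  rw [LinearMap.zero_apply]
  by_cases hn : n = 1
  · obtain ⟨k, hk⟩ := hS hn
    rw [C.defect_single_of_re_eq_zero hp (C.re_defect hk hp)]
    simp [C.vertDefect_apply_eq_zero hp (C.re_defect hk hp)]
  · have : Nontrivial (Fin n) := Fin.nontrivial_iff_two_le.2 (by have := NeZero.ne n; omega)
    obtain ⟨j, hj⟩ := exists_ne i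
    exact C.defect_single_eq_zero_of_ne hp hj.symm a

theorem confSystem [NeZero n] (C : HessSystem Ω h u l) (hc : IsPreconnected Ω)
    (hS : n = 1 → ∃ k : ℝ, ∀ p ∈ Ω, 4 * l p - rinner (u p) (u p) / h p = k) :
    ConfSystem Ω h u (confM h l) where
  isOpen := C.isOpen
  isPreconnected := hc
  contDiffOn_h := C.contDiffOn_h
  contDiffOn_u := C.contDiffOn_u
  contDiffOn_M := C.contDiffOn_confM
  pos := C.pos
  deriv_h := C.deriv_h
  deriv_u := C.deriv_u
  deriv_M p hp A := (C.hasDirDeriv_confM hp (horField p A)).congr_deriv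
    (sub_eq_zero.1 (LinearMap.congr_fun (C.defect_eq_zero hS hp) A))

end HessSystem

/-! ### The deformed structure in the left-invariant frame -/

/-- The horizontal gradient of `h` in the left-invariant frame. -/
def grad (h : QHeis n → ℝ) (p : QHeis n) : Fin n → ℍ[ℝ] :=
  ∑ k, fderiv ℝ h p (horField p (stdBasis k)) • stdBasis k

theorem rinner_grad (h : QHeis n → ℝ) (p : QHeis n) (A : Fin n → ℍ[ℝ]) :
    rinner (grad h p) A = fderiv ℝ h p (horField p A) := by
  rw [grad, rinner_sum_left]
  simp only [rinner_real_smul_left, rinner_comm (stdBasis _) A]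
  exact (Finset.sum_congr rfl fun k _ => mul_comm _ _).trans
    (sum_rinner_smul_map_stdBasis ((fderiv ℝ h p : QHeis n →ₗ[ℝ] ℝ) ∘ₗ horField p) A)

theorem contDiffOn_horField {Ω : Set (QHeis n)} (A : Fin n → ℍ[ℝ]) :
    ContDiffOn ℝ ∞ (fun x => horField x A) Ω :=
  (contDiffOn_const (c := ((realCoord A, 0) : QHeis n)).add
    (contDiffOn_linear (horFieldDeriv A) contDiffOn_id)).congr fun x _ => horField_eq x A

theorem contDiffOn_grad {Ω : Set (QHeis n)} {h : QHeis n → ℝ} (hΩ : IsOpen Ω)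
    (hs : ContDiffOn ℝ ∞ h Ω) : ContDiffOn ℝ ∞ (grad h) Ω :=
  ContDiffOn.sum fun k _ => ((hs.fderiv_of_isOpen hΩ (by simp)).clm_apply
    (contDiffOn_horField (stdBasis k))).smul contDiffOn_const

theorem confForm_apply (h : QHeis n → ℝ) (s : Fin 3) (p v : QHeis n) :
    confForm h s p v = (2 * h p)⁻¹ * stdForm n s p v := by
  simp [confForm]

theorem stdForm_horFieldDeriv (s : Fin 3) (p v : QHeis n) (A : Fin n → ℍ[ℝ]) :
    stdForm n s p (horFieldDeriv A v) = -im s (qinner A (qcoord v)) := by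
  rw [horFieldDeriv_eq_sum, map_neg, map_sum]
  simp [stdForm_vertField]

theorem horField_mem (h : QHeis n → ℝ) (p : QHeis n) (A : Fin n → ℍ[ℝ]) :
    horField p A ∈ horizontal (confForm h) p := by
  simp [horizontal, confForm_apply, stdForm_horField]

theorem eq_horField_of_stdForm_eq_zero {p v : QHeis n} (hv : ∀ s, stdForm n s p v = 0) :
    v = horField p (qcoord v) := by
  simpa only [hv, zero_smul, Finset.sum_const_zero, add_zero] using eq_horField_add_vertField p v

theorem stdForm_eq_zero_of_mem {h : QHeis n → ℝ} {p v : QHeis n} (h0 : h p ≠ 0)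
    (hv : v ∈ horizontal (confForm h) p) (s : Fin 3) : stdForm n s p v = 0 := by
  have hs : confForm h s p v = 0 := (Submodule.mem_iInf _).1 hv s
  rw [confForm_apply] at hs
  exact (mul_eq_zero.1 hs).resolve_left (by positivity)

theorem eq_horField_of_mem {h : QHeis n → ℝ} {p v : QHeis n} (h0 : h p ≠ 0)
    (hv : v ∈ horizontal (confForm h) p) : v = horField p (qcoord v) :=
  eq_horField_of_stdForm_eq_zero (stdForm_eq_zero_of_mem h0 hv)

/-- The connection form of `∇ = D + Γ` in the left-invariant horizontal frame. -/
def conn (Γ : QHeis n → QHeis n →L[ℝ] QHeis n →L[ℝ] QHeis n) (p v : QHeis n) :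
    (Fin n → ℍ[ℝ]) →ₗ[ℝ] (Fin n → ℍ[ℝ]) :=
  qcoordLin ∘ₗ (Γ p v : QHeis n →ₗ[ℝ] QHeis n) ∘ₗ horField p

theorem conn_apply (Γ : QHeis n → QHeis n →L[ℝ] QHeis n →L[ℝ] QHeis n) (p v : QHeis n)
    (B : Fin n → ℍ[ℝ]) : conn Γ p v B = qcoord (Γ p v (horField p B)) := rfl

namespace QCStructure

variable {Ω : Set (QHeis n)} {h : QHeis n → ℝ} {p : QHeis n}
  {Γ : QHeis n → QHeis n →L[ℝ] QHeis n →L[ℝ] QHeis n} (Q : QCStructure n Ω (confForm h))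

include Q

theorem conf_ne_zero (hp : p ∈ Ω) : h p ≠ 0 := fun h0 => by
  simpa [confForm_apply, h0] using Q.reeb_dual p hp 0 0

theorem contDiffOn_conf : ContDiffOn ℝ ∞ h Ω := by
  have hinv : ContDiffOn ℝ ∞ (fun x => 2 * confForm h 0 x (vertField 0)) Ω :=
    contDiffOn_const.mul ((Q.contDiffOn_η 0).clm_apply contDiffOn_const)
  have heq (x : QHeis n) : 2 * confForm h 0 x (vertField 0) = (h x)⁻¹ := by
    rw [confForm_apply, stdForm_vertField, mul_inv]
    simp
  simp only [heq] at hinv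
  exact (hinv.inv fun x hx => inv_ne_zero (Q.conf_ne_zero hx)).congr fun x _ => (inv_inv _).symm

theorem hasDirDeriv_of_contDiffOn {F : Type*} [NormedAddCommGroup F] [NormedSpace ℝ F]
    {f : QHeis n → F} (hf : ContDiffOn ℝ ∞ f Ω) (hp : p ∈ Ω) (v : QHeis n) :
    HasDirDeriv f (fderiv ℝ f p v) p v :=
  .of_differentiableAt ((hf.contDiffAt (Q.isOpen.mem_nhds hp)).differentiableAt (by simp)) v

theorem hasDirDeriv_inv_two_mul (hp : p ∈ Ω) (v : QHeis n) : HasDirDeriv (fun x => (2 * h x)⁻¹)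
    (-2 * (2 * h p)⁻¹ ^ 2 * fderiv ℝ h p v) p v :=
  (Q.hasDirDeriv_of_contDiffOn Q.contDiffOn_conf hp v).inv_two_mul (Q.conf_ne_zero hp)

theorem fderiv_confForm (hp : p ∈ Ω) (s : Fin 3) (v w : QHeis n) :
    fderiv ℝ (confForm h s) p v w = -2 * (2 * h p)⁻¹ ^ 2 * fderiv ℝ h p v * stdForm n s p w +
      (2 * h p)⁻¹ * im s (qinner (qcoord w) (qcoord v)) := by
  have hconf := (Q.hasDirDeriv_of_contDiffOn (Q.contDiffOn_η s) hp v).clm_apply (.const w p v)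
  have hformula := (Q.hasDirDeriv_inv_two_mul hp v).mul ((HasDirDeriv.const (1 / 2 * w.2 s) p v).add
    (((HasDirDeriv.const (qcoord w) p v).qinner (hasDirDeriv_qcoord p v)).linear (imLin s)))
  have hderiv := hconf.unique hformula Q.isOpen hp fun x _ => (confForm_apply h s x w).symm
  rw [map_zero, add_zero, qinner_zero_left, zero_add, zero_add] at hderiv
  exact hderiv

theorem dForm_horField (hp : p ∈ Ω) (s : Fin 3) (A B : Fin n → ℍ[ℝ]) :
    dForm (confForm h s) p (horField p A) (horField p B) =
      2 * (2 * h p)⁻¹ * rinner (imUnit s • A) B := by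
  rw [dForm, Q.fderiv_confForm hp, Q.fderiv_confForm hp, stdForm_horField, stdForm_horField,
    qcoord_horField, qcoord_horField, rinner_imUnit_left, im_qinner_comm s B A]
  ring

theorem I_horField_eq_horField_qcoord (hp : p ∈ Ω) (s : Fin 3) (A : Fin n → ℍ[ℝ]) :
    Q.I s p (horField p A) = horField p (qcoord (Q.I s p (horField p A))) :=
  eq_horField_of_mem (Q.conf_ne_zero hp) (Q.I_mem p hp s _ (horField_mem h p A))

theorem I_one_horField (hp : p ∈ Ω) (A : Fin n → ℍ[ℝ]) :
    Q.I 1 p (horField p A) = horField p (imUnit 1 • A) := by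
  have hJ := Q.I_horField_eq_horField_qcoord hp 1 A
  rw [hJ]
  generalize qcoord (Q.I 1 p (horField p A)) = J at hJ ⊢
  -- `I₁ I₂ = I₃`, and `g(I₁ ·, ·)`, `g(I₃ ·, ·)` are both known from `dΘ` before `g` is.
  have hsmul : imUnit 0 • J = imUnit 2 • A := by
    refine rinner_ext fun B => ?_
    have h₀ := Q.two_g_I p hp 0 _ (Q.I_mem p hp 1 _ (horField_mem h p A)) _ (horField_mem h p B)
    have h₂ := Q.two_g_I p hp 2 _ (horField_mem h p A) _ (horField_mem h p B)
    rw [Q.I_mul p hp _ (horField_mem h p A), h₂, Q.dForm_horField hp, hJ,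
      Q.dForm_horField hp] at h₀
    have := Q.conf_ne_zero hp
    exact (mul_left_cancel₀ (by positivity) h₀).symm
  have hunit : imUnit 1 = -(imUnit 0 * imUnit 2) := by
    ext <;> simp [Quaternion.re_mul, Quaternion.imI_mul, Quaternion.imJ_mul, Quaternion.imK_mul]
  rw [hunit, neg_smul, mul_smul, ← hsmul, imUnit_smul_imUnit_smul, neg_neg]

theorem g_horField (hp : p ∈ Ω) (A B : Fin n → ℍ[ℝ]) :
    Q.g p (horField p A) (horField p B) = (2 * h p)⁻¹ * rinner A B := by
  have hg := Q.two_g_I p hp 1 _ (horField_mem h p (-(imUnit 1 • A))) _ (horField_mem h p B)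
  rw [Q.I_one_horField hp, Q.dForm_horField hp, smul_neg, imUnit_smul_imUnit_smul, neg_neg] at hg
  linarith

theorem I_horField (hp : p ∈ Ω) (s : Fin 3) (A : Fin n → ℍ[ℝ]) :
    Q.I s p (horField p A) = horField p (imUnit s • A) := by
  have hJ := Q.I_horField_eq_horField_qcoord hp s A
  rw [hJ]
  refine congrArg _ (rinner_ext fun B => ?_)
  have hg := Q.two_g_I p hp s _ (horField_mem h p A) _ (horField_mem h p B)
  rw [hJ, Q.g_horField hp, Q.dForm_horField hp, ← mul_assoc] at hg
  have := Q.conf_ne_zero hp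
  exact mul_left_cancel₀ (by positivity) hg

theorem stdForm_reeb (hp : p ∈ Ω) (s t : Fin 3) :
    stdForm n t p (Q.ξ s p) = if t = s then 2 * h p else 0 := by
  have hdual := Q.reeb_dual p hp t s
  have := Q.conf_ne_zero hp
  rw [confForm_apply, inv_mul_eq_iff_eq_mul₀ (by positivity)] at hdual
  simpa using hdual

theorem qcoord_reeb (hp : p ∈ Ω) (s : Fin 3) : qcoord (Q.ξ s p) = imUnit s • grad h p := by
  have hsmul : imUnit s • qcoord (Q.ξ s p) = -grad h p := by
    refine rinner_ext fun A => ?_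
    have hskew := Q.reeb_skew p hp s s _ (horField_mem h p A)
    rw [dForm, Q.fderiv_confForm hp, Q.fderiv_confForm hp, stdForm_horField, Q.stdForm_reeb hp,
      if_pos rfl, qcoord_horField, ← rinner_grad, im_qinner_comm s A] at hskew
    rw [rinner_imUnit_left, rinner_neg_left]
    have := Q.conf_ne_zero hp
    field_simp at hskew
    refine mul_left_cancel₀ this ?_
    linear_combination hskew / 4
  rw [← neg_neg (grad h p), ← hsmul, smul_neg, imUnit_smul_imUnit_smul, neg_neg]

theorem reeb_eq (hp : p ∈ Ω) (s : Fin 3) :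
    Q.ξ s p = horField p (imUnit s • grad h p) + (2 * h p) • vertField s := by
  rw [eq_horField_add_vertField p (Q.ξ s p), Q.qcoord_reeb hp]
  simp [Q.stdForm_reeb hp]

theorem horField_conn (hp : p ∈ Ω) (hΓ : Q.IsBiquardConnection Γ) (v : QHeis n)
    (B : Fin n → ℍ[ℝ]) : horField p (conn Γ p v B) = horFieldDeriv B v + Γ p v (horField p B) := by
  rw [eq_horField_of_stdForm_eq_zero (v := horFieldDeriv B v + Γ p v (horField p B)) fun s => ?_,
    qcoord_map_add, qcoord_horFieldDeriv, zero_add, conn_apply]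
  have hpar := hΓ.horizontal_parallel p hp v _ (horField_mem h p B) s
  rw [Q.fderiv_confForm hp, stdForm_horField, confForm_apply, qcoord_horField] at hpar
  rw [map_add, stdForm_horFieldDeriv]
  have := Q.conf_ne_zero hp
  refine (mul_eq_zero.1 ?_).resolve_left (show (2 * h p)⁻¹ ≠ 0 by positivity)
  linear_combination -hpar

theorem Γ_horField (hp : p ∈ Ω) (hΓ : Q.IsBiquardConnection Γ) (v : QHeis n) (B : Fin n → ℍ[ℝ]) :
    Γ p v (horField p B) = horField p (conn Γ p v B) - horFieldDeriv B v := by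
  rw [Q.horField_conn hp hΓ, add_sub_cancel_left]

theorem conn_metric (hp : p ∈ Ω) (hΓ : Q.IsBiquardConnection Γ) (v : QHeis n)
    (A B : Fin n → ℍ[ℝ]) : rinner (conn Γ p v A) B + rinner A (conn Γ p v B) =
      -2 * (2 * h p)⁻¹ * fderiv ℝ h p v * rinner A B := by
  have hg := ((Q.hasDirDeriv_of_contDiffOn Q.contDiffOn_g hp v).clm_apply
    (hasDirDeriv_horField A p v)).clm_apply (hasDirDeriv_horField B p v)
  have hderiv := hg.unique ((Q.hasDirDeriv_inv_two_mul hp v).mul (.const (rinner A B) p v))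
    Q.isOpen hp fun x hx => (Q.g_horField hx A B).symm
  have hpar := hΓ.metric_parallel p hp v _ (horField_mem h p A) _ (horField_mem h p B)
  rw [Q.Γ_horField hp hΓ, Q.Γ_horField hp hΓ] at hpar
  simp only [map_sub, sub_apply, add_apply, Q.g_horField hp, mul_zero, add_zero] at hderiv hpar
  have := Q.conf_ne_zero hp
  refine mul_left_cancel₀ (show (2 * h p)⁻¹ ≠ 0 by positivity) ?_
  linear_combination hderiv - hpar

theorem conn_torsion (hp : p ∈ Ω) (hΓ : Q.IsBiquardConnection Γ) (A B : Fin n → ℍ[ℝ]) :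
    conn Γ p (horField p A) B - conn Γ p (horField p B) A =
      (2 * (2 * h p)⁻¹) • ∑ s, rinner (imUnit s • A) B • imUnit s • grad h p := by
  have htor := congrArg qcoord
    (hΓ.torsion_horizontal p hp _ (horField_mem h p A) _ (horField_mem h p B))
  rw [torsion, qcoord_map_sub, qcoord_map_sum] at htor
  rw [conn_apply, conn_apply, htor, Finset.smul_sum]
  refine Finset.sum_congr rfl fun s _ => ?_
  rw [qcoord_map_smul, Q.dForm_horField hp, Q.qcoord_reeb hp, mul_smul]

theorem conn_horField (hp : p ∈ Ω) (hΓ : Q.IsBiquardConnection Γ) (A B : Fin n → ℍ[ℝ]) :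
    conn Γ p (horField p A) B = (2 * h p)⁻¹ • (qinner B A • grad h p - qinner B (grad h p) • A -
      qinner A (grad h p) • B) := by
  refine rinner_ext fun C => ?_
  -- Koszul's formula
  have hmet X Y Z := Q.conn_metric hp hΓ (horField p X) Y Z
  have htor X Y Z := congrArg (fun V => rinner V Z) (Q.conn_torsion hp hΓ X Y)
  simp only [← rinner_grad, rinner_sub_left, rinner_real_smul_left, rinner_sum_left,
    rinner_imUnit_left] at hmet htor
  have hABC := hmet A B C
  have hBAC := hmet B A C
  have hCAB := hmet C A B
  have tABC := htor A B C
  have tACB := htor A C B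
  have tBCA := htor B C A
  rw [rinner_comm B] at hABC
  rw [rinner_comm A] at hBAC hCAB
  simp only [rinner_real_smul_left, rinner_sub_left, rinner_smul_left]
  rw [← star_qinner A B, ← star_qinner (grad h p) B, ← star_qinner (grad h p) A]
  simp only [rinner, Fin.sum_univ_three, im_zero, im_one, im_two] at hABC hBAC hCAB tABC tACB tBCA
  simp only [Quaternion.re_mul, Quaternion.re_star, Quaternion.imI_star, Quaternion.imJ_star,
    Quaternion.imK_star, rinner]
  linear_combination (hABC + hBAC - hCAB + tABC - tACB - tBCA) / 2

end QCStructure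

/-! ### Projection onto `sp(n) ⊕ sp(1)` -/

section Normalizer

theorem star_imUnit_mul_self (s : Fin 3) : star (imUnit s) * imUnit s = 1 := by
  fin_cases s <;> ext <;> simp [Quaternion.re_mul, Quaternion.imI_mul, Quaternion.imJ_mul,
    Quaternion.imK_mul]

theorem star_quatBasis_mul_self (t : Fin 4) : star (quatBasis t) * quatBasis t = 1 := by
  cases t using Fin.cases with
  | zero => simp
  | succ s => rw [quatBasis_succ, star_imUnit_mul_self]

/-- The sign with which the units `quatBasis t` and `imUnit s` commute. -/
def commSign (t : Fin 4) (s : Fin 3) : ℝ := if t = 0 ∨ t = s.succ then 1 else -1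

theorem quatBasis_mul_imUnit (t : Fin 4) (s : Fin 3) :
    quatBasis t * imUnit s = commSign t s • (imUnit s * quatBasis t) := by
  fin_cases t <;> fin_cases s <;> ext <;>
    simp [commSign, Quaternion.re_mul, Quaternion.imI_mul, Quaternion.imJ_mul,
      Quaternion.imK_mul, Fin.ext_iff]

theorem star_imUnit_mul_quatBasis_mul_imUnit (s : Fin 3) (t : Fin 4) :
    star (imUnit s) * quatBasis t * imUnit s = commSign t s • quatBasis t := by
  rw [mul_assoc, quatBasis_mul_imUnit, mul_smul_comm, ← mul_assoc, star_imUnit_mul_self, one_mul]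

theorem sum_commSign (s : Fin 3) : ∑ t, commSign t s = 0 := by
  rw [Fin.sum_univ_succ]
  fin_cases s <;> simp [commSign, Fin.sum_univ_three]

variable {ι : Type*} [Fintype ι]

theorem rinner_quat_smul_quat_smul (a b : ℍ[ℝ]) (X Y : ι → ℍ[ℝ]) :
    rinner (a • X) (b • Y) = rinner ((star b * a) • X) Y := by
  rw [rinner_smul_right, smul_smul]

/-- The bilinear form `(X, Y) ↦ rinner (K X) (L Y)`, to which traces over a frame apply. -/
def rinnerBilin (K L : (ι → ℍ[ℝ]) →ₗ[ℝ] (ι → ℍ[ℝ])) :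
    (ι → ℍ[ℝ]) →ₗ[ℝ] (ι → ℍ[ℝ]) →ₗ[ℝ] ℝ :=
  LinearMap.mk₂ ℝ (fun X Y => rinner (K X) (L Y))
    (fun X Y Z => by rw [map_add, rinner_add_left])
    (fun c X Y => by rw [map_smul, rinner_real_smul_left, smul_eq_mul])
    (fun X Y Z => by rw [map_add, rinner_add_right])
    (fun c X Y => by rw [map_smul, rinner_real_smul_right, smul_eq_mul])

variable (L : (ι → ℍ[ℝ]) →ₗ[ℝ] (ι → ℍ[ℝ]))

theorem exists_sum_rinner_quatBasis_of_normalizer {a : Fin 3 → Fin 3 → ℝ}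
    (hL : ∀ t A, L (imUnit t • A) - imUnit t • L A = ∑ r, a t r • imUnit r • A)
    (s : Fin 3) : ∃ d : ℝ, ∀ A, ∑ t, rinner (L (quatBasis t • A)) (quatBasis t • imUnit s • A) =
      4 * rinner (L A) (imUnit s • A) + d * rinner A A := by
  let d (t : Fin 3) : ℝ := ∑ r, a t r * (star (imUnit t * imUnit s) * imUnit r).re
  have himUnit (t : Fin 3) (A : ι → ℍ[ℝ]) : rinner (L (imUnit t • A)) (imUnit t • imUnit s • A) =
      rinner (L A) (imUnit s • A) + d t * rinner A A := by
    rw [sub_eq_iff_eq_add'.1 (hL t A), rinner_add_left, rinner_quat_smul_quat_smul,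
      star_imUnit_mul_self, one_smul, rinner_sum_left, Finset.sum_mul]
    refine congrArg _ (Finset.sum_congr rfl fun r _ => ?_)
    rw [rinner_real_smul_left, smul_smul, rinner_quat_smul_quat_smul, rinner_smul_left,
      qinner_self, Quaternion.mul_coe_eq_smul, Quaternion.re_smul, smul_eq_mul]
    ring
  refine ⟨∑ t, d t, fun A => ?_⟩
  rw [Fin.sum_univ_succ]
  simp only [quatBasis_succ, himUnit, Finset.sum_add_distrib, ← Finset.sum_mul, quatBasis_zero,
    one_smul, Finset.sum_const, Finset.card_univ, Fintype.card_fin, nsmul_eq_mul]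
  ring

variable [DecidableEq ι]

theorem sum_quatBasis_smul (t : Fin 4) (β : (ι → ℍ[ℝ]) →ₗ[ℝ] (ι → ℍ[ℝ]) →ₗ[ℝ] ℝ) :
    ∑ k, β (quatBasis t • stdBasis k) (quatBasis t • stdBasis k) =
      ∑ k, β (stdBasis k) (stdBasis k) := by
  have horth (k l : ι × Fin 4) :
      rinner (quatBasis t • stdBasis k) (quatBasis t • stdBasis l) = if k = l then 1 else 0 := by
    rw [rinner_quat_smul_quat_smul, star_quatBasis_mul_self, one_smul, rinner_stdBasis]
  rw [sum_diag_of_orthogonal (by simp [mul_comm]) one_ne_zero horth β, one_mul]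

theorem sum_rinner_qinner_smul (A Z : ι → ℍ[ℝ]) :
    ∑ k, rinner (L (stdBasis k)) (qinner (stdBasis k) A • Z) =
      ∑ t, rinner (L (quatBasis t • A)) (quatBasis t • Z) := by
  have hexpand (k : ι × Fin 4) : rinner (L (stdBasis k)) (qinner (stdBasis k) A • Z) =
      ∑ t, rinner (quatBasis t • A) (stdBasis k) *
        rinner (L (stdBasis k)) (quatBasis t • Z) := by
    rw [qinner_eq_sum_quatBasis, Finset.sum_smul, rinner_comm, rinner_sum_left]
    refine Finset.sum_congr rfl fun t _ => ?_
    rw [Quaternion.coe_mul_eq_smul, smul_assoc, rinner_real_smul_left, rinner_comm (stdBasis k),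
      rinner_comm (_ • Z)]
  simp only [hexpand]
  rw [Finset.sum_comm]
  refine Finset.sum_congr rfl fun t _ => ?_
  simp only [← rinner_real_smul_left, ← rinner_sum_left, sum_rinner_smul_map_stdBasis]

theorem sum_rinner_quatBasis_comm (s : Fin 3) :
    ∑ k, ∑ t, rinner (L (quatBasis t • stdBasis k)) (quatBasis t • imUnit s • stdBasis k) = 0 := by
  have hconj (t : Fin 4) :
      ∑ k, rinner (L (quatBasis t • stdBasis k)) (quatBasis t • imUnit s • stdBasis k) =
        commSign t s * ∑ k, rinner (L (stdBasis k)) (imUnit s • stdBasis k) := by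
    rw [← show _ = ∑ k, rinner (L (stdBasis k)) (imUnit s • stdBasis k) from
      sum_quatBasis_smul t (rinnerBilin L (DistribSMul.toLinearMap ℝ _ (imUnit s))),
      Finset.mul_sum]
    refine Finset.sum_congr rfl fun k _ => ?_
    rw [smul_smul, quatBasis_mul_imUnit, smul_assoc, rinner_real_smul_right, mul_smul]
    rfl
  rw [Finset.sum_comm]
  simp only [hconj, ← Finset.sum_mul, sum_commSign, zero_mul]

theorem four_rinner_of_normalizer [Nonempty ι] {a : Fin 3 → Fin 3 → ℝ}
    (hL : ∀ t A, L (imUnit t • A) - imUnit t • L A = ∑ r, a t r • imUnit r • A)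
    (s : Fin 3) (A : ι → ℍ[ℝ]) :
    4 * rinner (L A) (imUnit s • A) =
      ∑ k, rinner (L (stdBasis k)) (qinner (stdBasis k) A • imUnit s • A) +
      rinner A A / Fintype.card ι * ∑ k, rinner (L (stdBasis k)) (imUnit s • stdBasis k) := by
  obtain ⟨d, hd⟩ := exists_sum_rinner_quatBasis_of_normalizer L hL s
  have htrace := sum_rinner_quatBasis_comm L s
  simp only [hd, Finset.sum_add_distrib, ← Finset.mul_sum, sum_rinner_stdBasis_self] at htrace
  rw [sum_rinner_qinner_smul, hd]
  field_simp
  linear_combination -(rinner A A / 4) * htrace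

end Normalizer

/-! ### The Biquard connection along the Reeb fields -/

/-- The horizontal Hessian `A ↦ D_A (∇h)` of `h` in the left-invariant frame. -/
def hess (h : QHeis n → ℝ) (p : QHeis n) : (Fin n → ℍ[ℝ]) →ₗ[ℝ] (Fin n → ℍ[ℝ]) :=
  (fderiv ℝ (grad h) p : QHeis n →ₗ[ℝ] (Fin n → ℍ[ℝ])) ∘ₗ horField p

/-- The sub-Laplacian of `h`, the trace of the horizontal Hessian. -/
def lap (h : QHeis n → ℝ) (p : QHeis n) : ℝ := ∑ k, rinner (hess h p (stdBasis k)) (stdBasis k)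

/-- The horizontal part of the bracket of the Reeb field `ξₛ` with left-invariant horizontal
fields; the torsion `T(ξₛ, ·)` is the difference of `conn Γ p (ξₛ)` and this map. -/
def reebBracket (h : QHeis n → ℝ) (p : QHeis n) (s : Fin 3) :
    (Fin n → ℍ[ℝ]) →ₗ[ℝ] (Fin n → ℍ[ℝ]) where
  toFun A := -(imUnit s • hess h p A) + (2 * h p)⁻¹ •
    ((qinner (grad h p) A * imUnit s - imUnit s * qinner (grad h p) A) • grad h p)
  map_add' A B := by
    simp only [map_add, qinner_add_right, add_mul, mul_add, smul_add, add_smul, sub_smul, smul_sub]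
    abel
  map_smul' c A := by
    simp only [map_smul, qinner_real_smul_right, smul_mul_assoc, mul_smul_comm, ← smul_sub,
      RingHom.id_apply, smul_add, smul_neg, smul_assoc, smul_comm _ c]

theorem reebBracket_apply (h : QHeis n → ℝ) (p : QHeis n) (s : Fin 3) (A : Fin n → ℍ[ℝ]) :
    reebBracket h p s A = -(imUnit s • hess h p A) + (2 * h p)⁻¹ •
      ((qinner (grad h p) A * imUnit s - imUnit s * qinner (grad h p) A) • grad h p) := rfl

/-- The horizontal frame `√(2h) stdBasis`, orthonormal for the metric of `(1 / 2h) Θ̃`. -/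
def stdFrame (h : QHeis n → ℝ) (p : QHeis n) (a : Fin (4 * n)) : QHeis n :=
  √(2 * h p) • horField p (stdBasis (finProdFinEquiv.symm.trans (Equiv.prodComm _ _) a))

/-- The element `X ↦ (X, A) eₛ A` of `sp(n)`, where `eₛ = imUnit s`. -/
def spElement (s : Fin 3) (A : Fin n → ℍ[ℝ]) : (Fin n → ℍ[ℝ]) →ₗ[ℝ] (Fin n → ℍ[ℝ]) where
  toFun X := qinner X A • imUnit s • A
  map_add' X Y := by rw [qinner_add_left, add_smul]
  map_smul' c X := by rw [qinner_real_smul_left, smul_assoc, RingHom.id_apply]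

theorem spElement_apply (s : Fin 3) (A X : Fin n → ℍ[ℝ]) :
    spElement s A X = qinner X A • imUnit s • A := rfl

theorem spElement_imUnit_smul (s t : Fin 3) (A X : Fin n → ℍ[ℝ]) :
    spElement s A (imUnit t • X) = imUnit t • spElement s A X := by
  rw [spElement_apply, spElement_apply, qinner_smul_left, mul_smul]

theorem rinner_spElement (s : Fin 3) (A X Y : Fin n → ℍ[ℝ]) :
    rinner (spElement s A X) Y = -rinner X (spElement s A Y) := by
  rw [spElement_apply, spElement_apply, rinner_comm X, smul_smul, smul_smul, rinner_smul_left,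
    rinner_smul_left, ← star_qinner X A, ← star_qinner Y A]
  fin_cases s <;> simp [Quaternion.re_mul, Quaternion.imI_mul, Quaternion.imJ_mul,
    Quaternion.imK_mul] <;> ring

theorem sum_im_imUnit_mul_smul_imUnit (s : Fin 3) (y : ℍ[ℝ]) :
    ∑ t, (2 * ((if t = s then y.re else 0) - im t (imUnit s * y))) • imUnit t =
      y * imUnit s - imUnit s * y := by
  fin_cases s <;> ext <;> simp [Fin.sum_univ_three, Quaternion.re_mul, Quaternion.imI_mul,
    Quaternion.imJ_mul, Quaternion.imK_mul] <;> ring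

namespace QCStructure

variable {Ω : Set (QHeis n)} {h : QHeis n → ℝ} {p : QHeis n}
  {Γ : QHeis n → QHeis n →L[ℝ] QHeis n →L[ℝ] QHeis n} (Q : QCStructure n Ω (confForm h))

include Q

theorem conn_quaternionic (hp : p ∈ Ω) (hΓ : Q.IsBiquardConnection Γ) (v : QHeis n) :
    ∃ a : Fin 3 → Fin 3 → ℝ, ∀ s A,
      conn Γ p v (imUnit s • A) - imUnit s • conn Γ p v A = ∑ t, a s t • imUnit t • A := by
  obtain ⟨a, ha⟩ := hΓ.quaternionic_parallel p hp v
  refine ⟨a, fun s A => horField_injective p ?_⟩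
  have hpar := ha s _ (horField_mem h p A)
  have hI := ((Q.hasDirDeriv_of_contDiffOn (Q.contDiffOn_I s) hp v).clm_apply
    (hasDirDeriv_horField A p v)).unique (hasDirDeriv_horField (imUnit s • A) p v) Q.isOpen hp
    fun x hx => (Q.I_horField hx s A).symm
  simp only [Q.I_horField hp, Q.Γ_horField hp hΓ, map_sub, ← hI] at hpar
  simp only [map_sub, map_sum, map_smul, ← hpar]
  abel

theorem hasDirDeriv_grad (hp : p ∈ Ω) (A : Fin n → ℍ[ℝ]) :
    HasDirDeriv (grad h) (hess h p A) p (horField p A) :=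
  Q.hasDirDeriv_of_contDiffOn (contDiffOn_grad Q.isOpen Q.contDiffOn_conf) hp _

theorem fderiv_reeb (hp : p ∈ Ω) (s : Fin 3) (A : Fin n → ℍ[ℝ]) :
    fderiv ℝ (Q.ξ s) p (horField p A) = horField p (imUnit s • hess h p A) +
      horFieldDeriv (imUnit s • grad h p) (horField p A) +
      (2 * rinner (grad h p) A) • vertField s := by
  have hξ := ((HasDirDeriv.const (imUnit s) p (horField p A)).quat_smul
      (Q.hasDirDeriv_grad hp A)).horField.add
    (((Q.hasDirDeriv_of_contDiffOn Q.contDiffOn_conf hp (horField p A)).const_smul 2).smul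
      (.const (vertField s : QHeis n) p (horField p A)))
  rw [(hξ.congr_of_isOpen Q.isOpen hp fun x hx => Q.reeb_eq hx s).fderiv_eq, zero_smul, zero_add,
    smul_zero, add_zero, smul_eq_mul, rinner_grad]

theorem torsion_reeb_horField (hp : p ∈ Ω) (hΓ : Q.IsBiquardConnection Γ) (s : Fin 3)
    (A : Fin n → ℍ[ℝ]) :
    torsion Γ p (Q.ξ s p) (horField p A) = horField p (conn Γ p (Q.ξ s p) A) -
      horFieldDeriv A (Q.ξ s p) - covDeriv Γ (Q.ξ s) p (horField p A) +
      fderiv ℝ (Q.ξ s) p (horField p A) := by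
  rw [torsion, covDeriv, Q.Γ_horField hp hΓ]
  abel

theorem stdForm_covDeriv_reeb (hp : p ∈ Ω) (hΓ : Q.IsBiquardConnection Γ) (s t : Fin 3)
    (A : Fin n → ℍ[ℝ]) :
    stdForm n t p (covDeriv Γ (Q.ξ s) p (horField p A)) =
      2 * ((if t = s then (qinner (grad h p) A).re else 0) -
        im t (imUnit s * qinner (grad h p) A)) := by
  have htor := stdForm_eq_zero_of_mem (Q.conf_ne_zero hp)
    (hΓ.torsion_vertical p hp s _ (horField_mem h p A)) t
  rw [Q.torsion_reeb_horField hp hΓ, Q.fderiv_reeb hp] at htor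
  simp only [map_add, map_sub, map_smul, stdForm_horField, stdForm_horFieldDeriv,
    stdForm_vertField, Q.qcoord_reeb hp, qcoord_horField, smul_eq_mul,
    im_qinner_comm t A (imUnit s • grad h p), qinner_smul_left, rinner] at htor
  split_ifs at htor ⊢ <;> linear_combination -htor

theorem eq_sum_reeb_of_mem_span (hp : p ∈ Ω) {v : QHeis n}
    (hv : v ∈ Submodule.span ℝ (Set.range fun t => Q.ξ t p)) :
    v = ∑ t, confForm h t p v • Q.ξ t p := by
  obtain ⟨c, rfl⟩ := (Submodule.mem_span_range_iff_exists_fun ℝ).1 hv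
  simp [Q.reeb_dual p hp]

theorem qcoord_covDeriv_reeb (hp : p ∈ Ω) (hΓ : Q.IsBiquardConnection Γ) (s : Fin 3)
    (A : Fin n → ℍ[ℝ]) :
    qcoord (covDeriv Γ (Q.ξ s) p (horField p A)) = (2 * h p)⁻¹ •
      ((qinner (grad h p) A * imUnit s - imUnit s * qinner (grad h p) A) • grad h p) := by
  rw [Q.eq_sum_reeb_of_mem_span hp (hΓ.vertical_parallel p hp (horField p A) s), qcoord_map_sum,
    ← sum_im_imUnit_mul_smul_imUnit, Finset.sum_smul, Finset.smul_sum]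
  refine Finset.sum_congr rfl fun t _ => ?_
  rw [qcoord_map_smul, Q.qcoord_reeb hp, confForm_apply, Q.stdForm_covDeriv_reeb hp hΓ, mul_smul,
    smul_assoc]

theorem torsion_reeb (hp : p ∈ Ω) (hΓ : Q.IsBiquardConnection Γ) (s : Fin 3)
    (A : Fin n → ℍ[ℝ]) :
    torsion Γ p (Q.ξ s p) (horField p A) =
      horField p ((conn Γ p (Q.ξ s p) - reebBracket h p s) A) := by
  rw [eq_horField_of_mem (Q.conf_ne_zero hp)
    (hΓ.torsion_vertical p hp s _ (horField_mem h p A)), Q.torsion_reeb_horField hp hΓ,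
    Q.fderiv_reeb hp]
  simp only [qcoord_map_add, qcoord_map_sub, qcoord_map_smul, qcoord_horField,
    qcoord_horFieldDeriv, qcoord_vertField, Q.qcoord_covDeriv_reeb hp hΓ, smul_zero, add_zero,
    sub_zero, LinearMap.sub_apply, reebBracket_apply]
  exact congrArg _ (by abel)

theorem isFrame_stdFrame (hp : p ∈ Ω) (hpos : 0 < h p) : Q.IsFrame p (stdFrame h p) := by
  refine ⟨fun a => Submodule.smul_mem _ _ (horField_mem h p _), fun a b => ?_⟩
  have hsqrt : √(2 * h p) * (√(2 * h p) * (2 * h p)⁻¹) = 1 := by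
    rw [← mul_assoc, Real.mul_self_sqrt (by positivity), mul_inv_cancel₀ (by positivity)]
  simp only [stdFrame, map_smul, smul_apply, Q.g_horField hp, rinner_stdBasis, smul_eq_mul,
    EmbeddingLike.apply_eq_iff_eq, mul_ite, mul_one, mul_zero, hsqrt]

theorem sum_stdFrame (hp : p ∈ Ω) (hpos : 0 < h p) {T M : QHeis n →L[ℝ] QHeis n}
    {K L : (Fin n → ℍ[ℝ]) →ₗ[ℝ] (Fin n → ℍ[ℝ])} (hT : ∀ A, T (horField p A) = horField p (K A))
    (hM : ∀ A, M (horField p A) = horField p (L A)) :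
    ∑ a, Q.g p (T (stdFrame h p a)) (M (stdFrame h p a)) =
      ∑ k, rinner (K (stdBasis k)) (L (stdBasis k)) := by
  rw [← Equiv.sum_comp (finProdFinEquiv.symm.trans (Equiv.prodComm (Fin 4) (Fin n)))]
  refine Finset.sum_congr rfl fun a _ => ?_
  simp only [stdFrame, map_smul, hT, hM, smul_apply, Q.g_horField hp, smul_eq_mul]
  rw [← mul_assoc, Real.mul_self_sqrt (by positivity), mul_inv_cancel_left₀ (by positivity)]

theorem isSp_spElement (hp : p ∈ Ω) (s : Fin 3) (A : Fin n → ℍ[ℝ]) :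
    Q.IsSp p (horField p ∘ₗ spElement s A ∘ₗ qcoordLin).toContinuousLinearMap := by
  have happly (X : Fin n → ℍ[ℝ]) :
      (horField p ∘ₗ spElement s A ∘ₗ qcoordLin).toContinuousLinearMap (horField p X) =
        horField p (spElement s A X) :=
    congrArg (fun Y => horField p (spElement s A Y)) (qcoord_horField p X)
  refine ⟨fun X _ => horField_mem h p _, fun X hX Y hY => ?_, fun t X hX => ?_⟩
  · rw [eq_horField_of_mem (Q.conf_ne_zero hp) hX, eq_horField_of_mem (Q.conf_ne_zero hp) hY,
      happly, happly, Q.g_horField hp, Q.g_horField hp, rinner_spElement, mul_neg]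
  · rw [eq_horField_of_mem (Q.conf_ne_zero hp) hX, happly, Q.I_horField hp, Q.I_horField hp,
      happly, spElement_imUnit_smul]

theorem sum_rinner_conn_reeb_spElement (hp : p ∈ Ω) (hpos : 0 < h p)
    (hΓ : Q.IsBiquardConnection Γ) (s : Fin 3) (A : Fin n → ℍ[ℝ]) :
    ∑ k, rinner (conn Γ p (Q.ξ s p) (stdBasis k)) (spElement s A (stdBasis k)) =
      ∑ k, rinner (reebBracket h p s (stdBasis k)) (spElement s A (stdBasis k)) := by
  rw [← sub_eq_zero, ← Finset.sum_sub_distrib]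
  simp only [← rinner_sub_left, ← LinearMap.sub_apply]
  exact (Q.sum_stdFrame (T := Γ p (Q.ξ s p) - (Γ p).flip (Q.ξ s p)) hp hpos
    (Q.torsion_reeb hp hΓ s)
    (fun X => congrArg (fun Y => horField p (spElement s A Y)) (qcoord_horField p X))).symm.trans
    (hΓ.torsion_perp_sp p hp s _ (Q.isFrame_stdFrame hp hpos) _ (Q.isSp_spElement hp s A))

theorem sum_rinner_conn_reeb_imUnit (hp : p ∈ Ω) (hpos : 0 < h p)
    (hΓ : Q.IsBiquardConnection Γ) (s t : Fin 3) :
    ∑ k, rinner (conn Γ p (Q.ξ s p) (stdBasis k)) (imUnit t • stdBasis k) =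
      ∑ k, rinner (reebBracket h p s (stdBasis k)) (imUnit t • stdBasis k) := by
  rw [← sub_eq_zero, ← Finset.sum_sub_distrib]
  simp only [← rinner_sub_left, ← LinearMap.sub_apply]
  exact (Q.sum_stdFrame (T := Γ p (Q.ξ s p) - (Γ p).flip (Q.ξ s p))
    (L := DistribSMul.toLinearMap ℝ _ (imUnit t)) hp hpos (Q.torsion_reeb hp hΓ s)
    (Q.I_horField hp t)).symm.trans
    (hΓ.torsion_perp_sp_one p hp s _ (Q.isFrame_stdFrame hp hpos) t)

theorem four_rinner_conn_reeb [NeZero n] (hp : p ∈ Ω) (hpos : 0 < h p)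
    (hΓ : Q.IsBiquardConnection Γ) (s : Fin 3) (A : Fin n → ℍ[ℝ]) :
    4 * rinner (conn Γ p (Q.ξ s p) A) (imUnit s • A) =
      ∑ t, rinner (reebBracket h p s (quatBasis t • A)) (quatBasis t • imUnit s • A) +
      rinner A A / n * ∑ k, rinner (reebBracket h p s (stdBasis k)) (imUnit s • stdBasis k) := by
  obtain ⟨a, ha⟩ := Q.conn_quaternionic hp hΓ (Q.ξ s p)
  have hsp := Q.sum_rinner_conn_reeb_spElement hp hpos hΓ s A
  simp only [spElement_apply] at hsp
  rw [four_rinner_of_normalizer _ ha, hsp, Q.sum_rinner_conn_reeb_imUnit hp hpos hΓ,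
    sum_rinner_qinner_smul, Fintype.card_fin]

end QCStructure

section TraceIdentities

variable {ι : Type*} [Fintype ι] [DecidableEq ι]

theorem sum_re_qinner_right (a r : ℍ[ℝ]) (Y Z : ι → ℍ[ℝ]) :
    ∑ k, (a * (qinner Y (stdBasis k) * r * qinner Z (stdBasis k))).re =
      -2 * (a * (qinner Y Z * star r)).re := by
  rw [← re_sum, ← Finset.mul_sum, sum_qinner_mul_qinner_right, mul_smul_comm,
    Quaternion.re_smul, smul_eq_mul]

theorem sum_re_qinner_left (a r : ℍ[ℝ]) (Y Z : ι → ℍ[ℝ]) :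
    ∑ k, (a * (qinner (stdBasis k) Y * r * qinner Z (stdBasis k))).re =
      4 * a.re * (r * qinner Z Y).re := by
  rw [← re_sum, ← Finset.mul_sum, sum_qinner_mul_qinner_left, Quaternion.mul_coe_eq_smul,
    Quaternion.re_smul, smul_eq_mul]
  ring

end TraceIdentities

section ReebTrace

variable (h : QHeis n → ℝ) (p : QHeis n) (s : Fin 3)

theorem sum_rinner_reebBracket_imUnit :
    ∑ k, rinner (reebBracket h p s (stdBasis k)) (imUnit s • stdBasis k) =
      4 * (2 * h p)⁻¹ * rinner (grad h p) (grad h p) - lap h p := by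
  have hterm (k : Fin n × Fin 4) :
      rinner (reebBracket h p s (stdBasis k)) (imUnit s • stdBasis k) =
        -rinner (hess h p (stdBasis k)) (stdBasis k) + (2 * h p)⁻¹ *
          ((star (imUnit s) *
            (qinner (grad h p) (stdBasis k) * imUnit s * qinner (grad h p) (stdBasis k))).re -
          (1 * (qinner (grad h p) (stdBasis k) * 1 * qinner (grad h p) (stdBasis k))).re) := by
    rw [reebBracket_apply, rinner_add_left, rinner_neg_left, rinner_real_smul_left,
      rinner_quat_smul_quat_smul, rinner_quat_smul_quat_smul, star_imUnit_mul_self, one_smul,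
      mul_sub, ← mul_assoc (star (imUnit s)) (imUnit s), star_imUnit_mul_self, one_mul, one_mul,
      mul_one, rinner_smul_left, sub_mul, Quaternion.re_sub]
    simp only [mul_assoc]
  simp only [hterm, Finset.sum_add_distrib, Finset.sum_neg_distrib, ← Finset.mul_sum,
    Finset.sum_sub_distrib, sum_re_qinner_right]
  simp only [lap, qinner_self, Quaternion.coe_mul_eq_smul,
    mul_smul_comm, ← star_mul, imUnit_mul_self, star_one, star_neg, Quaternion.re_smul,
    Quaternion.re_neg, Quaternion.re_one, one_mul, smul_eq_mul]
  ring

theorem rinner_reebBracket_quatBasis (t : Fin 4) (A : Fin n → ℍ[ℝ]) :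
    rinner (reebBracket h p s (quatBasis t • A)) (quatBasis t • imUnit s • A) =
      -(commSign t s * rinner (hess h p (quatBasis t • A)) (quatBasis t • A)) + (2 * h p)⁻¹ *
        ((qinner (grad h p) A * star (quatBasis t) * imUnit s -
          imUnit s * (qinner (grad h p) A * star (quatBasis t))) *
            (qinner (grad h p) A * star (quatBasis t * imUnit s))).re := by
  rw [reebBracket_apply, rinner_add_left, rinner_neg_left, rinner_real_smul_left, smul_smul,
    rinner_comm (imUnit s • _), rinner_smul_right, smul_smul, ← mul_assoc,
    star_imUnit_mul_quatBasis_mul_imUnit, smul_assoc, rinner_real_smul_left,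
    rinner_comm (quatBasis t • A), rinner_smul_left, qinner_smul_right, qinner_smul_right]

theorem sum_rinner_reebBracket_quatBasis (A : Fin n → ℍ[ℝ]) :
    ∑ t, rinner (reebBracket h p s (quatBasis t • A)) (quatBasis t • imUnit s • A) =
      -(rinner (hess h p A) A) + ∑ t, rinner (hess h p (imUnit t • A)) (imUnit t • A) -
        2 * rinner (hess h p (imUnit s • A)) (imUnit s • A) +
      4 * (2 * h p)⁻¹ * (Quaternion.normSq (qinner (grad h p) A) -
        2 * (qinner (grad h p) A).re ^ 2 - 2 * im s (qinner (grad h p) A) ^ 2) := by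
  simp only [rinner_reebBracket_quatBasis, Finset.sum_add_distrib, Finset.sum_neg_distrib,
    ← Finset.mul_sum]
  congr 1
  · rw [Fin.sum_univ_succ]
    fin_cases s <;> simp [commSign, quatBasis_succ, Fin.sum_univ_three] <;> ring
  · rw [mul_comm 4, mul_assoc]
    congr 1
    generalize qinner (grad h p) A = y
    rw [Quaternion.normSq_def']
    fin_cases s <;> simp [Fin.sum_univ_four, Quaternion.re_mul, Quaternion.imI_mul,
      Quaternion.imJ_mul, Quaternion.imK_mul] <;> ring

end ReebTrace

theorem QCStructure.four_sum_rinner_conn_reeb [NeZero n] {Ω : Set (QHeis n)} {h : QHeis n → ℝ}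
    {p : QHeis n} {Γ : QHeis n → QHeis n →L[ℝ] QHeis n →L[ℝ] QHeis n}
    (Q : QCStructure n Ω (confForm h)) (hp : p ∈ Ω) (hpos : 0 < h p)
    (hΓ : Q.IsBiquardConnection Γ) (A : Fin n → ℍ[ℝ]) :
    4 * ∑ s, rinner (conn Γ p (Q.ξ s p) A) (imUnit s • A) =
      -3 * rinner (hess h p A) A + ∑ t, rinner (hess h p (imUnit t • A)) (imUnit t • A) +
      4 * (2 * h p)⁻¹ *
        (Quaternion.normSq (qinner (grad h p) A) - 4 * (qinner (grad h p) A).re ^ 2) +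
      3 * rinner A A / n * (4 * (2 * h p)⁻¹ * rinner (grad h p) (grad h p) - lap h p) := by
  rw [Finset.mul_sum]
  simp only [Q.four_rinner_conn_reeb hp hpos hΓ, sum_rinner_reebBracket_quatBasis,
    sum_rinner_reebBracket_imUnit, Quaternion.normSq_def', Fin.sum_univ_three, im_zero, im_one,
    im_two]
  ring

/-! ### The Ricci tensor of the Biquard connection -/

section ConnForm

variable {ι : Type*} [Fintype ι]

/-- The action on `B` of the Biquard connection form of `(1 / 2h) Θ̃` in the direction `A`, in the
left-invariant frame, where `w = ∇h / (2h)`. -/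
def connForm (w A B : ι → ℍ[ℝ]) : ι → ℍ[ℝ] :=
  qinner B A • w - qinner B w • A - qinner A w • B

theorem rinner_connForm_self (w A : ι → ℍ[ℝ]) : rinner (connForm w A A) w =
    rinner A A * rinner w w - 2 * (qinner A w * qinner A w).re := by
  rw [connForm, rinner_sub_left, rinner_sub_left, rinner_smul_left, rinner_smul_left, qinner_self,
    qinner_self, ← Quaternion.coe_mul, Quaternion.re_coe]
  ring

theorem re_qinner_mul_qinner (w A : ι → ℍ[ℝ]) : (qinner A w * qinner A w).re =
    2 * rinner A w ^ 2 - Quaternion.normSq (qinner A w) := by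
  rw [Quaternion.normSq_def', rinner, Quaternion.re_mul]
  ring

theorem sum_sq_rinner_imUnit_smul (w A : ι → ℍ[ℝ]) :
    ∑ s, rinner w (imUnit s • A) ^ 2 = Quaternion.normSq (qinner A w) - rinner A w ^ 2 := by
  simp only [rinner_imUnit_right, im_qinner_comm _ w A, Fin.sum_univ_three, im_zero, im_one, im_two]
  rw [Quaternion.normSq_def', rinner]
  ring

theorem rinner_connForm_imUnit_smul (w A : ι → ℍ[ℝ]) (s : Fin 3) :
    rinner (connForm w (imUnit s • w) A) (imUnit s • A) =
      ((qinner A w * star (imUnit s)) * (star (qinner A w) * star (imUnit s))).re -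
      (qinner A w * (imUnit s * (star (qinner A w) * star (imUnit s)))).re -
      rinner w w * rinner A A := by
  have hnorm : ((imUnit s * (rinner w w : ℍ[ℝ])) * ((rinner A A : ℍ[ℝ]) * star (imUnit s))).re =
      rinner w w * rinner A A := by
    rw [re_mul_comm, Quaternion.coe_mul_eq_smul, smul_mul_assoc, ← mul_assoc,
      star_imUnit_mul_self, one_mul, Quaternion.re_smul, Quaternion.re_coe, smul_eq_mul, mul_comm]
  rw [connForm, rinner_sub_left, rinner_sub_left, rinner_smul_left, rinner_smul_left,
    rinner_smul_left, qinner_smul_right, qinner_smul_right, qinner_smul_left, qinner_smul_left,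
    qinner_self, qinner_smul_right, qinner_smul_right, qinner_self, hnorm, star_qinner]

theorem sum_rinner_connForm_imUnit_smul (w A : ι → ℍ[ℝ]) :
    ∑ s, rinner (connForm w (imUnit s • w) A) (imUnit s • A) =
      -8 * rinner A w ^ 2 + 2 * Quaternion.normSq (qinner A w) - 3 * rinner w w * rinner A A := by
  simp only [rinner_connForm_imUnit_smul, Fin.sum_univ_three]
  rw [Quaternion.normSq_def', rinner.eq_def A w]
  generalize qinner A w = x
  simp [Quaternion.re_mul, Quaternion.imI_mul, Quaternion.imJ_mul, Quaternion.imK_mul]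
  ring

variable [DecidableEq ι]

theorem sum_rinner_qinner_smul_self (K : (ι → ℍ[ℝ]) →ₗ[ℝ] (ι → ℍ[ℝ])) (A : ι → ℍ[ℝ]) :
    ∑ k, rinner (qinner A (K (stdBasis k)) • A) (stdBasis k) =
      rinner (K A) A - ∑ s, rinner (K (imUnit s • A)) (imUnit s • A) := by
  have hterm (k : ι × Fin 4) : rinner (qinner A (K (stdBasis k)) • A) (stdBasis k) =
      2 * rinner (rinner A (stdBasis k) • K (stdBasis k)) A -
        rinner (K (stdBasis k)) (qinner (stdBasis k) A • A) := by
    have hstar : qinner A (stdBasis k) = ((2 * rinner A (stdBasis k) : ℝ) : ℍ[ℝ]) -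
        qinner (stdBasis k) A := by
      rw [rinner, ← Quaternion.self_add_star', star_qinner, add_sub_cancel_right]
    rw [rinner_smul_left, re_mul_comm, ← rinner_smul_left, hstar, sub_smul, rinner_sub_left,
      rinner_comm (K _), rinner_smul_left, Quaternion.coe_mul_eq_smul, Quaternion.re_smul,
      smul_eq_mul, ← rinner, rinner_real_smul_left, rinner_comm (K _), mul_assoc]
  simp only [hterm, Finset.sum_sub_distrib, ← Finset.mul_sum, ← rinner_sum_left,
    sum_rinner_smul_map_stdBasis, sum_rinner_qinner_smul]
  simp only [Fin.sum_univ_succ (n := 3), quatBasis_succ, quatBasis_zero, one_smul]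
  ring

theorem sum_rinner_connForm_map (K : (ι → ℍ[ℝ]) →ₗ[ℝ] (ι → ℍ[ℝ])) (A : ι → ℍ[ℝ]) :
    ∑ k, rinner (connForm (K (stdBasis k)) A A) (stdBasis k) =
      rinner A A * ∑ k, rinner (K (stdBasis k)) (stdBasis k) -
        2 * (rinner (K A) A - ∑ s, rinner (K (imUnit s • A)) (imUnit s • A)) := by
  have hself (k : ι × Fin 4) : rinner (qinner A A • K (stdBasis k)) (stdBasis k) =
      rinner A A * rinner (K (stdBasis k)) (stdBasis k) := by
    rw [rinner_smul_left, qinner_self, Quaternion.coe_mul_eq_smul, Quaternion.re_smul, smul_eq_mul,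
      ← rinner]
  simp only [connForm, rinner_sub_left, Finset.sum_sub_distrib, sum_rinner_qinner_smul_self, hself,
    ← Finset.mul_sum]
  ring

theorem sum_re_mul_qinner_stdBasis (a : ℍ[ℝ]) :
    ∑ k : ι × Fin 4, (a * qinner (stdBasis k) (stdBasis k)).re = 4 * Fintype.card ι * a.re := by
  simp only [qinner_self, Quaternion.mul_coe_eq_smul, Quaternion.re_smul, smul_eq_mul,
    ← Finset.sum_mul, sum_rinner_stdBasis_self]

theorem sum_rinner_connForm_stdBasis (w Y : ι → ℍ[ℝ]) :
    ∑ k, rinner (connForm w (stdBasis k) Y) (stdBasis k) =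
      -(4 * Fintype.card ι + 6) * rinner Y w := by
  have hleft := sum_re_qinner_right 1 1 Y w
  have hright := sum_re_qinner_left 1 1 w Y
  simp only [one_mul, mul_one, star_one, Quaternion.re_one] at hleft hright
  simp only [connForm, rinner_sub_left, Finset.sum_sub_distrib, rinner_smul_left, hleft, hright,
    sum_re_mul_qinner_stdBasis]
  rw [rinner]
  ring

theorem sum_rinner_connForm_connForm_stdBasis (w A : ι → ℍ[ℝ]) :
    ∑ k, rinner (connForm w A (connForm w (stdBasis k) A)) (stdBasis k) =
      (4 * Fintype.card ι + 4) * (qinner A w * qinner A w).re -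
        2 * rinner A A * rinner w w + 4 * rinner A w ^ 2 := by
  -- `hᵢⱼ` is the product of the `i`-th summand of the outer `connForm` and the `j`-th summand of
  -- the inner one; the pair `(3, 3)` gives the same trace as `(2, 2)`.
  have h₁₁ := sum_re_qinner_right 1 (qinner w A) A w
  have h₁₂ := sum_re_qinner_left (qinner A w) 1 A w
  have h₁₃ := sum_re_qinner_left 1 (qinner A A) w w
  have h₂₁ := sum_re_qinner_right 1 (qinner w w) A A
  have h₂₂ := sum_re_qinner_left (qinner A w) 1 w A
  have h₂₃ := sum_re_qinner_left 1 (qinner A w) w A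
  have h₃₁ := sum_re_qinner_right (qinner A w) 1 A w
  have h₃₂ := sum_re_mul_qinner_stdBasis (ι := ι) (qinner A w * qinner A w)
  simp only [one_mul, mul_one, star_one, Quaternion.re_one, mul_assoc]
    at h₁₁ h₁₂ h₁₃ h₂₁ h₂₂ h₂₃ h₃₁ h₃₂
  simp only [connForm, rinner_sub_left, Finset.sum_sub_distrib, rinner_smul_left, qinner_sub_left,
    qinner_smul_left, sub_mul, mul_sub, Quaternion.re_sub, mul_assoc]
  rw [h₁₁, h₁₂, h₁₃, h₂₁, h₂₂, h₂₃, h₃₁, h₃₂, star_qinner, star_qinner, qinner_self, qinner_self,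
    ← Quaternion.coe_mul, Quaternion.re_coe, ← rinner, ← rinner, rinner_comm w A]
  ring

theorem sum_rinner_sum_im_smul (A : ι → ℍ[ℝ]) (c : Fin 3 → ι → ℍ[ℝ]) :
    ∑ k, rinner (∑ s, (2 * im s (qinner A (stdBasis k))) • c s) (stdBasis k) =
      -2 * ∑ s, rinner (c s) (imUnit s • A) := by
  simp only [rinner_sum_left, rinner_real_smul_left]
  rw [Finset.sum_comm, Finset.mul_sum]
  refine Finset.sum_congr rfl fun s _ => ?_
  rw [rinner_comm, ← sum_rinner_mul_rinner_stdBasis, Finset.mul_sum]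
  refine Finset.sum_congr rfl fun k _ => ?_
  rw [rinner_imUnit_left]
  ring

end ConnForm

/-- The vector `∇h / (2h)`, which enters the Biquard connection of `(1 / 2h) Θ̃`. -/
def wgrad (h : QHeis n → ℝ) (p : QHeis n) : Fin n → ℍ[ℝ] := (2 * h p)⁻¹ • grad h p

/-- The horizontal derivative of `wgrad h` as an endomorphism of `ℍⁿ`. -/
def wderiv (h : QHeis n → ℝ) (p : QHeis n) : (Fin n → ℍ[ℝ]) →ₗ[ℝ] (Fin n → ℍ[ℝ]) where
  toFun A := (2 * h p)⁻¹ • hess h p A - (2 * rinner (wgrad h p) A) • wgrad h p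
  map_add' A B := by simp only [map_add, rinner_add_right, smul_add, mul_add, add_smul]; abel
  map_smul' c A := by
    simp only [map_smul, rinner_real_smul_right, RingHom.id_apply, smul_sub, smul_smul]
    congr 2 <;> ring

theorem wderiv_apply (h : QHeis n → ℝ) (p : QHeis n) (A : Fin n → ℍ[ℝ]) :
    wderiv h p A = (2 * h p)⁻¹ • hess h p A - (2 * rinner (wgrad h p) A) • wgrad h p := rfl

theorem rinner_wderiv_self (h : QHeis n → ℝ) (p : QHeis n) (A : Fin n → ℍ[ℝ]) :
    rinner (wderiv h p A) A =
      (2 * h p)⁻¹ * rinner (hess h p A) A - 2 * rinner (wgrad h p) A ^ 2 := by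
  rw [wderiv_apply, rinner_sub_left, rinner_real_smul_left, rinner_real_smul_left]
  ring

theorem sum_rinner_wderiv (h : QHeis n → ℝ) (p : QHeis n) :
    ∑ k, rinner (wderiv h p (stdBasis k)) (stdBasis k) =
      (2 * h p)⁻¹ * lap h p - 2 * rinner (wgrad h p) (wgrad h p) := by
  simp only [rinner_wderiv_self, pow_two, Finset.sum_sub_distrib, ← Finset.mul_sum,
    sum_rinner_mul_rinner_stdBasis, lap]

/-- The endomorphism `b ↦ R(b, A)B` of `ℍⁿ` representing the horizontal curvature of the Biquard
connection in the left-invariant frame. The sum comes from the brackets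
`[b, A] = ∑ₛ 2 im s (A, b) ∂ₛ` of left-invariant horizontal fields. -/
def frameCurv (h : QHeis n → ℝ) (Γ : QHeis n → QHeis n →L[ℝ] QHeis n →L[ℝ] QHeis n)
    (p : QHeis n) (A B : Fin n → ℍ[ℝ]) : (Fin n → ℍ[ℝ]) →ₗ[ℝ] (Fin n → ℍ[ℝ]) where
  toFun b := connForm (wderiv h p b) A B - connForm (wderiv h p A) b B +
    connForm (wgrad h p) b (connForm (wgrad h p) A B) -
    connForm (wgrad h p) A (connForm (wgrad h p) b B) +
    ∑ s, (2 * im s (qinner A b)) • conn Γ p (vertField s) B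
  map_add' b c := by
    simp only [connForm, map_add, qinner_add_left, qinner_add_right, qinner_sub_left,
      qinner_smul_left, im_add, mul_add, add_smul, smul_add, smul_sub, sub_smul,
      Finset.sum_add_distrib]
    abel
  map_smul' r b := by
    simp only [connForm, map_smul, qinner_real_smul_left, qinner_real_smul_right,
      qinner_sub_left, qinner_smul_left, im_smul, smul_assoc, smul_add, smul_sub, sub_smul,
      smul_comm _ r, mul_left_comm _ r, RingHom.id_apply, Finset.smul_sum, mul_smul r]

theorem frameCurv_apply (h : QHeis n → ℝ)
    (Γ : QHeis n → QHeis n →L[ℝ] QHeis n →L[ℝ] QHeis n) (p : QHeis n) (A B b : Fin n → ℍ[ℝ]) :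
    frameCurv h Γ p A B b = connForm (wderiv h p b) A B - connForm (wderiv h p A) b B +
      connForm (wgrad h p) b (connForm (wgrad h p) A B) -
      connForm (wgrad h p) A (connForm (wgrad h p) b B) +
      ∑ s, (2 * im s (qinner A b)) • conn Γ p (vertField s) B := rfl

theorem sum_rinner_frameCurv (h : QHeis n → ℝ)
    (Γ : QHeis n → QHeis n →L[ℝ] QHeis n →L[ℝ] QHeis n) (p : QHeis n) (A : Fin n → ℍ[ℝ]) :
    ∑ k, rinner (frameCurv h Γ p A A (stdBasis k)) (stdBasis k) =
      (2 * h p)⁻¹ * ((4 * n + 4) * rinner (hess h p A) A +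
        2 * ∑ s, rinner (hess h p (imUnit s • A)) (imUnit s • A) + rinner A A * lap h p) -
      (4 * n + 6) * rinner A A * rinner (wgrad h p) (wgrad h p) +
      8 * rinner A (wgrad h p) ^ 2 - (4 * n + 12) * Quaternion.normSq (qinner A (wgrad h p)) -
      2 * ∑ s, rinner (conn Γ p (vertField s) A) (imUnit s • A) := by
  simp only [frameCurv_apply, rinner_add_left, rinner_sub_left, Finset.sum_add_distrib,
    Finset.sum_sub_distrib, sum_rinner_connForm_map, sum_rinner_connForm_stdBasis,
    sum_rinner_connForm_connForm_stdBasis, sum_rinner_sum_im_smul, rinner_connForm_self,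
    re_qinner_mul_qinner, rinner_comm A (wderiv h p A), sum_rinner_wderiv]
  simp only [rinner_wderiv_self, Finset.sum_sub_distrib, ← Finset.mul_sum,
    sum_sq_rinner_imUnit_smul, rinner_comm (wgrad h p) A, Fintype.card_fin]
  ring

theorem HasDirDeriv.connForm {w : QHeis n → Fin n → ℍ[ℝ]} {w' : Fin n → ℍ[ℝ]} {p v : QHeis n}
    (hw : HasDirDeriv w w' p v) (A B : Fin n → ℍ[ℝ]) :
    HasDirDeriv (fun x => QC.connForm (w x) A B) (QC.connForm w' A B) p v := by
  have hA := HasDirDeriv.const A p v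
  have hB := HasDirDeriv.const B p v
  refine ((((hB.qinner hA).quat_smul hw).sub ((hB.qinner hw).quat_smul hA)).sub
    ((hA.qinner hw).quat_smul hB)).congr_deriv ?_
  simp [QC.connForm]

theorem horFieldDeriv_horField_sub (p : QHeis n) (A b : Fin n → ℍ[ℝ]) :
    horFieldDeriv A (horField p b) - horFieldDeriv b (horField p A) =
      -∑ s, (2 * im s (qinner A b)) • vertField s := by
  rw [horFieldDeriv_eq_sum, horFieldDeriv_eq_sum, qcoord_horField, qcoord_horField]
  simp only [im_qinner_comm _ b A, neg_smul, Finset.sum_neg_distrib, two_mul, add_smul,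
    Finset.sum_add_distrib]
  abel

namespace QCStructure

variable {Ω : Set (QHeis n)} {h : QHeis n → ℝ} {p : QHeis n}
  {Γ : QHeis n → QHeis n →L[ℝ] QHeis n →L[ℝ] QHeis n} (Q : QCStructure n Ω (confForm h))

include Q

theorem hasDirDeriv_wgrad (hp : p ∈ Ω) (A : Fin n → ℍ[ℝ]) :
    HasDirDeriv (wgrad h) (wderiv h p A) p (horField p A) := by
  refine ((Q.hasDirDeriv_inv_two_mul hp (horField p A)).smul
    (Q.hasDirDeriv_grad hp A)).congr_deriv ?_
  rw [wderiv_apply, wgrad, rinner_real_smul_left, rinner_grad, smul_smul, sub_eq_add_neg,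
    ← neg_smul, add_comm]
  congr 2
  ring

theorem conn_horField_eq_connForm (hp : p ∈ Ω) (hΓ : Q.IsBiquardConnection Γ)
    (A B : Fin n → ℍ[ℝ]) : conn Γ p (horField p A) B = connForm (wgrad h p) A B := by
  rw [Q.conn_horField hp hΓ, connForm, wgrad, qinner_real_smul_right, qinner_real_smul_right,
    smul_sub, smul_sub, smul_assoc, smul_assoc, smul_comm (qinner B A)]

theorem Γ_horField_horField (hp : p ∈ Ω) (hΓ : Q.IsBiquardConnection Γ) (A B : Fin n → ℍ[ℝ]) :
    Γ p (horField p A) (horField p B) =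
      horField p (connForm (wgrad h p) A B) - horFieldDeriv B (horField p A) := by
  rw [Q.Γ_horField hp hΓ, Q.conn_horField_eq_connForm hp hΓ]

theorem Γ_vertField_horField (hp : p ∈ Ω) (hΓ : Q.IsBiquardConnection Γ) (s : Fin 3)
    (B : Fin n → ℍ[ℝ]) :
    Γ p (vertField s) (horField p B) = horField p (conn Γ p (vertField s) B) := by
  rw [Q.Γ_horField hp hΓ, horFieldDeriv_vertField, sub_zero]

theorem fderiv_Γ_horField (hp : p ∈ Ω) (hΓ : Q.IsBiquardConnection Γ) (b A B : Fin n → ℍ[ℝ]) :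
    fderiv ℝ Γ p (horField p b) (horField p A) (horField p B) =
      horField p (connForm (wderiv h p b) A B) +
      horFieldDeriv (connForm (wgrad h p) A B) (horField p b) -
      Γ p (horFieldDeriv A (horField p b)) (horField p B) -
      Γ p (horField p A) (horFieldDeriv B (horField p b)) := by
  have hΓ' := ((Q.hasDirDeriv_of_contDiffOn hΓ.contDiffOn hp (horField p b)).clm_apply
    (hasDirDeriv_horField A p _)).clm_apply (hasDirDeriv_horField B p _)
  have hform := ((Q.hasDirDeriv_wgrad hp b).connForm A B).horField.sub
    (.const (horFieldDeriv B (horField p A)) p (horField p b))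
  have hderiv := hΓ'.unique hform Q.isOpen hp fun x hx => by
    rw [Q.Γ_horField_horField hx hΓ]
    simp only [horFieldDeriv_apply, qcoord_horField]
  rw [sub_zero] at hderiv
  rw [← hderiv]
  simp only [add_apply]
  abel

theorem curvature_horField (hp : p ∈ Ω) (hΓ : Q.IsBiquardConnection Γ) (b A B : Fin n → ℍ[ℝ]) :
    curvature Γ p (horField p b) (horField p A) (horField p B) =
      horField p (frameCurv h Γ p A B b) := by
  have hvert : Γ p (horFieldDeriv A (horField p b)) (horField p B) =
      -horField p (∑ s, (2 * im s (qinner A b)) • conn Γ p (vertField s) B) +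
        Γ p (horFieldDeriv b (horField p A)) (horField p B) := by
    rw [← sub_eq_iff_eq_add, ← sub_apply, ← map_sub, horFieldDeriv_horField_sub]
    simp only [map_neg, map_sum, map_smul, neg_apply, sum_apply, smul_apply,
      Q.Γ_vertField_horField hp hΓ]
  have hΓ' (v C D : QHeis n) : fderiv ℝ (fun x => Γ x C D) p v = fderiv ℝ Γ p v C D := by
    have := ((Q.hasDirDeriv_of_contDiffOn hΓ.contDiffOn hp v).clm_apply (.const C p v)).clm_apply
      (.const D p v)
    simpa using this.fderiv_eq
  rw [curvature, covDeriv, covDeriv, hΓ', hΓ', Q.fderiv_Γ_horField hp hΓ,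
    Q.fderiv_Γ_horField hp hΓ, hvert, Q.Γ_horField_horField hp hΓ A,
    Q.Γ_horField_horField hp hΓ b, map_sub, map_sub, Q.Γ_horField_horField hp hΓ,
    Q.Γ_horField_horField hp hΓ, frameCurv_apply]
  simp only [map_add, map_sub]
  abel

theorem rinner_qcoord_of_isFrame (hp : p ∈ Ω) {e : Fin (4 * n) → QHeis n} (he : Q.IsFrame p e)
    (a b : Fin (4 * n)) :
    rinner (qcoord (e a)) (qcoord (e b)) = if a = b then 2 * h p else 0 := by
  have h0 := Q.conf_ne_zero hp
  have hab := he.2 a b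
  rw [eq_horField_of_mem h0 (he.1 a), eq_horField_of_mem h0 (he.1 b), Q.g_horField hp,
    inv_mul_eq_iff_eq_mul₀ (mul_ne_zero two_ne_zero h0)] at hab
  rw [hab, mul_ite, mul_one, mul_zero]

theorem ricci_eq_sum (hp : p ∈ Ω) (hΓ : Q.IsBiquardConnection Γ) {e : Fin (4 * n) → QHeis n}
    (he : Q.IsFrame p e) (A B : Fin n → ℍ[ℝ]) :
    Q.ricci Γ p e (horField p A) (horField p B) =
      ∑ k, rinner (frameCurv h Γ p A B (stdBasis k)) (stdBasis k) := by
  have h0 : 2 * h p ≠ 0 := mul_ne_zero two_ne_zero (Q.conf_ne_zero hp)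
  have hterm (a : Fin (4 * n)) : Q.g p (curvature Γ p (e a) (horField p A) (horField p B)) (e a) =
      (2 * h p)⁻¹ * rinnerBilin (frameCurv h Γ p A B) .id (qcoord (e a)) (qcoord (e a)) := by
    conv_lhs => rw [eq_horField_of_mem (Q.conf_ne_zero hp) (he.1 a), Q.curvature_horField hp hΓ,
      Q.g_horField hp]
    rfl
  simp only [ricci, hterm]
  rw [← Finset.mul_sum, sum_diag_of_orthogonal (by simp) h0 (Q.rinner_qcoord_of_isFrame hp he),
    inv_mul_cancel_left₀ h0]
  rfl

theorem conn_vertField (hp : p ∈ Ω) (hΓ : Q.IsBiquardConnection Γ) (s : Fin 3)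
    (A : Fin n → ℍ[ℝ]) :
    conn Γ p (vertField s) A = (2 * h p)⁻¹ • conn Γ p (Q.ξ s p) A -
      connForm (wgrad h p) (imUnit s • wgrad h p) A := by
  have hvert : (vertField s : QHeis n) =
      (2 * h p)⁻¹ • Q.ξ s p - horField p (imUnit s • wgrad h p) := by
    rw [Q.reeb_eq hp, wgrad, smul_comm (imUnit s), LinearMap.map_smul (horField p), smul_add,
      inv_smul_smul₀ (mul_ne_zero two_ne_zero (Q.conf_ne_zero hp)), add_sub_cancel_left]
  rw [← Q.conn_horField_eq_connForm hp hΓ, conn_apply, hvert]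
  simp only [map_sub, sub_apply, map_smul, smul_apply, qcoord_map_sub, qcoord_map_smul, conn_apply]

theorem four_sum_rinner_conn_vertField [NeZero n] (hp : p ∈ Ω) (hpos : 0 < h p)
    (hΓ : Q.IsBiquardConnection Γ) (A : Fin n → ℍ[ℝ]) :
    4 * ∑ s, rinner (conn Γ p (vertField s) A) (imUnit s • A) =
      (2 * h p)⁻¹ * (-3 * rinner (hess h p A) A +
        ∑ s, rinner (hess h p (imUnit s • A)) (imUnit s • A) - 3 / n * rinner A A * lap h p) -
      4 * Quaternion.normSq (qinner A (wgrad h p)) + 16 * rinner A (wgrad h p) ^ 2 +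
      12 * (1 + 1 / n) * rinner A A * rinner (wgrad h p) (wgrad h p) := by
  have hreeb := Q.four_sum_rinner_conn_reeb hp hpos hΓ A
  have hgrad : grad h p = (2 * h p) • wgrad h p :=
    (smul_inv_smul₀ (mul_ne_zero two_ne_zero hpos.ne') _).symm
  rw [← star_qinner A, Quaternion.normSq_star, Quaternion.re_star, ← rinner, hgrad,
    qinner_real_smul_right, Quaternion.normSq_smul, rinner_real_smul_left, rinner_real_smul_right,
    rinner_real_smul_right] at hreeb
  simp only [Q.conn_vertField hp hΓ, rinner_sub_left, rinner_real_smul_left,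
    Finset.sum_sub_distrib, ← Finset.mul_sum, sum_rinner_connForm_imUnit_smul]
  rw [mul_sub, mul_left_comm, hreeb]
  field_simp
  ring

theorem ricci_horField [NeZero n] (hp : p ∈ Ω) (hpos : 0 < h p) (hΓ : Q.IsBiquardConnection Γ)
    {e : Fin (4 * n) → QHeis n} (he : Q.IsFrame p e) (A : Fin n → ℍ[ℝ]) :
    Q.ricci Γ p e (horField p A) (horField p A) =
      (2 * h p)⁻¹ * ((4 * n + 11 / 2) * rinner (hess h p A) A +
        3 / 2 * ∑ s, rinner (hess h p (imUnit s • A)) (imUnit s • A)) -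
      (4 * n + 10) * (2 * h p)⁻¹ ^ 2 * Quaternion.normSq (qinner A (grad h p)) +
      rinner A A * ((2 * h p)⁻¹ * (1 + 3 / (2 * n)) * lap h p -
        (4 * n + 12 + 6 / n) * (2 * h p)⁻¹ ^ 2 * rinner (grad h p) (grad h p)) := by
  have hnormSq : Quaternion.normSq (qinner A (wgrad h p)) =
      (2 * h p)⁻¹ ^ 2 * Quaternion.normSq (qinner A (grad h p)) := by
    rw [wgrad, qinner_real_smul_right, Quaternion.normSq_smul]
  have hself : rinner (wgrad h p) (wgrad h p) =
      (2 * h p)⁻¹ ^ 2 * rinner (grad h p) (grad h p) := by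
    rw [wgrad, rinner_real_smul_left, rinner_real_smul_right, pow_two, mul_assoc]
  have hvert := Q.four_sum_rinner_conn_vertField hp hpos hΓ A
  rw [Q.ricci_eq_sum hp hΓ he, sum_rinner_frameCurv]
  rw [hnormSq, hself] at *
  linear_combination -(1 / 2) * hvert

end QCStructure

/-! ### The qc-Einstein condition as an equation for the Hessian -/

section QuadraticForms

theorem normSq_imUnit (s : Fin 3) : Quaternion.normSq (imUnit s) = 1 := by
  fin_cases s <;> simp [Quaternion.normSq_def']

theorem imUnit_mul_imUnit_add_one (s : Fin 3) : imUnit s * imUnit (s + 1) = imUnit (s + 2) := by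
  fin_cases s <;> ext <;> simp [Quaternion.re_mul, Quaternion.imI_mul, Quaternion.imJ_mul,
    Quaternion.imK_mul]

theorem imUnit_add_one_mul_imUnit (s : Fin 3) : imUnit (s + 1) * imUnit s = -imUnit (s + 2) := by
  fin_cases s <;> ext <;> simp [Quaternion.re_mul, Quaternion.imI_mul, Quaternion.imJ_mul,
    Quaternion.imK_mul]

theorem sum_quatBasis_smul_imUnit_smul {ι : Type*} {H : (ι → ℍ[ℝ]) → ℝ}
    (hneg : ∀ A, H (-A) = H A) (s : Fin 3) (A : ι → ℍ[ℝ]) :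
    ∑ t, H (quatBasis t • imUnit s • A) = ∑ t, H (quatBasis t • A) := by
  have hcycle (f : Fin 3 → ℝ) : ∑ r, f r = f s + f (s + 1) + f (s + 2) := by
    fin_cases s <;> simp [Fin.sum_univ_three] <;> ring
  have hmul : imUnit (s + 2) * imUnit s = imUnit (s + 1) := by
    simpa only [add_assoc, show (2 + 1 : Fin 3) = 0 from rfl, show (2 + 2 : Fin 3) = 1 from rfl,
      add_zero] using imUnit_mul_imUnit_add_one (s + 2)
  simp only [Fin.sum_univ_succ (n := 3), quatBasis_succ, quatBasis_zero, one_smul, hcycle,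
    imUnit_smul_imUnit_smul, hneg]
  simp only [smul_smul, imUnit_add_one_mul_imUnit, hmul, neg_smul, hneg]
  ring

theorem apply_imUnit_smul_of_add_sum_eq {ι : Type*} {H N : (ι → ℍ[ℝ]) → ℝ}
    (hneg : ∀ A, H (-A) = H A) (hN : ∀ s A, N (imUnit s • A) = N A) {α β : ℝ} (hαβ : α ≠ β)
    (hH : ∀ A, α * H A + β * ∑ s, H (imUnit s • A) = N A) (s : Fin 3) (A : ι → ℍ[ℝ]) :
    H (imUnit s • A) = H A := by
  have hquat (A : ι → ℍ[ℝ]) : (α - β) * H A = N A - β * ∑ t, H (quatBasis t • A) := by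
    rw [← hH, Fin.sum_univ_succ (n := 3)]
    simp only [quatBasis_succ, quatBasis_zero, one_smul]
    ring
  refine mul_left_cancel₀ (sub_ne_zero.2 hαβ) ?_
  rw [hquat, hquat, hN, sum_quatBasis_smul_imUnit_smul hneg]

variable {ι : Type*} [Fintype ι]

theorem eq_of_rinner_self_eq {K L : (ι → ℍ[ℝ]) →+ (ι → ℍ[ℝ])}
    (hself : ∀ A, rinner (K A) A = rinner (L A) A)
    (hcomm : ∀ A B, rinner (K A) B - rinner (K B) A = rinner (L A) B - rinner (L B) A) :
    K = L := by
  refine AddMonoidHom.ext fun A => rinner_ext fun B => ?_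
  have hadd := hself (A + B)
  simp only [map_add, rinner_add_left, rinner_add_right] at hadd
  linear_combination (hadd - hself A - hself B + hcomm A B) / 2

theorem sum_normSq_qinner [DecidableEq ι] (u : ι → ℍ[ℝ]) :
    ∑ k, Quaternion.normSq (qinner (stdBasis k) u) = 4 * rinner u u := by
  simpa only [normSq_eq_re, star_qinner, one_mul, mul_one, Quaternion.re_one, rinner] using
    sum_re_qinner_left 1 1 u u

theorem rinner_quat_smul_self (a : ℍ[ℝ]) (A : ι → ℍ[ℝ]) : rinner (a • A) A = a.re * rinner A A := by
  rw [rinner_smul_left, qinner_self, Quaternion.mul_coe_eq_smul, Quaternion.re_smul, smul_eq_mul,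
    mul_comm]

theorem rinner_quat_smul_sub_comm (a : ℍ[ℝ]) (A B : ι → ℍ[ℝ]) :
    rinner (a • A) B - rinner (a • B) A = -2 * ∑ s, im s (qinner A B) * im s a := by
  rw [rinner_smul_left, rinner_smul_left, ← star_qinner A B]
  simp only [Quaternion.re_mul, Quaternion.re_star, Quaternion.imI_star, Quaternion.imJ_star,
    Quaternion.imK_star, Fin.sum_univ_three, im_zero, im_one, im_two]
  ring

theorem rinner_qinner_smul_comm (u A B : ι → ℍ[ℝ]) :
    rinner (qinner A u • u) B = rinner (qinner B u • u) A := by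
  rw [rinner_smul_left, rinner_smul_left, ← Quaternion.re_star, star_mul, star_qinner, star_qinner]

end QuadraticForms

/-- The function `λ` for which the horizontal Hessian of a qc-Einstein conformal factor `h` has
diagonal `λ |A|² + |(A, ∇h)|² / (2h)`, read off from the traces. -/
def hessTrace (h : QHeis n → ℝ) (p : QHeis n) : ℝ :=
  (lap h p - 4 * (2 * h p)⁻¹ * rinner (grad h p) (grad h p)) / (4 * n)

theorem sum_hess_imUnit (h : QHeis n → ℝ) (p : QHeis n) (s : Fin 3) :
    ∑ k, rinner (hess h p (imUnit s • stdBasis k)) (imUnit s • stdBasis k) = lap h p := by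
  rw [← quatBasis_succ]
  exact sum_quatBasis_smul s.succ (rinnerBilin (hess h p) LinearMap.id)

namespace QCStructure

variable {Ω : Set (QHeis n)} {h : QHeis n → ℝ} {p : QHeis n}
  {Γ : QHeis n → QHeis n →L[ℝ] QHeis n →L[ℝ] QHeis n} (Q : QCStructure n Ω (confForm h))
include Q

theorem contDiffOn_hessTrace (hpos : ∀ p ∈ Ω, 0 < h p) : ContDiffOn ℝ ∞ (hessTrace h) Ω := by
  have hgrad := contDiffOn_grad Q.isOpen Q.contDiffOn_conf
  have hlap : ContDiffOn ℝ ∞ (lap h) Ω := ContDiffOn.sum fun k _ => contDiffOn_rinner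
    ((hgrad.fderiv_of_isOpen Q.isOpen (by simp)).clm_apply (contDiffOn_horField (stdBasis k)))
    contDiffOn_const
  exact (hlap.sub ((contDiffOn_const.mul (contDiffOn_inv_two_mul Q.contDiffOn_conf hpos)).mul
    (contDiffOn_rinner hgrad hgrad))).div_const _

theorem rinner_hess_sub_comm (hp : p ∈ Ω) (A B : Fin n → ℍ[ℝ]) :
    rinner (hess h p A) B - rinner (hess h p B) A =
      -2 * ∑ s, rinner (imUnit s • A) B * fderiv ℝ h p (vertField s) := by
  have hderiv (X Y : Fin n → ℍ[ℝ]) :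
      fderiv ℝ (fun x => fderiv ℝ h x (horField x Y)) p (horField p X) =
        rinner (hess h p X) Y := by
    rw [funext fun x => (rinner_grad h x Y).symm,
      ((Q.hasDirDeriv_grad hp X).rinner (.const Y p _)).fderiv_eq, rinner_zero_right,
      add_zero]
  rw [← hderiv, ← hderiv]
  exact fderiv_horField_commutator (Q.contDiffOn_conf.contDiffAt (Q.isOpen.mem_nhds hp)) A B

variable [NeZero n] (hΓ : Q.IsBiquardConnection Γ) (hE : Q.IsQCEinstein Γ)
include hΓ hE

theorem scal_mul_rinner_self (hp : p ∈ Ω) (hpos : 0 < h p) {e : Fin (4 * n) → QHeis n}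
    (he : Q.IsFrame p e) (A : Fin n → ℍ[ℝ]) :
    Q.scal Γ p e / (4 * n) * ((2 * h p)⁻¹ * rinner A A) =
      (2 * h p)⁻¹ * ((4 * n + 11 / 2) * rinner (hess h p A) A +
        3 / 2 * ∑ s, rinner (hess h p (imUnit s • A)) (imUnit s • A)) -
      (4 * n + 10) * (2 * h p)⁻¹ ^ 2 * Quaternion.normSq (qinner A (grad h p)) +
      rinner A A * ((2 * h p)⁻¹ * (1 + 3 / (2 * n)) * lap h p -
        (4 * n + 12 + 6 / n) * (2 * h p)⁻¹ ^ 2 * rinner (grad h p) (grad h p)) := by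
  rw [← Q.g_horField hp, ← hE p hp e he _ (horField_mem h p A) _ (horField_mem h p A),
    Q.ricci_horField hp hpos hΓ he]

theorem scal_eq (hp : p ∈ Ω) (hpos : 0 < h p) {e : Fin (4 * n) → QHeis n} (he : Q.IsFrame p e) :
    Q.scal Γ p e = 8 * n * (n + 2) * (4 * hessTrace h p - rinner (grad h p) (grad h p) / h p) := by
  have htrace := Finset.sum_congr rfl fun k (_ : k ∈ Finset.univ) =>
    Q.scal_mul_rinner_self hΓ hE hp hpos he (stdBasis k)
  simp only [Finset.sum_add_distrib, Finset.sum_sub_distrib, ← Finset.mul_sum, ← Finset.sum_mul,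
    sum_rinner_stdBasis_self, sum_normSq_qinner] at htrace
  rw [Finset.sum_comm] at htrace
  simp only [sum_hess_imUnit, Finset.sum_const, Finset.card_univ, Fintype.card_fin,
    nsmul_eq_mul, Nat.cast_ofNat] at htrace
  rw [← lap] at htrace
  have hn : (n : ℝ) ≠ 0 := NeZero.ne _
  rw [hessTrace]
  field_simp at htrace ⊢
  linear_combination htrace

theorem rinner_hess_imUnit_smul (hp : p ∈ Ω) (hpos : 0 < h p) (s : Fin 3) (A : Fin n → ℍ[ℝ]) :
    rinner (hess h p (imUnit s • A)) (imUnit s • A) = rinner (hess h p A) A := by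
  have hEinstein := Q.scal_mul_rinner_self hΓ hE hp hpos (Q.isFrame_stdFrame hp hpos)
  let ρ : ℝ := Q.scal Γ p (stdFrame h p) / (4 * n) * (2 * h p)⁻¹ -
    ((2 * h p)⁻¹ * (1 + 3 / (2 * n)) * lap h p -
      (4 * n + 12 + 6 / n) * (2 * h p)⁻¹ ^ 2 * rinner (grad h p) (grad h p))
  have hcoeff : (2 * h p)⁻¹ * (4 * n + 11 / 2) ≠ (2 * h p)⁻¹ * (3 / 2) :=
    (mul_right_injective₀ (by positivity)).ne (by linarith [(Nat.cast_nonneg n : (0 : ℝ) ≤ n)])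
  refine apply_imUnit_smul_of_add_sum_eq (H := fun A => rinner (hess h p A) A)
    (N := fun A => ρ * rinner A A +
      (4 * n + 10) * (2 * h p)⁻¹ ^ 2 * Quaternion.normSq (qinner A (grad h p)))
    (fun A => ?_) (fun t A => ?_) hcoeff (fun A => ?_) s A
  · simp only [map_neg, rinner_neg_left, rinner_neg_right, neg_neg]
  · simp only [rinner_quat_smul_quat_smul, star_imUnit_mul_self, one_smul, qinner_smul_left,
      map_mul, normSq_imUnit, one_mul]
  · linear_combination -hEinstein A

theorem rinner_hess_self (hp : p ∈ Ω) (hpos : 0 < h p) (A : Fin n → ℍ[ℝ]) :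
    rinner (hess h p A) A = hessTrace h p * rinner A A +
      (2 * h p)⁻¹ * Quaternion.normSq (qinner A (grad h p)) := by
  have hA := Q.scal_mul_rinner_self hΓ hE hp hpos (Q.isFrame_stdFrame hp hpos) A
  rw [Q.scal_eq hΓ hE hp hpos (Q.isFrame_stdFrame hp hpos)] at hA
  simp only [Q.rinner_hess_imUnit_smul hΓ hE hp hpos, Finset.sum_const, Finset.card_univ,
    Fintype.card_fin, nsmul_eq_mul, Nat.cast_ofNat] at hA
  have hn : (n : ℝ) ≠ 0 := NeZero.ne _
  rw [hessTrace] at hA ⊢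
  field_simp at hA ⊢
  refine mul_left_cancel₀ (show (4 * n + 10 : ℝ) ≠ 0 by positivity) ?_
  linear_combination -hA

theorem hess_eq (hp : p ∈ Ω) (hpos : 0 < h p) (A : Fin n → ℍ[ℝ]) :
    hess h p A =
      confM h (hessTrace h) p • A + (2 * h p)⁻¹ • (qinner A (grad h p) • grad h p) := by
  let L : (Fin n → ℍ[ℝ]) →+ (Fin n → ℍ[ℝ]) := AddMonoidHom.mk'
    (fun A => confM h (hessTrace h) p • A + (2 * h p)⁻¹ • (qinner A (grad h p) • grad h p))
    fun A B => by simp only [qinner_add_left, smul_add, add_smul]; abel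
  suffices (hess h p : (Fin n → ℍ[ℝ]) →+ (Fin n → ℍ[ℝ])) = L from DFunLike.congr_fun this A
  refine eq_of_rinner_self_eq (fun A => ?_) fun A B => ?_
  · change rinner (hess h p A) A = rinner (_ + _) A
    rw [Q.rinner_hess_self hΓ hE hp hpos, rinner_add_left, rinner_quat_smul_self, re_confM,
      rinner_real_smul_left, rinner_smul_left, normSq_eq_re, star_qinner]
  · change rinner (hess h p A) B - rinner (hess h p B) A = rinner (_ + _) B - rinner (_ + _) A
    rw [Q.rinner_hess_sub_comm hp, rinner_add_left, rinner_add_left, rinner_real_smul_left,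
      rinner_real_smul_left, rinner_qinner_smul_comm, add_sub_add_right_eq_sub,
      rinner_quat_smul_sub_comm]
    simp only [rinner_imUnit_left, im_confM, mul_neg, neg_mul]

theorem hessSystem (hpos : ∀ p ∈ Ω, 0 < h p) : HessSystem Ω h (grad h) (hessTrace h) where
  isOpen := Q.isOpen
  contDiffOn_h := Q.contDiffOn_conf
  contDiffOn_u := contDiffOn_grad Q.isOpen Q.contDiffOn_conf
  contDiffOn_l := Q.contDiffOn_hessTrace hpos
  pos := hpos
  deriv_h p hp A := (Q.hasDirDeriv_of_contDiffOn Q.contDiffOn_conf hp (horField p A)).congr_deriv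
    (rinner_grad h p A).symm
  deriv_u p hp A := (Q.hasDirDeriv_grad hp A).congr_deriv (Q.hess_eq hΓ hE hp (hpos p hp) A)

theorem confSystem (hpos : ∀ p ∈ Ω, 0 < h p) (hΩ : IsPreconnected Ω)
    (hS : n = 1 → ∃ k : ℝ, Q.HasConstantScal Γ k) :
    ConfSystem Ω h (grad h) (confM h (hessTrace h)) := by
  refine (Q.hessSystem hΓ hE hpos).confSystem hΩ fun hn => ?_
  obtain ⟨k, hk⟩ := hS hn
  refine ⟨k / (8 * n * (n + 2)), fun p hp => ?_⟩
  have hframe := Q.isFrame_stdFrame hp (hpos p hp)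
  rw [← hk p hp _ hframe, Q.scal_eq hΓ hE hp (hpos p hp) hframe,
    mul_div_cancel_left₀ _ (by have := NeZero.ne (n : ℝ); positivity)]

theorem hasConstantScal_of_eq (hpos : ∀ p ∈ Ω, 0 < h p) {k : ℝ}
    (hk : ∀ p ∈ Ω,
      4 * (confM h (hessTrace h) p).re - rinner (grad h p) (grad h p) / h p = k) :
    Q.HasConstantScal Γ (8 * n * (n + 2) * k) := fun p hp e he => by
  rw [Q.scal_eq hΓ hE hp (hpos p hp) he, ← hk p hp, re_confM]

end QCStructure

theorem eq_zero_of_forall_affine_ne_zero {a : ℍ[ℝ]} {c : Fin n → ℍ[ℝ]}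
    (h : ∀ p : QHeis n, a + ∑ i, c i * star (qcoord p i) ≠ 0) : c = 0 := by
  by_contra hc
  refine h (horField 0 (-(rinner c c)⁻¹ • star a • c)) ?_
  change a + qinner c (qcoord _) = 0
  rw [qcoord_horField, qinner_real_smul_right, qinner_smul_right, star_star, qinner_self,
    Quaternion.coe_mul_eq_smul, smul_smul, neg_mul, inv_mul_cancel₀ (rinner_self_pos hc).ne',
    neg_smul, one_smul, add_neg_cancel]

end QC

end

theorem mainTheorem2 (n : ℕ) (hn : 1 ≤ n)
    (Ω : Set (QC.QHeis n)) (hΩ : IsOpen Ω) (hΩc : IsConnected Ω)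
    (h : QC.QHeis n → ℝ) (hsmooth : ContDiffOn ℝ ∞ h Ω) (hpos : ∀ p ∈ Ω, 0 < h p)
    (Q : QC.QCStructure n Ω (QC.confForm h))
    (Γ : QC.QHeis n → QC.QHeis n →L[ℝ] QC.QHeis n →L[ℝ] QC.QHeis n)
    (hΓ : Q.IsBiquardConnection Γ) (hE : Q.IsQCEinstein Γ)
    (hS : n = 1 → ∃ k : ℝ, Q.HasConstantScal Γ k) :
    (∃ (c₀ σ : ℝ) (q₀ : Fin n → ℍ[ℝ]) (ω₀ : Fin 3 → ℝ), 0 < c₀ ∧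
      (∀ p ∈ Ω, h p = c₀ * ((σ + ∑ i, ‖QC.qcoord p i + q₀ i‖ ^ 2) ^ 2 +
        ∑ s, (p.2 s + ω₀ s + 2 * QC.im s (∑ i, q₀ i * star (QC.qcoord p i))) ^ 2)) ∧
      Q.HasConstantScal Γ (128 * n * (n + 2) * c₀ * σ)) ∨
    (∃ (a : ℍ[ℝ]) (c : Fin n → ℍ[ℝ]), (Ω = Set.univ → c = 0) ∧
      (∀ p ∈ Ω, h p = ‖a + ∑ i, c i * star (QC.qcoord p i)‖ ^ 2) ∧
      Q.HasConstantScal Γ (-(32 * n * (n + 2) * ∑ i, ‖c i‖ ^ 2))) := by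
  have : NeZero n := ⟨by omega⟩
  have C := Q.confSystem hΓ hE hpos hΩc.isPreconnected hS
  rcases C.eq_zero_or_exists_normSq_eq with hM | ⟨c, hc, hM⟩
  · obtain ⟨a, c, hh, hscal⟩ := C.exists_eq_of_eq_zero hM hΩc.nonempty
    refine .inr ⟨a, c, ?_, hh, ?_⟩
    · rintro rfl
      refine QC.eq_zero_of_forall_affine_ne_zero (a := a) fun p hp => (hpos p trivial).ne' ?_
      rw [hh p trivial, hp, norm_zero, zero_pow two_ne_zero]
    · convert Q.hasConstantScal_of_eq hΓ hE hpos hscal using 1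
      ring
  · obtain ⟨c₀, σ, q₀, ω₀, hc₀, hh, hscal⟩ := C.exists_eq_of_normSq_eq hc hM
    refine .inl ⟨c₀, σ, q₀, ω₀, hc₀, hh, ?_⟩
    convert Q.hasConstantScal_of_eq hΓ hE hpos hscal using 1
    ring
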